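/- Let $d\ge 2$ and $m>0$. On Minkowski space $\mathbb R^{1,d-1}$ write $px=-p^0x^0+p^1x^1+\dots+p^{d-1}x^{d-1}$, $x^2=xx$, $\Box=-\partial_0^2+\partial_1^2+\dots+\partial_{d-1}^2$, $J^{\vee}=\{x^2\le 0,\ x^0\ge 0\}$ and $J^{\wedge}=\{x^2\le 0,\ x^0\le 0\}$. Let $U_\alpha$ be the principal branch on $\mathbb C\setminus\,]-\infty,0]$ of the analytic function given by $$U_\alpha(z)=\frac1{\sqrt\pi}\int_0^\infty e^{-t}e^{-z/t}t^{-\alpha-1}\,dt,\qquad \operatorname{Re}z>0 .$$ Upper signs below refer to $G^{\rm F}$ and lower signs to $G^{\overline{\rm F}}$; an expression containing $\mp i0$ denotes the limit, as $\epsilon\searrow0$, of the same expression with $\mp i\epsilon$, taken in the sense of tempered distributions. **Theorem.** The distributional limits $\frac{1}{-m^2+p^2\mp i0}$ exist in $\mathcal S'(\mathbb R^{1,d-1})$, and the tachyonic Feynman and anti-Feynman propagators, defined as their inverse Fourier transforms, satisfy, as tempered distributions on $\mathbb R^{1,d-1}$, $$G^{\mathrm F/\overline{\mathrm F}}(x)=\int\frac{e^{ipx}}{-m^2+p^2\mp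 i0}\,\frac{dp}{(2\pi)^d} =\frac{\sqrt\pi\,m^{d-2}(\mp i)^{d+1}}{(4\pi)^{d/2}}\;U_{\frac d2-1}\!\Big(\frac{m^2(-x^2\mp i0)}{4}\Big),$$ where in particular the limit on the right-hand side exists. On the open sets $\{x^2>0\}$ and $\{x^2<0\}$ these distributions are regular and are given respectively by the functions $$\frac{\pm i\sqrt\pi\,m^{d-2}e^{\mp i\pi(\frac d2-1)}}{(4\pi)^{d/2}}\,U_{\frac d2-1}\!\Big(\frac{m^2(-x^2\mp i0)}4\Big)\ \ (x^2>0),\qquad \frac{\pm i\sqrt\pi\,m^{d-2}e^{\mp i\pi(\frac d2-1)}}{(4\pi)^{d/2}}\,U_{\frac d2-1}\!\Big(\frac{m^2|x^2|}4\Big)\ \ (x^2<0),$$ where for $x^2>0$ the symbol $\mp i0$ denotes the pointwise boundary value. Consequently, $G^{\mathrm F}+G^{\overline{\mathrm F}}$ does not have causal support, i.e. its support is not contained in $J^\vee\cup J^\wedge$. Hence, if $G^{\vee}$ and $G^{\wedge}$ denote the forward and backward Green functions of the tachyonic Klein–Gordon equation, that is, the distributions on $\mathbb R^{1,d-1}$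 with $(-m^2-\Box)G^{\vee/\wedge}=\delta$ and $\operatorname{supp}G^\vee\subset J^\vee$, $\operatorname{supp}G^\wedge\subset J^\wedge$, then $$G^{\mathrm F}+G^{\overline{\mathrm F}}\neq G^{\vee}+G^{\wedge}.$$ -/

import Mathlib

open MeasureTheory Filter Topology Complex
open scoped SchwartzMap Distributions FourierTransform LineDeriv

noncomputable section

/-- Minkowski space `ℝ^{1,d-1}`; the coordinate with index `0` is time. -/
abbrev Minkowski (d : ℕ) : Type := EuclideanSpace ℝ (Fin d)

/-- The diagonal `(-1, 1, …, 1)` of the Minkowski metric. -/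
def minkowskiSign {d : ℕ} [NeZero d] (i : Fin d) : ℝ := if i = 0 then -1 else 1

/-- The Minkowski product `p x = -p⁰x⁰ + p¹x¹ + ⋯ + p^{d-1}x^{d-1}`. -/
def minkowskiProd {d : ℕ} [NeZero d] (p x : Minkowski d) : ℝ :=
  ∑ i, minkowskiSign i * p i * x i

/-- The square `x² = -(x⁰)² + (x¹)² + ⋯ + (x^{d-1})²`. -/
def minkowskiSq {d : ℕ} [NeZero d] (x : Minkowski d) : ℝ := minkowskiProd x x

/-- The future light cone `J^∨`. -/
def futureCone (d : ℕ) [NeZero d] : Set (Minkowski d) := {x | minkowskiSq x ≤ 0 ∧ 0 ≤ x 0}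

/-- The past light cone `J^∧`. -/
def pastCone (d : ℕ) [NeZero d] : Set (Minkowski d) := {x | minkowskiSq x ≤ 0 ∧ x 0 ≤ 0}

/-- The principal branch, on `ℂ ∖ ]-∞, 0]`, of the function
`U_α(z) = π^{-1/2} ∫₀^∞ e^{-t} e^{-z/t} t^{-α-1} dt` (`Re z > 0`). Substituting `t = √z s` gives
the formula below, which converges and is analytic wherever `Re √z > 0`, that is, on all of
`ℂ ∖ ]-∞, 0]`. In terms of the Macdonald function, `U_α(z) = 2 π^{-1/2} z^{-α/2} K_α(2√z)`. -/
def besselU (α z : ℂ) : ℂ :=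
  (1 / (√Real.pi : ℂ)) * z ^ (-α / 2) *
    ∫ s in Set.Ioi (0 : ℝ), cexp (-(z ^ (1 / 2 : ℂ)) * (s + 1 / s)) * (s : ℂ) ^ (-α - 1)

/-- On the positive half-line `besselU` is given by the usual integral. -/
theorem besselU_ofReal (α : ℂ) {r : ℝ} (hr : 0 < r) :
    besselU α r = (1 / (√Real.pi : ℂ)) *
      ∫ t in Set.Ioi (0 : ℝ), cexp (-t) * cexp (-(r : ℂ) / t) * (t : ℂ) ^ (-α - 1) := by
  have hq : 0 < √r := Real.sqrt_pos.2 hr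
  have hs : (r : ℂ) ^ (1 / 2 : ℂ) = ((√r : ℝ) : ℂ) := by
    rw [Real.sqrt_eq_rpow, Complex.ofReal_cpow hr.le]
    norm_num
  have hrr : (r : ℂ) = ((√r : ℝ) : ℂ) * ((√r : ℝ) : ℂ) := by
    rw [← Complex.ofReal_mul, Real.mul_self_sqrt hr.le]
  have hq0 : ((√r : ℝ) : ℂ) ≠ 0 := by exact_mod_cast hq.ne'
  have key := integral_comp_mul_left_Ioi
    (fun t : ℝ => cexp (-t) * cexp (-(r : ℂ) / t) * (t : ℂ) ^ (-α - 1)) 0 hq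
  rw [mul_zero] at key
  have h2 : ∫ t in Set.Ioi (0 : ℝ), cexp (-t) * cexp (-(r : ℂ) / t) * (t : ℂ) ^ (-α - 1)
      = ((√r : ℝ) : ℂ) * ∫ s in Set.Ioi (0 : ℝ), cexp (-((√r * s : ℝ) : ℂ)) *
        cexp (-(r : ℂ) / ((√r * s : ℝ) : ℂ)) * ((√r * s : ℝ) : ℂ) ^ (-α - 1) := by
    rw [key, Complex.real_smul, Complex.ofReal_inv, ← mul_assoc, mul_inv_cancel₀ hq0, one_mul]
  rw [h2, besselU, mul_assoc, hs]
  congr 1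
  rw [← integral_const_mul, ← integral_const_mul]
  refine setIntegral_congr_fun measurableSet_Ioi fun s hs' => ?_
  have hs0 : (0 : ℝ) < s := hs'
  have hsc : (s : ℂ) ≠ 0 := by exact_mod_cast hs0.ne'
  rw [← Complex.exp_add, Complex.ofReal_mul,
    Complex.mul_cpow_ofReal_nonneg hq.le hs0.le]
  have e1 : (r : ℂ) ^ (-α / 2) = ((√r : ℝ) : ℂ) * ((√r : ℝ) : ℂ) ^ (-α - 1) := by
    rw [hrr, Complex.mul_cpow_ofReal_nonneg hq.le hq.le, ← Complex.cpow_add _ _ hq0,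
      Complex.cpow_sub _ _ hq0, Complex.cpow_one, mul_div_cancel₀ _ hq0]
    congr 1
    ring
  rw [e1, hrr]
  have e2 : -((√r : ℝ) : ℂ) * ((s : ℂ) + 1 / s) = -(((√r : ℝ) : ℂ) * s) +
      -(((√r : ℝ) : ℂ) * ((√r : ℝ) : ℂ)) / (((√r : ℝ) : ℂ) * s) := by
    field_simp
    ring
  rw [e2]
  ring

/-- The linear automorphism `p ↦ (2π)⁻¹ (-p⁰, p¹, …, p^{d-1})`. -/
def minkowskiRescale (d : ℕ) [NeZero d] : Minkowski d ≃L[ℝ] Minkowski d :=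
  LinearEquiv.toContinuousLinearEquiv
    { toFun := fun p => WithLp.toLp 2 fun i => (2 * Real.pi)⁻¹ * (minkowskiSign i * p i)
      invFun := fun p => WithLp.toLp 2 fun i => 2 * Real.pi * (minkowskiSign i * p i)
      map_add' := fun p q => by ext i; simp; ring
      map_smul' := fun c p => by ext i; simp; ring
      left_inv := fun p => by
        ext i
        have := Real.pi_ne_zero
        by_cases h : i = 0 <;> simp [minkowskiSign, h] <;> field_simp
      right_inv := fun p => by
        ext i
        have := Real.pi_ne_zero
        by_cases h : i = 0 <;> simp [minkowskiSign, h] <;> field_simp }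

/-- The map `φ ↦ (p ↦ (2π)^{-d} ∫ e^{i p x} φ(x) dx)` on Schwartz functions, with the Minkowski
product in the exponent (see `minkowskiTransform_apply`). -/
def minkowskiTransform (d : ℕ) [NeZero d] : 𝓢(Minkowski d, ℂ) →L[ℂ] 𝓢(Minkowski d, ℂ) :=
  ((2 * Real.pi : ℂ) ^ d)⁻¹ •
    (SchwartzMap.compCLMOfContinuousLinearEquiv ℂ (minkowskiRescale d)).comp
      (FourierTransform.fourierInvCLM ℂ 𝓢(Minkowski d, ℂ))

theorem minkowskiTransform_apply {d : ℕ} [NeZero d] (φ : 𝓢(Minkowski d, ℂ)) (p : Minkowski d) :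
    minkowskiTransform d φ p =
      ((2 * Real.pi : ℂ) ^ d)⁻¹ * ∫ x, cexp (I * minkowskiProd p x) * φ x := by
  have h : ∀ x : Minkowski d,
      2 * Real.pi * inner ℝ x (minkowskiRescale d p) = minkowskiProd p x := by
    intro x
    have := Real.pi_ne_zero
    simp only [minkowskiRescale, minkowskiProd, PiLp.inner_apply, Finset.mul_sum]
    refine Finset.sum_congr rfl fun i _ => ?_
    simp
    field_simp
  simp only [minkowskiTransform, smul_apply,
    ContinuousLinearMap.comp_apply, smul_eq_mul]
  congr 1
  simp only [SchwartzMap.compCLMOfContinuousLinearEquiv_apply, Function.comp_apply,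
    FourierTransform.fourierInvCLM_apply, SchwartzMap.fourierInv_coe, Real.fourierInv_eq']
  refine integral_congr_ae (Eventually.of_forall fun x => ?_)
  simp only [smul_eq_mul]
  rw [h x, mul_comm I]

/-- The inverse Fourier transform `x ↦ ∫ e^{i p x} R(p) dp / (2π)^d` of a tempered distribution
on Minkowski space. -/
def minkowskiFourierInv {d : ℕ} [NeZero d] (R : 𝓢'(Minkowski d, ℂ)) : 𝓢'(Minkowski d, ℂ) :=
  PointwiseConvergenceCLM.precomp ℂ (minkowskiTransform d) R

theorem minkowskiFourierInv_apply {d : ℕ} [NeZero d] (R : 𝓢'(Minkowski d, ℂ))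
    (φ : 𝓢(Minkowski d, ℂ)) : minkowskiFourierInv R φ = R (minkowskiTransform d φ) := rfl

/-- `T = lim_{ε ↘ 0} f ε` in the sense of tempered distributions, each function `f ε` being
regarded as the regular distribution `φ ↦ ∫ f ε x * φ x dx`. -/
def IsDistributionalLimit {d : ℕ} (f : ℝ → Minkowski d → ℂ) (T : 𝓢'(Minkowski d, ℂ)) : Prop :=
  ∀ φ : 𝓢(Minkowski d, ℂ),
    (∀ ε : ℝ, 0 < ε → Integrable fun x => f ε x * φ x) ∧
      Tendsto (fun ε : ℝ => ∫ x, f ε x * φ x) (𝓝[>] 0) (𝓝 (T φ))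

/-- On the open set `Ω` the distribution `T` is regular, given by the function `f`. -/
def IsGivenOn {d : ℕ} (T : 𝓢'(Minkowski d, ℂ)) (Ω : Set (Minkowski d))
    (f : Minkowski d → ℂ) : Prop :=
  ∀ φ : 𝓢(Minkowski d, ℂ), HasCompactSupport φ → tsupport φ ⊆ Ω →
    Integrable (fun x => f x * φ x) ∧ T φ = ∫ x, f x * φ x

/-- `G(x) = ∫ e^{i p x} / (-m² + p² ∓ i0) dp / (2π)^d`: the tachyonic Feynman propagator for
`σ = 1` and the tachyonic anti-Feynman propagator for `σ = -1`. -/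
def IsTachyonicPropagator {d : ℕ} [NeZero d] (σ : ℤˣ) (m : ℝ) (G : 𝓢'(Minkowski d, ℂ)) : Prop :=
  ∃ R : 𝓢'(Minkowski d, ℂ),
    IsDistributionalLimit
      (fun ε p => 1 / (-(m : ℂ) ^ 2 + minkowskiSq p - ((σ : ℤ) : ℂ) * I * ε)) R ∧
    G = minkowskiFourierInv R

/-- The d'Alembertian `□ = -∂₀² + ∂₁² + ⋯ + ∂_{d-1}²` on distributions on Minkowski space. -/
def dAlembertian {d : ℕ} [NeZero d] (T : 𝓓'((⊤ : TopologicalSpace.Opens (Minkowski d)), ℂ)) :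
    𝓓'((⊤ : TopologicalSpace.Opens (Minkowski d)), ℂ) :=
  ∑ i : Fin d, minkowskiSign i •
    ∂_{EuclideanSpace.single i (1 : ℝ)} (∂_{EuclideanSpace.single i (1 : ℝ)} T)

/-- `(-m² - □) T = δ`. -/
def IsTachyonicGreen {d : ℕ} [NeZero d] (m : ℝ)
    (T : 𝓓'((⊤ : TopologicalSpace.Opens (Minkowski d)), ℂ)) : Prop :=
  -(m ^ 2) • T - dAlembertian T =
    Distribution.mapCLM Complex.ofRealCLM (Distribution.delta (0 : Minkowski d))

/-- The forward (retarded) tachyonic Green function `G^∨`: the Green function supported in the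
future light cone. -/
def IsForwardGreen {d : ℕ} [NeZero d] (m : ℝ)
    (T : 𝓓'((⊤ : TopologicalSpace.Opens (Minkowski d)), ℂ)) : Prop :=
  IsTachyonicGreen m T ∧ Distribution.dsupport T ⊆ futureCone d

/-- The backward (advanced) tachyonic Green function `G^∧`: the Green function supported in the
past light cone. -/
def IsBackwardGreen {d : ℕ} [NeZero d] (m : ℝ)
    (T : 𝓓'((⊤ : TopologicalSpace.Opens (Minkowski d)), ℂ)) : Prop :=
  IsTachyonicGreen m T ∧ Distribution.dsupport T ⊆ pastCone d

/-- A real test function, regarded as a complex Schwartz function. -/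
def testToSchwartz {d : ℕ} (φ : 𝓓((⊤ : TopologicalSpace.Opens (Minkowski d)), ℝ)) :
    𝓢(Minkowski d, ℂ) :=
  HasCompactSupport.toSchwartzMap (f := fun x => ((φ x : ℝ) : ℂ))
    (φ.hasCompactSupport.comp_left (g := fun r : ℝ => (r : ℂ)) Complex.ofReal_zero)
    (Complex.ofRealCLM.contDiff.comp φ.contDiff)

theorem testToSchwartz_apply {d : ℕ} (φ : 𝓓((⊤ : TopologicalSpace.Opens (Minkowski d)), ℝ))
    (x : Minkowski d) : testToSchwartz φ x = ((φ x : ℝ) : ℂ) := rfl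

end

/-! Write c = -iσ, so c² = -1, and α = d/2 - 1. The argument is Schwinger's parametrization with
enough control to reach the boundary. For ε > 0 one has 1/(p² - m² - iσε) = -c ∫₀^∞ e^{-(ε + c m²)s}
e^{c s p²} ds. Paired with the transform of a Schwartz function φ, this becomes the Laplace
transform, at a = ε + c m², of f(s) = `minkowskiEvolution`. In momentum space f is visibly bounded.
The Gaussian Fourier formula rewrites it as a constant times s^{-d/2} ∫ e^{-c x²/(4s)} φ(x) dx,
whence f' = O(s^{-2}) at infinity. For d = 2 this decay does not make f itself absolutely
integrable, so one integration by parts on ]1, ∞[ defines `abelIntegral`, which is continuous up to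
Re a = 0, a ≠ 0. Letting ε ↘ 0 gives the momentum-space limit.

In position space a factor e^{-η/s} is inserted and the integrals are exchanged. The inner integral
∫ s^{-α-1} e^{-as - b/s} ds with b = η + c x²/4 equals √π a^α U_α(ab), by rotating the ray of
integration (`integral_exp_neg_mul_sub_div_eq_besselU`). At a = c m² and η = ε/4 the argument ab is
exactly m²(-x² - iσε)/4. Hence both regularizations converge to the same number, `propagatorValue`:
one sends a to the imaginary axis at η = 0, the other sends η to 0 at a = c m². This proves
existence of the limits and their equality at once.

Off the light cone the limit is pointwise because b ↦ U_α(cb) extends continuously from Re b > 0 to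
Re b ≥ 0, b ≠ 0. The extension comes from the integral of e^{-2q cosh t} e^{kt} cosh^{-n} t, which
converges absolutely up to Re q = 0 once n > |k|; `coshLaplace_recurrence` raises n at the price of
powers of 1/q.

For the support claim, the sum of the two propagators at a spacelike point is, up to a nonzero
factor, a combination of the values of the Macdonald function at -iy and iy, with nonzero
coefficients. If it vanished for all y > 0, so would its Laplace moments against y^n e^{-ly}; as l ↘
0 these become a positive number times k₁(-2i)^{-(n+1)} + k₂(2i)^{-(n+1)}, which cannot vanish for
two consecutive n. So the sum is nonzero somewhere spacelike, where G^∨ + G^∧ vanishes. -/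

noncomputable section

/-! ### Boundary values of hyperbolic-cosine Laplace integrals. -/

/-- The weight `e^{kt} / cosh^n t`. -/
def expCoshWeight (k : ℝ) (n : ℕ) (t : ℝ) : ℝ := Real.exp (k * t) * (Real.cosh t)⁻¹ ^ n

theorem continuous_expCoshWeight (k : ℝ) (n : ℕ) : Continuous (expCoshWeight k n) := by
  unfold expCoshWeight
  have h : Continuous fun t : ℝ => (Real.cosh t)⁻¹ :=
    Real.continuous_cosh.inv₀ fun t => (Real.cosh_pos t).ne'
  fun_prop

theorem expCoshWeight_pos (k : ℝ) (n : ℕ) (t : ℝ) : 0 < expCoshWeight k n t :=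
  mul_pos (Real.exp_pos _) (pow_pos (inv_pos.2 (Real.cosh_pos t)) n)

theorem expCoshWeight_mul_inv_cosh_pow (k : ℝ) (n j : ℕ) (t : ℝ) :
    (Real.cosh t)⁻¹ ^ j * expCoshWeight k n t = expCoshWeight k (n + j) t := by
  unfold expCoshWeight; ring

theorem sinh_mul_expCoshWeight (k : ℝ) (n : ℕ) (t : ℝ) :
    Real.sinh t * expCoshWeight k n t =
      (expCoshWeight (k + 1) n t - expCoshWeight (k - 1) n t) / 2 := by
  unfold expCoshWeight
  rw [Real.sinh_eq, add_mul, sub_mul, Real.exp_add, Real.exp_sub, Real.exp_neg, one_mul]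
  have := (Real.exp_pos t).ne'
  field_simp

/-- This is cosh² = 1 + sinh². One factor sinh t in the last term is kept apart because it combines
with e^{-2q cosh t} into an exact derivative; the other is absorbed into the weights. -/
theorem expCoshWeight_eq_add (k : ℝ) (n : ℕ) (t : ℝ) :
    expCoshWeight k n t = expCoshWeight k (n + 2) t +
      Real.sinh t * (Real.sinh t * expCoshWeight k (n + 2) t) := by
  unfold expCoshWeight
  have h : Real.cosh t * (Real.cosh t)⁻¹ = 1 := mul_inv_cancel₀ (Real.cosh_pos t).ne'
  have h2 := Real.cosh_sq t
  have : (Real.cosh t)⁻¹ ^ n = (Real.cosh t)⁻¹ ^ (n + 2) * (Real.sinh t ^ 2 + 1) := by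
    rw [← h2, pow_add, mul_assoc, ← mul_pow, mul_comm (Real.cosh t)⁻¹, h]; ring
  rw [this]; ring

theorem hasDerivAt_expCoshWeight (k : ℝ) (n : ℕ) (t : ℝ) :
    HasDerivAt (expCoshWeight k n) (k * expCoshWeight k n t -
      n / 2 * (expCoshWeight (k + 1) (n + 1) t - expCoshWeight (k - 1) (n + 1) t)) t := by
  have h1 : HasDerivAt (fun t => Real.exp (k * t)) (Real.exp (k * t) * k) t := by
    simpa using ((hasDerivAt_id t).const_mul k).exp
  have hc := (Real.cosh_pos t).ne'
  have h2 := ((Real.hasDerivAt_cosh t).inv hc).pow n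
  refine (h1.mul h2).congr_deriv ?_
  have h3 := sinh_mul_expCoshWeight k (n + 1) t
  have h4 : (n : ℝ) / 2 * (expCoshWeight (k + 1) (n + 1) t - expCoshWeight (k - 1) (n + 1) t) =
      n * (Real.sinh t * expCoshWeight k (n + 1) t) := by rw [h3]; ring
  rw [h4]
  unfold expCoshWeight
  rcases n with _ | n
  · simp; ring
  · simp only [Nat.add_sub_cancel, Pi.inv_apply, Pi.pow_apply]
    push_cast
    rw [pow_succ _ (n + 1), pow_succ _ n]
    field_simp
    ring

theorem expCoshWeight_le_exp (k : ℝ) (n : ℕ) (t : ℝ) :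
    expCoshWeight k n t ≤ 2 ^ n * Real.exp ((k - n) * t) ∧
      expCoshWeight k n t ≤ 2 ^ n * Real.exp ((k + n) * t) := by
  have key : ∀ s : ℝ, Real.exp s / 2 ≤ Real.cosh t →
      expCoshWeight k n t ≤ 2 ^ n * Real.exp ((k * t) - n * s) := by
    intro s hs
    unfold expCoshWeight
    have : (Real.cosh t)⁻¹ ≤ 2 * Real.exp (-s) := by
      rw [Real.exp_neg]
      calc (Real.cosh t)⁻¹ ≤ (Real.exp s / 2)⁻¹ := by
            apply inv_anti₀ (by positivity) hs
        _ = _ := by rw [inv_div]; rfl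
    calc _ ≤ Real.exp (k * t) * (2 * Real.exp (-s)) ^ n := by gcongr
      _ = _ := by
        rw [mul_pow, ← Real.exp_nat_mul, sub_eq_add_neg, Real.exp_add]
        ring_nf
  constructor
  · convert! key t ?_ using 3
    · ring
    · rw [Real.cosh_eq]; linarith [Real.exp_pos (-t)]
  · convert! key (-t) ?_ using 3
    · ring
    · rw [Real.cosh_eq]; linarith [Real.exp_pos (t)]

theorem integrable_expCoshWeight {k : ℝ} {n : ℕ} (h : |k| < n) :
    Integrable (expCoshWeight k n) := by
  obtain ⟨h1, h2⟩ := abs_lt.1 h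
  rw [← integrableOn_univ, ← Set.Iic_union_Ioi (a := (0 : ℝ)), integrableOn_union]
  constructor
  · refine Integrable.mono' ((integrableOn_exp_mul_Iic (a := k + n) (by linarith) 0).const_mul (2 ^ n))
      (continuous_expCoshWeight k n).aestronglyMeasurable (Eventually.of_forall fun t => ?_)
    rw [Real.norm_of_nonneg (expCoshWeight_pos k n t).le]
    exact (expCoshWeight_le_exp k n t).2
  · refine Integrable.mono' ((integrableOn_exp_mul_Ioi (a := k - n) (by linarith) 0).const_mul (2 ^ n))
      (continuous_expCoshWeight k n).aestronglyMeasurable (Eventually.of_forall fun t => ?_)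
    rw [Real.norm_of_nonneg (expCoshWeight_pos k n t).le]
    exact (expCoshWeight_le_exp k n t).1

/-- Super-exponential decay of `e^{-r cosh t}` against the weights. -/
theorem exp_neg_cosh_le {r : ℝ} (hr : 0 < r) (N : ℕ) (t : ℝ) :
    Real.exp (-(r * Real.cosh t)) ≤ N.factorial / r ^ N * (Real.cosh t)⁻¹ ^ N := by
  have hc := Real.cosh_pos t
  have h := Real.pow_div_factorial_le_exp (x := r * Real.cosh t) (by positivity) N
  rw [Real.exp_neg]
  calc _ ≤ ((r * Real.cosh t) ^ N / N.factorial)⁻¹ := inv_anti₀ (by positivity) h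
    _ = _ := by rw [inv_div, mul_pow, inv_pow]; field_simp

theorem integrable_exp_neg_cosh {r : ℝ} (hr : 0 < r) (k : ℝ) (n : ℕ) :
    Integrable fun t => Real.exp (-(r * Real.cosh t)) * expCoshWeight k n t := by
  obtain ⟨N, hN⟩ := exists_nat_gt |k|
  have hi : Integrable (expCoshWeight k (n + N)) := by
    apply integrable_expCoshWeight; push_cast; linarith [Nat.cast_nonneg (α := ℝ) n]
  refine Integrable.mono' (hi.const_mul (N.factorial / r ^ N)) ?_ (Eventually.of_forall fun t => ?_)
  · have := continuous_expCoshWeight k n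
    exact Continuous.aestronglyMeasurable (by fun_prop)
  · have := expCoshWeight_pos k n t
    rw [Real.norm_of_nonneg (by positivity), ← expCoshWeight_mul_inv_cosh_pow, ← mul_assoc]
    gcongr
    exact exp_neg_cosh_le hr N t

/-- The integral `∫ e^{-2 q cosh t} e^{kt} / cosh^n t dt`. For `n = 0` it is `2 K_k(2q)`. -/
def coshLaplace (k : ℝ) (n : ℕ) (q : ℂ) : ℂ :=
  ∫ t : ℝ, cexp (-(2 * q * Real.cosh t)) * (expCoshWeight k n t : ℂ)

theorem norm_coshLaplace_integrand (k : ℝ) (n : ℕ) (q : ℂ) (t : ℝ) :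
    ‖cexp (-(2 * q * Real.cosh t)) * (expCoshWeight k n t : ℂ)‖ =
      Real.exp (-(2 * q.re * Real.cosh t)) * expCoshWeight k n t := by
  rw [norm_mul, Complex.norm_exp, Complex.norm_real,
    Real.norm_of_nonneg (expCoshWeight_pos k n t).le, Complex.neg_re, Complex.re_mul_ofReal]
  simp

theorem continuous_coshLaplace_integrand (k : ℝ) (n : ℕ) (q : ℂ) :
    Continuous fun t : ℝ => cexp (-(2 * q * Real.cosh t)) * (expCoshWeight k n t : ℂ) := by
  have := continuous_expCoshWeight k n
  fun_prop

theorem integrable_coshLaplace (k : ℝ) (n : ℕ) {q : ℂ} (hq : 0 < q.re) :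
    Integrable fun t : ℝ => cexp (-(2 * q * Real.cosh t)) * (expCoshWeight k n t : ℂ) := by
  refine Integrable.mono' (integrable_exp_neg_cosh (r := 2 * q.re) (by positivity) k n)
    (continuous_coshLaplace_integrand k n q).aestronglyMeasurable
    (Eventually.of_forall fun t => ?_)
  rw [norm_coshLaplace_integrand]

/-- Integration by parts: -2q sinh t e^{-2q cosh t} is the derivative of the exponential, and the
total derivative integrates to zero over the line. -/
theorem integral_sinh_mul_coshLaplace (k : ℝ) (n : ℕ) {q : ℂ} (hq : 0 < q.re) :
    2 * q * ∫ t : ℝ, cexp (-(2 * q * Real.cosh t)) * ((Real.sinh t * expCoshWeight k n t : ℝ) : ℂ) =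
      k * coshLaplace k n q -
        n / 2 * (coshLaplace (k + 1) (n + 1) q - coshLaplace (k - 1) (n + 1) q) := by
  have I1 := integrable_coshLaplace k n hq
  have I2 := integrable_coshLaplace (k + 1) (n + 1) hq
  have I3 := integrable_coshLaplace (k - 1) (n + 1) hq
  have I4 : Integrable fun t : ℝ =>
      cexp (-(2 * q * Real.cosh t)) * ((Real.sinh t * expCoshWeight k n t : ℝ) : ℂ) := by
    simp_rw [sinh_mul_expCoshWeight]
    refine (((integrable_coshLaplace (k + 1) n hq).sub
      (integrable_coshLaplace (k - 1) n hq)).div_const 2).congr (Eventually.of_forall fun t => ?_)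
    simp only [Pi.sub_apply]; push_cast; ring
  have hd : ∀ t : ℝ, HasDerivAt
      (fun t : ℝ => cexp (-(2 * q * Real.cosh t)) * (expCoshWeight k n t : ℂ))
      (-(2 * q) * (cexp (-(2 * q * Real.cosh t)) * ((Real.sinh t * expCoshWeight k n t : ℝ) : ℂ)) +
       (k * (cexp (-(2 * q * Real.cosh t)) * (expCoshWeight k n t : ℂ)) -
        n / 2 * (cexp (-(2 * q * Real.cosh t)) * (expCoshWeight (k + 1) (n + 1) t : ℂ) -
          cexp (-(2 * q * Real.cosh t)) * (expCoshWeight (k - 1) (n + 1) t : ℂ)))) t := by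
    intro t
    have h1 : HasDerivAt (fun t : ℝ => cexp (-(2 * q * Real.cosh t)))
        (cexp (-(2 * q * Real.cosh t)) * -(2 * q * Real.sinh t)) t :=
      (((Real.hasDerivAt_cosh t).ofReal_comp.const_mul (2 * q)).neg).cexp
    have h2 := (hasDerivAt_expCoshWeight k n t).ofReal_comp
    refine (h1.mul h2).congr_deriv ?_
    push_cast; ring
  have I5 : Integrable fun t : ℝ =>
      cexp (-(2 * q * Real.cosh t)) * (expCoshWeight (k + 1) (n + 1) t : ℂ) -
        cexp (-(2 * q * Real.cosh t)) * (expCoshWeight (k - 1) (n + 1) t : ℂ) := I2.sub I3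
  have I6 : Integrable fun t : ℝ => k * (cexp (-(2 * q * Real.cosh t)) * (expCoshWeight k n t : ℂ)) -
      n / 2 * (cexp (-(2 * q * Real.cosh t)) * (expCoshWeight (k + 1) (n + 1) t : ℂ) -
        cexp (-(2 * q * Real.cosh t)) * (expCoshWeight (k - 1) (n + 1) t : ℂ)) :=
    (I1.const_mul _).sub (I5.const_mul _)
  have := integral_eq_zero_of_hasDerivAt_of_integrable hd ((I4.const_mul _).add I6) I1
  rw [integral_add (I4.const_mul _) I6, integral_sub (I1.const_mul _) (I5.const_mul _),
    integral_const_mul, integral_const_mul, integral_const_mul, integral_sub I2 I3] at this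
  simp only [coshLaplace]
  linear_combination -this

/-- In every term on the right the excess n - |k| has grown by at least 1, at the cost of at most
one factor 1/q. Iterating reaches weights that are integrable by themselves, without help from the
exponential. -/
theorem coshLaplace_recurrence (k : ℝ) (n : ℕ) {q : ℂ} (hq : 0 < q.re) :
    coshLaplace k n q = coshLaplace k (n + 2) q + q⁻¹ *
      (((k + 1) / 4 : ℝ) * coshLaplace (k + 1) (n + 2) q +
       (-(n + 2) / 8 : ℝ) * coshLaplace (k + 2) (n + 3) q +
       ((n + 2) / 4 : ℝ) * coshLaplace k (n + 3) q +
       (-(k - 1) / 4 : ℝ) * coshLaplace (k - 1) (n + 2) q +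
       (-(n + 2) / 8 : ℝ) * coshLaplace (k - 2) (n + 3) q) := by
  have hq0 : q ≠ 0 := by rintro rfl; simp at hq
  have A := integral_sinh_mul_coshLaplace (k + 1) (n + 2) hq
  have B := integral_sinh_mul_coshLaplace (k - 1) (n + 2) hq
  have J : ∀ k, Integrable fun t : ℝ => cexp (-(2 * q * Real.cosh t)) *
      ((Real.sinh t * expCoshWeight k (n + 2) t : ℝ) : ℂ) := by
    intro k
    simp_rw [sinh_mul_expCoshWeight]
    refine (((integrable_coshLaplace (k + 1) (n + 2) hq).sub
      (integrable_coshLaplace (k - 1) (n + 2) hq)).div_const 2).congr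
      (Eventually.of_forall fun t => ?_)
    simp only [Pi.sub_apply]; push_cast; ring
  have C : coshLaplace k n q = coshLaplace k (n + 2) q + 2⁻¹ *
      ((∫ t : ℝ, cexp (-(2 * q * Real.cosh t)) *
        ((Real.sinh t * expCoshWeight (k + 1) (n + 2) t : ℝ) : ℂ)) -
      ∫ t : ℝ, cexp (-(2 * q * Real.cosh t)) *
        ((Real.sinh t * expCoshWeight (k - 1) (n + 2) t : ℝ) : ℂ)) := by
    have JJ : Integrable fun t : ℝ => 2⁻¹ *
        (cexp (-(2 * q * Real.cosh t)) *
          ((Real.sinh t * expCoshWeight (k + 1) (n + 2) t : ℝ) : ℂ) -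
        cexp (-(2 * q * Real.cosh t)) *
          ((Real.sinh t * expCoshWeight (k - 1) (n + 2) t : ℝ) : ℂ)) :=
      ((J _).sub (J _)).const_mul _
    rw [← integral_sub (J _) (J _), ← integral_const_mul]
    unfold coshLaplace
    rw [← integral_add (integrable_coshLaplace _ _ hq) JJ]
    refine integral_congr_ae (Eventually.of_forall fun t => ?_)
    simp only
    rw [expCoshWeight_eq_add k n t, sinh_mul_expCoshWeight k]
    rw [mul_div_assoc', mul_sub, mul_comm (Real.sinh t)]
    push_cast; ring
  have e1 : k + 1 + 1 = k + 2 := by ring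
  have e2 : k + 1 - 1 = k := by ring
  have e3 : k - 1 + 1 = k := by ring
  have e4 : k - 1 - 1 = k - 2 := by ring
  have e5 : n + 2 + 1 = n + 3 := rfl
  rw [e1, e2, e5] at A
  rw [e3, e4, e5] at B
  rw [C]
  generalize (∫ t : ℝ, cexp (-(2 * q * Real.cosh t)) *
        ((Real.sinh t * expCoshWeight (k + 1) (n + 2) t : ℝ) : ℂ)) = X at A ⊢
  generalize (∫ t : ℝ, cexp (-(2 * q * Real.cosh t)) *
        ((Real.sinh t * expCoshWeight (k - 1) (n + 2) t : ℝ) : ℂ)) = Y at B ⊢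
  have hqi : q⁻¹ * q = 1 := inv_mul_cancel₀ hq0
  push_cast at A B ⊢
  linear_combination (q⁻¹ / 4) * A - (q⁻¹ / 4) * B - (1 / 2) * (X - Y) * hqi

/-- `F`, given for `Re q > 0`, extends continuously to `{Re q ≥ 0} ∖ {0}`, with a polynomial bound in
`1 / |q|`. -/
def HasBoundaryExtension (F : ℂ → ℂ) : Prop :=
  ∃ G : ℂ → ℂ, ContinuousOn G {q | 0 ≤ q.re ∧ q ≠ 0} ∧ (∀ q, 0 < q.re → G q = F q) ∧
    ∃ (C : ℝ) (N : ℕ), 0 ≤ C ∧ ∀ q, 0 ≤ q.re → q ≠ 0 → ‖G q‖ ≤ C * (1 + ‖q‖⁻¹) ^ N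

namespace HasBoundaryExtension

theorem congr {F F' : ℂ → ℂ} (h : HasBoundaryExtension F) (e : ∀ q, 0 < q.re → F q = F' q) :
    HasBoundaryExtension F' := by
  obtain ⟨G, h1, h2, h3⟩ := h
  exact ⟨G, h1, fun q hq => (h2 q hq).trans (e q hq), h3⟩

theorem add {F F' : ℂ → ℂ} (h : HasBoundaryExtension F) (h' : HasBoundaryExtension F') :
    HasBoundaryExtension fun q => F q + F' q := by
  obtain ⟨G, h1, h2, C, N, hC, h3⟩ := h
  obtain ⟨G', h1', h2', C', N', hC', h3'⟩ := h'
  refine ⟨fun q => G q + G' q, h1.add h1', fun q hq => by simp only [h2 q hq, h2' q hq],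
    C + C', N + N', by positivity, fun q hq hq0 => ?_⟩
  have one : (1 : ℝ) ≤ 1 + ‖q‖⁻¹ := by simp
  calc ‖G q + G' q‖ ≤ C * (1 + ‖q‖⁻¹) ^ N + C' * (1 + ‖q‖⁻¹) ^ N' :=
        (norm_add_le _ _).trans (add_le_add (h3 q hq hq0) (h3' q hq hq0))
    _ ≤ C * (1 + ‖q‖⁻¹) ^ (N + N') + C' * (1 + ‖q‖⁻¹) ^ (N + N') := by
        gcongr <;> first | exact one | omega
    _ = _ := by ring

theorem const_mul {F : ℂ → ℂ} (h : HasBoundaryExtension F) (c : ℂ) :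
    HasBoundaryExtension fun q => c * F q := by
  obtain ⟨G, h1, h2, C, N, hC, h3⟩ := h
  refine ⟨fun q => c * G q, continuousOn_const.mul h1, fun q hq => by simp only [h2 q hq],
    ‖c‖ * C, N, by positivity, fun q hq hq0 => ?_⟩
  rw [norm_mul, mul_assoc]
  gcongr
  exact h3 q hq hq0

theorem inv_mul {F : ℂ → ℂ} (h : HasBoundaryExtension F) :
    HasBoundaryExtension fun q => q⁻¹ * F q := by
  obtain ⟨G, h1, h2, C, N, hC, h3⟩ := h
  refine ⟨fun q => q⁻¹ * G q, (continuousOn_id.inv₀ fun q hq => hq.2).mul h1,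
    fun q hq => by simp only [h2 q hq], C, N + 1, hC, fun q hq hq0 => ?_⟩
  rw [norm_mul, norm_inv, pow_succ, ← mul_assoc, mul_comm]
  gcongr
  · exact h3 q hq hq0
  · linarith

end HasBoundaryExtension

/-- Induction on the number N of recurrence steps still needed. For N = 0 one has |k| < n, so the
weight is integrable and dominates the integrand on the whole closed half-plane; each step uses up
exactly one unit of the deficit. -/
theorem hasBoundaryExtension_coshLaplace_aux (N : ℕ) :
    ∀ (k : ℝ) (n : ℕ), |k| + 1 ≤ n + N → HasBoundaryExtension (coshLaplace k n) := by
  induction N with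
  | zero =>
    intro k n h
    have hi : Integrable (expCoshWeight k n) := by
      apply integrable_expCoshWeight; push_cast at h; linarith
    have hb : ∀ q : ℂ, 0 ≤ q.re → ∀ t : ℝ,
        ‖cexp (-(2 * q * Real.cosh t)) * (expCoshWeight k n t : ℂ)‖ ≤ expCoshWeight k n t := by
      intro q hq t
      rw [norm_coshLaplace_integrand]
      refine mul_le_of_le_one_left (expCoshWeight_pos k n t).le (Real.exp_le_one_iff.2 ?_)
      have := Real.cosh_pos t
      have : 0 ≤ 2 * q.re * Real.cosh t := by positivity
      linarith
    refine ⟨coshLaplace k n, ?_, fun _ _ => rfl, ∫ t, expCoshWeight k n t, 0,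
      integral_nonneg fun t => (expCoshWeight_pos k n t).le, fun q hq hq0 => ?_⟩
    · refine continuousOn_of_dominated (bound := expCoshWeight k n)
        (fun q _ => (continuous_coshLaplace_integrand k n q).aestronglyMeasurable)
        (fun q hq => Eventually.of_forall (hb q hq.1)) hi (Eventually.of_forall fun t => ?_)
      exact Continuous.continuousOn (by fun_prop)
    · rw [pow_zero, mul_one]
      exact norm_integral_le_of_norm_le hi (Eventually.of_forall (hb q hq))
  | succ N ih =>
    intro k n h
    push_cast at h
    have a1 : |k + 1| ≤ |k| + 1 := by simpa using abs_add_le k 1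
    have a2 : |k - 1| ≤ |k| + 1 := by simpa using abs_sub k 1
    have a3 : |k + 2| ≤ |k| + 2 := by simpa using abs_add_le k 2
    have a4 : |k - 2| ≤ |k| + 2 := by simpa using abs_sub k 2
    have h0 := ih k (n + 2) (by push_cast; linarith)
    have h1 := ih (k + 1) (n + 2) (by push_cast; linarith)
    have h2 := ih (k + 2) (n + 3) (by push_cast; linarith)
    have h3 := ih k (n + 3) (by push_cast; linarith)
    have h4 := ih (k - 1) (n + 2) (by push_cast; linarith)
    have h5 := ih (k - 2) (n + 3) (by push_cast; linarith)
    exact (h0.add (((((h1.const_mul _).add (h2.const_mul _)).add (h3.const_mul _)).add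
      (h4.const_mul _)).add (h5.const_mul _)).inv_mul).congr
      fun q hq => (coshLaplace_recurrence k n hq).symm

theorem hasBoundaryExtension_coshLaplace (k : ℝ) (n : ℕ) :
    HasBoundaryExtension (coshLaplace k n) := by
  obtain ⟨N, hN⟩ := exists_nat_ge (|k| + 1)
  exact hasBoundaryExtension_coshLaplace_aux N k n (by linarith [Nat.cast_nonneg (α := ℝ) n])


/-! ### The two-parameter integral for U_α by rotation of the ray. -/

theorem integral_Ioi_zero_eq_integral_exp (g : ℝ → ℂ) :
    ∫ s in Set.Ioi (0 : ℝ), g s = ∫ t : ℝ, (Real.exp t : ℂ) * g (Real.exp t) := by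
  have := integral_image_eq_integral_abs_deriv_smul (s := Set.univ) MeasurableSet.univ
    (fun x _ => (Real.hasDerivAt_exp x).hasDerivWithinAt) Real.exp_injective.injOn g
  rw [Set.image_univ, Real.range_exp] at this
  rw [this, setIntegral_univ]
  refine integral_congr_ae (Eventually.of_forall fun t => ?_)
  simp [abs_of_pos (Real.exp_pos t)]

theorem exp_mul_rpow_neg_sub_one (α t : ℝ) :
    Real.exp t * Real.exp t ^ (-α - 1) = Real.exp (-α * t) := by
  rw [← Real.exp_mul, ← Real.exp_add]; congr 1; ring

/-- Under s = e^t the exponent s + 1/s becomes 2 cosh t. -/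
theorem besselU_eq_coshLaplace (α : ℝ) (z : ℂ) :
    besselU α z = (1 / (√Real.pi : ℂ)) * z ^ (-(α : ℂ) / 2) *
      coshLaplace (-α) 0 (z ^ (1 / 2 : ℂ)) := by
  unfold besselU coshLaplace
  congr 1
  rw [integral_Ioi_zero_eq_integral_exp]
  refine integral_congr_ae (Eventually.of_forall fun t => ?_)
  have h1 : ((Real.exp t : ℝ) : ℂ) ^ (-(α : ℂ) - 1) = ((Real.exp t ^ (-α - 1) : ℝ) : ℂ) := by
    rw [Complex.ofReal_cpow (Real.exp_pos t).le]; push_cast; rfl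
  have h2 : expCoshWeight (-α) 0 t = Real.exp t * Real.exp t ^ (-α - 1) := by
    rw [exp_mul_rpow_neg_sub_one]; simp [expCoshWeight]
  have h3 : -(z ^ (1 / 2 : ℂ)) * ((Real.exp t : ℂ) + 1 / (Real.exp t : ℂ)) =
      -(2 * z ^ (1 / 2 : ℂ) * Real.cosh t) := by
    rw [Real.cosh_eq, one_div (Real.exp t : ℂ), ← Complex.ofReal_inv, ← Real.exp_neg]
    push_cast; ring
  simp only
  rw [h1, h2, h3]
  push_cast
  ring

/-- The rotated integrand for the integral `∫ s^{-α-1} e^{-a s - b / s} ds`, `s = e^{t + θζ}`. -/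
def rotatedIntegrand (α : ℝ) (a b ζ : ℂ) (θ t : ℝ) : ℂ :=
  cexp (-(a * cexp (θ * ζ) * Real.exp t) - b * cexp (-(θ * ζ)) * Real.exp (-t) - α * (t + θ * ζ))

theorem continuous_rotatedIntegrand (α : ℝ) (a b ζ : ℂ) (θ : ℝ) :
    Continuous (rotatedIntegrand α a b ζ θ) := by
  unfold rotatedIntegrand; fun_prop

theorem norm_rotatedIntegrand_le {α r M : ℝ} {a b ζ : ℂ} {θ : ℝ}
    (ha : r ≤ (a * cexp (θ * ζ)).re) (hb : r ≤ (b * cexp (-(θ * ζ))).re)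
    (hM : Real.exp (-(α * (θ * ζ.re))) ≤ M) (t : ℝ) :
    ‖rotatedIntegrand α a b ζ θ t‖ ≤
      M * (Real.exp (-(2 * r * Real.cosh t)) * expCoshWeight (-α) 0 t) := by
  unfold rotatedIntegrand
  rw [Complex.norm_exp]
  have e : (-(a * cexp (θ * ζ) * Real.exp t) - b * cexp (-(θ * ζ)) * Real.exp (-t) -
      α * (t + θ * ζ)).re = -((a * cexp (θ * ζ)).re * Real.exp t) -
      (b * cexp (-(θ * ζ))).re * Real.exp (-t) - α * t - α * (θ * ζ.re) := by
    rw [Complex.sub_re, Complex.sub_re, Complex.neg_re, Complex.re_mul_ofReal,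
      Complex.re_mul_ofReal, Complex.re_ofReal_mul, Complex.add_re, Complex.re_ofReal_mul,
      Complex.ofReal_re]
    ring
  rw [e]
  have w : expCoshWeight (-α) 0 t = Real.exp (-(α * t)) := by simp [expCoshWeight]
  calc _ ≤ Real.exp (-(2 * r * Real.cosh t) + -(α * t) + -(α * (θ * ζ.re))) := by
        apply Real.exp_le_exp.2
        have h1 := mul_le_mul_of_nonneg_right ha (Real.exp_pos t).le
        have h2 := mul_le_mul_of_nonneg_right hb (Real.exp_pos (-t)).le
        rw [Real.cosh_eq]
        linarith
    _ = Real.exp (-(α * (θ * ζ.re))) * (Real.exp (-(2 * r * Real.cosh t)) *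
          expCoshWeight (-α) 0 t) := by rw [w, Real.exp_add, Real.exp_add]; ring
    _ ≤ _ := by
        gcongr
        exact mul_nonneg (Real.exp_pos _).le (expCoshWeight_pos _ _ _).le

/-- The common factor of the derivatives of `rotatedIntegrand` in `t` and in `θ`. -/
def rotatedDeriv (α : ℝ) (a b ζ : ℂ) (θ t : ℝ) : ℂ :=
  (-(a * cexp (θ * ζ) * Real.exp t) + b * cexp (-(θ * ζ)) * Real.exp (-t) - α) *
    rotatedIntegrand α a b ζ θ t

theorem hasDerivAt_rotatedIntegrand (α : ℝ) (a b ζ : ℂ) (θ t : ℝ) :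
    HasDerivAt (fun t => rotatedIntegrand α a b ζ θ t) (rotatedDeriv α a b ζ θ t) t := by
  unfold rotatedIntegrand rotatedDeriv
  have h1 := ((Real.hasDerivAt_exp t).ofReal_comp.const_mul (a * cexp (θ * ζ))).neg
  have h2 := (((hasDerivAt_neg t).exp).ofReal_comp.const_mul (b * cexp (-(θ * ζ))))
  have h3 := ((hasDerivAt_id t).ofReal_comp.add_const (θ * ζ)).const_mul (α : ℂ)
  refine (((h1.sub h2).sub h3).cexp).congr_deriv ?_
  simp only [rotatedIntegrand, Pi.sub_apply, Pi.neg_apply, id]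
  push_cast
  ring

/-- The integrand is a holomorphic function of t + θζ, so its θ-derivative is ζ times its
t-derivative. -/
theorem hasDerivAt_rotatedIntegrand_angle (α : ℝ) (a b ζ : ℂ) (θ t : ℝ) :
    HasDerivAt (fun θ => rotatedIntegrand α a b ζ θ t) (ζ * rotatedDeriv α a b ζ θ t) θ := by
  unfold rotatedIntegrand rotatedDeriv
  have h0 : HasDerivAt (fun θ : ℝ => (θ : ℂ) * ζ) ζ θ := by
    simpa using (hasDerivAt_id θ).ofReal_comp.mul_const ζ
  have h1 := ((h0.cexp.const_mul a).mul_const (Real.exp t : ℂ)).neg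
  have h2 := ((h0.neg.cexp.const_mul b).mul_const (Real.exp (-t) : ℂ))
  have h3 := (h0.const_add (t : ℂ)).const_mul (α : ℂ)
  refine (((h1.sub h2).sub h3).cexp).congr_deriv ?_
  simp only [rotatedIntegrand, Pi.sub_apply, Pi.neg_apply]
  ring

theorem norm_rotatedDeriv_le {α r M R : ℝ} {a b ζ : ℂ} {θ : ℝ}
    (ha : r ≤ (a * cexp (θ * ζ)).re) (hb : r ≤ (b * cexp (-(θ * ζ))).re)
    (hM : Real.exp (-(α * (θ * ζ.re))) ≤ M)
    (ha' : ‖a * cexp (θ * ζ)‖ ≤ R) (hb' : ‖b * cexp (-(θ * ζ))‖ ≤ R) (t : ℝ) :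
    ‖rotatedDeriv α a b ζ θ t‖ ≤
      M * (R * (Real.exp (-(2 * r * Real.cosh t)) * expCoshWeight (1 - α) 0 t) +
        R * (Real.exp (-(2 * r * Real.cosh t)) * expCoshWeight (-1 - α) 0 t) +
        |α| * (Real.exp (-(2 * r * Real.cosh t)) * expCoshWeight (-α) 0 t)) := by
  have h := norm_rotatedIntegrand_le (α := α) ha hb hM t
  have h' : ‖-(a * cexp (θ * ζ) * Real.exp t) + b * cexp (-(θ * ζ)) * Real.exp (-t) - α‖ ≤
      R * Real.exp t + R * Real.exp (-t) + |α| := by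
    refine (norm_sub_le _ _).trans (add_le_add ((norm_add_le _ _).trans (add_le_add ?_ ?_)) ?_)
    · rw [norm_neg, norm_mul, Complex.norm_real, Real.norm_of_nonneg (Real.exp_pos t).le]
      gcongr
    · rw [norm_mul, Complex.norm_real, Real.norm_of_nonneg (Real.exp_pos _).le]
      gcongr
    · rw [Complex.norm_real, Real.norm_eq_abs]
  have w1 : expCoshWeight (1 - α) 0 t = Real.exp t * expCoshWeight (-α) 0 t := by
    simp only [expCoshWeight, pow_zero, mul_one, ← Real.exp_add]; ring_nf
  have w2 : expCoshWeight (-1 - α) 0 t = Real.exp (-t) * expCoshWeight (-α) 0 t := by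
    simp only [expCoshWeight, pow_zero, mul_one, ← Real.exp_add]; ring_nf
  unfold rotatedDeriv
  rw [norm_mul, w1, w2]
  calc _ ≤ (R * Real.exp t + R * Real.exp (-t) + |α|) *
        (M * (Real.exp (-(2 * r * Real.cosh t)) * expCoshWeight (-α) 0 t)) := by
        have : 0 ≤ R := (norm_nonneg _).trans ha'
        gcongr
    _ = _ := by ring

/-- Differentiating under the integral gives ζ times the integral of a total t-derivative, which is
zero. This replaces Cauchy's theorem; positivity of the two real parts keeps the decay uniform for θ
near θ₀. -/
theorem hasDerivAt_integral_rotatedIntegrand (α : ℝ) {a b ζ : ℂ} {θ₀ : ℝ}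
    (ha : 0 < (a * cexp (θ₀ * ζ)).re) (hb : 0 < (b * cexp (-(θ₀ * ζ))).re) :
    HasDerivAt (fun θ => ∫ t, rotatedIntegrand α a b ζ θ t) 0 θ₀ := by
  obtain ⟨r, hr, hra, hrb⟩ : ∃ r : ℝ, 0 < r ∧ r < (a * cexp (θ₀ * ζ)).re ∧
      r < (b * cexp (-(θ₀ * ζ))).re := by
    obtain ⟨r, h, h'⟩ := exists_between (lt_min ha hb)
    exact ⟨r, h, h'.trans_le (min_le_left _ _), h'.trans_le (min_le_right _ _)⟩
  obtain ⟨R, hRa, hRb⟩ : ∃ R : ℝ, ‖a * cexp (θ₀ * ζ)‖ < R ∧ ‖b * cexp (-(θ₀ * ζ))‖ < R := by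
    obtain ⟨R, h⟩ := exists_gt (max ‖a * cexp (θ₀ * ζ)‖ ‖b * cexp (-(θ₀ * ζ))‖)
    exact ⟨R, (le_max_left _ _).trans_lt h, (le_max_right _ _).trans_lt h⟩
  obtain ⟨M, hM⟩ : ∃ M : ℝ, Real.exp (-(α * (θ₀ * ζ.re))) < M := exists_gt _
  have ca : Continuous fun θ : ℝ => a * cexp (θ * ζ) := by fun_prop
  have cb : Continuous fun θ : ℝ => b * cexp (-(θ * ζ)) := by fun_prop
  have cM : Continuous fun θ : ℝ => Real.exp (-(α * (θ * ζ.re))) := by fun_prop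
  have ev : ∀ᶠ θ : ℝ in 𝓝 θ₀, r < (a * cexp (θ * ζ)).re ∧ r < (b * cexp (-(θ * ζ))).re ∧
      ‖a * cexp (θ * ζ)‖ < R ∧ ‖b * cexp (-(θ * ζ))‖ < R ∧
      Real.exp (-(α * (θ * ζ.re))) < M :=
    ((Complex.continuous_re.comp ca).continuousAt.eventually_const_lt hra).and <|
      ((Complex.continuous_re.comp cb).continuousAt.eventually_const_lt hrb).and <|
      (ca.norm.continuousAt.eventually_lt_const hRa).and <|
      (cb.norm.continuousAt.eventually_lt_const hRb).and
        (cM.continuousAt.eventually_lt_const hM)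
  have h2r : 0 < 2 * r := by positivity
  have B := (((((integrable_exp_neg_cosh h2r (1 - α) 0).const_mul R).add
    ((integrable_exp_neg_cosh h2r (-1 - α) 0).const_mul R)).add
    ((integrable_exp_neg_cosh h2r (-α) 0).const_mul |α|)).const_mul M)
  have cD : ∀ θ, Continuous (rotatedDeriv α a b ζ θ) := fun θ => by
    have := continuous_rotatedIntegrand α a b ζ θ
    unfold rotatedDeriv; fun_prop
  have ev0 := ev.self_of_nhds
  have I0 : Integrable (rotatedIntegrand α a b ζ θ₀) :=
    Integrable.mono' ((integrable_exp_neg_cosh h2r (-α) 0).const_mul M)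
      (continuous_rotatedIntegrand α a b ζ θ₀).aestronglyMeasurable
      (Eventually.of_forall fun t => norm_rotatedIntegrand_le hra.le hrb.le hM.le t)
  have ID : Integrable (rotatedDeriv α a b ζ θ₀) :=
    Integrable.mono' B (cD θ₀).aestronglyMeasurable (Eventually.of_forall fun t =>
      norm_rotatedDeriv_le hra.le hrb.le hM.le hRa.le hRb.le t)
  have key := (hasDerivAt_integral_of_dominated_loc_of_deriv_le (μ := volume)
    (F := fun θ t => rotatedIntegrand α a b ζ θ t)
    (F' := fun θ t => ζ * rotatedDeriv α a b ζ θ t) ev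
    (Eventually.of_forall fun θ => (continuous_rotatedIntegrand α a b ζ θ).aestronglyMeasurable)
    I0 ((cD θ₀).const_smul ζ).aestronglyMeasurable
    (bound := fun t => ‖ζ‖ * (M * (R * (Real.exp (-(2 * r * Real.cosh t)) *
        expCoshWeight (1 - α) 0 t) +
      R * (Real.exp (-(2 * r * Real.cosh t)) * expCoshWeight (-1 - α) 0 t) +
      |α| * (Real.exp (-(2 * r * Real.cosh t)) * expCoshWeight (-α) 0 t))))
    (Eventually.of_forall fun t θ hθ => by
      rw [norm_mul]
      exact mul_le_mul_of_nonneg_left (norm_rotatedDeriv_le hθ.1.le hθ.2.1.le hθ.2.2.2.2.le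
        hθ.2.2.1.le hθ.2.2.2.1.le t) (norm_nonneg ζ))
    (B.const_mul ‖ζ‖)
    (Eventually.of_forall fun t θ _ => hasDerivAt_rotatedIntegrand_angle α a b ζ θ t)).2
  refine key.congr_deriv ?_
  rw [integral_const_mul,
    integral_eq_zero_of_hasDerivAt_of_integrable (hasDerivAt_rotatedIntegrand α a b ζ θ₀) ID I0,
    mul_zero]

theorem abs_arg_add_lt_pi {a b : ℂ} (ha : 0 < a.re) (hb : 0 < b.re) :
    |a.arg + b.arg| < Real.pi := by
  have h1 := abs_arg_lt_pi_div_two_iff.2 (Or.inl ha)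
  have h2 := abs_arg_lt_pi_div_two_iff.2 (Or.inl hb)
  linarith [abs_add_le a.arg b.arg]

theorem log_mul_of_re_pos {a b : ℂ} (ha : 0 < a.re) (hb : 0 < b.re) :
    Complex.log (a * b) = Complex.log a + Complex.log b := by
  have ha0 : a ≠ 0 := by rintro rfl; simp at ha
  have hb0 : b ≠ 0 := by rintro rfl; simp at hb
  have h := abs_lt.1 (abs_arg_add_lt_pi ha hb)
  exact (Complex.log_mul_eq_add_log_iff ha0 hb0).2 ⟨h.1, h.2.le⟩

/-- For positive a and b, scaling s balances the two exponents. For complex a and b the scaling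
becomes a deformation of the ray, along which the integral is constant. -/
theorem integral_exp_neg_mul_sub_div_eq_besselU (α : ℝ) {a b : ℂ} (ha : 0 < a.re) (hb : 0 < b.re) :
    ∫ s in Set.Ioi (0 : ℝ), cexp (-(a * s) - b / s) * ((s ^ (-α - 1) : ℝ) : ℂ) =
      (√Real.pi : ℂ) * a ^ (α : ℂ) * besselU α (a * b) := by
  have ha0 : a ≠ 0 := by rintro rfl; simp at ha
  have hb0 : b ≠ 0 := by rintro rfl; simp at hb
  have hab := mul_ne_zero ha0 hb0
  -- Here e^ζ is a square root of b/a, so at θ = 1 both coefficients a e^ζ and b e^{-ζ} equal the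
  -- principal √(ab).
  set ζ : ℂ := (Complex.log b - Complex.log a) / 2 with hζ
  have Ea : ∀ θ : ℝ, a * cexp (θ * ζ) =
      cexp ((1 - θ / 2) * Complex.log a + θ / 2 * Complex.log b) := by
    intro θ
    conv_lhs => rw [← Complex.exp_log ha0]
    rw [← Complex.exp_add]; congr 1; rw [hζ]; ring
  have Eb : ∀ θ : ℝ, b * cexp (-(θ * ζ)) =
      cexp ((1 - θ / 2) * Complex.log b + θ / 2 * Complex.log a) := by
    intro θ
    conv_lhs => rw [← Complex.exp_log hb0]
    rw [← Complex.exp_add]; congr 1; rw [hζ]; ring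
  -- During the deformation the argument is a convex combination of arg u and arg v, so it stays in
  -- ]-π/2, π/2[.
  have pos : ∀ (u v : ℂ), 0 < u.re → 0 < v.re → ∀ θ ∈ Set.Icc (0 : ℝ) 1,
      0 < (cexp ((1 - θ / 2) * Complex.log u + θ / 2 * Complex.log v)).re := by
    intro u v hu hv θ hθ
    rw [Complex.exp_re]
    refine mul_pos (Real.exp_pos _) (Real.cos_pos_of_mem_Ioo ?_)
    have h1 := abs_lt.1 (abs_arg_lt_pi_div_two_iff.2 (Or.inl hu))
    have h2 := abs_lt.1 (abs_arg_lt_pi_div_two_iff.2 (Or.inl hv))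
    have e : (((1 - θ / 2) * Complex.log u + θ / 2 * Complex.log v : ℂ)).im =
        (1 - θ / 2) * u.arg + θ / 2 * v.arg := by
      have : ((1 - θ / 2) * Complex.log u + θ / 2 * Complex.log v : ℂ) =
        ((1 - θ / 2 : ℝ) : ℂ) * Complex.log u + ((θ / 2 : ℝ) : ℂ) * Complex.log v := by
        push_cast; ring
      rw [this, Complex.add_im, Complex.im_ofReal_mul, Complex.im_ofReal_mul, Complex.log_im,
        Complex.log_im]
    rw [e]
    obtain ⟨hθ0, hθ1⟩ := hθ
    constructor <;> nlinarith
  have hder : ∀ θ ∈ Set.Icc (0 : ℝ) 1,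
      HasDerivAt (fun θ => ∫ t, rotatedIntegrand α a b ζ θ t) 0 θ := fun θ hθ =>
    hasDerivAt_integral_rotatedIntegrand α (by rw [Ea]; exact pos a b ha hb θ hθ)
      (by rw [Eb]; exact pos b a hb ha θ hθ)
  have hconst := constant_of_has_deriv_right_zero
    (fun θ hθ => (hder θ hθ).continuousAt.continuousWithinAt)
    (fun θ hθ => (hder θ ⟨hθ.1, hθ.2.le⟩).hasDerivWithinAt) 1 ⟨zero_le_one, le_rfl⟩
  have hlhs : ∫ s in Set.Ioi (0 : ℝ), cexp (-(a * s) - b / s) * ((s ^ (-α - 1) : ℝ) : ℂ) =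
      ∫ t, rotatedIntegrand α a b ζ 0 t := by
    rw [integral_Ioi_zero_eq_integral_exp]
    refine integral_congr_ae (Eventually.of_forall fun t => ?_)
    simp only [rotatedIntegrand]
    rw [mul_left_comm, ← Complex.ofReal_mul, exp_mul_rpow_neg_sub_one, Complex.ofReal_exp (-α * t),
      ← Complex.exp_add]
    congr 1
    rw [Real.exp_neg]
    push_cast
    simp only [zero_mul, neg_zero, Complex.exp_zero]
    ring
  have hq : (a * b) ^ (1 / 2 : ℂ) = cexp ((Complex.log a + Complex.log b) / 2) := by
    rw [Complex.cpow_def_of_ne_zero hab, log_mul_of_re_pos ha hb]; congr 1; ring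
  have hrhs : ∫ t, rotatedIntegrand α a b ζ 1 t =
      cexp (-(α * ζ)) * coshLaplace (-α) 0 ((a * b) ^ (1 / 2 : ℂ)) := by
    unfold coshLaplace
    rw [← integral_const_mul]
    refine integral_congr_ae (Eventually.of_forall fun t => ?_)
    have e1 := Ea 1
    have e2 := Eb 1
    have e3 : (1 - ((1 : ℝ) : ℂ) / 2) * Complex.log a + ((1 : ℝ) : ℂ) / 2 * Complex.log b =
        (Complex.log a + Complex.log b) / 2 := by push_cast; ring
    have e4 : (1 - ((1 : ℝ) : ℂ) / 2) * Complex.log b + ((1 : ℝ) : ℂ) / 2 * Complex.log a =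
        (Complex.log a + Complex.log b) / 2 := by push_cast; ring
    rw [e3, ← hq] at e1
    rw [e4, ← hq] at e2
    simp only [rotatedIntegrand, expCoshWeight]
    rw [e1, e2, pow_zero, mul_one, Complex.ofReal_exp (-α * t), ← Complex.exp_add, ← Complex.exp_add]
    congr 1
    rw [Real.cosh_eq]
    push_cast
    ring
  have hpi : (√Real.pi : ℂ) ≠ 0 := by
    exact_mod_cast (Real.sqrt_pos.2 Real.pi_pos).ne'
  rw [hlhs, ← hconst, hrhs, besselU_eq_coshLaplace, Complex.cpow_def_of_ne_zero ha0,
    Complex.cpow_def_of_ne_zero hab (-(α : ℂ) / 2), log_mul_of_re_pos ha hb]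
  have : cexp (-(α * ζ)) = cexp (Complex.log a * α) *
      cexp ((Complex.log a + Complex.log b) * (-(α : ℂ) / 2)) := by
    rw [← Complex.exp_add]; congr 1; rw [hζ]; ring
  rw [this]
  field_simp


/-! ### Boundary values of U_α on the cut. -/

/-- The continuous extension of `coshLaplace (-α) 0` to the punctured closed right half-plane. -/
def macdonaldExt (α : ℝ) : ℂ → ℂ := (hasBoundaryExtension_coshLaplace (-α) 0).choose

theorem continuousOn_macdonaldExt (α : ℝ) :
    ContinuousOn (macdonaldExt α) {q | 0 ≤ q.re ∧ q ≠ 0} :=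
  (hasBoundaryExtension_coshLaplace (-α) 0).choose_spec.1

theorem macdonaldExt_eq (α : ℝ) {q : ℂ} (hq : 0 < q.re) :
    macdonaldExt α q = coshLaplace (-α) 0 q :=
  (hasBoundaryExtension_coshLaplace (-α) 0).choose_spec.2.1 q hq

theorem exists_norm_macdonaldExt_le (α : ℝ) : ∃ (C : ℝ) (N : ℕ), 0 ≤ C ∧
    ∀ q : ℂ, 0 ≤ q.re → q ≠ 0 → ‖macdonaldExt α q‖ ≤ C * (1 + ‖q‖⁻¹) ^ N :=
  (hasBoundaryExtension_coshLaplace (-α) 0).choose_spec.2.2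

/-- The number `-iσ`, for `σ = ±1`. -/
def negIUnit (σ : ℤˣ) : ℂ := -((σ : ℤ) : ℂ) * I

theorem negIUnit_re (σ : ℤˣ) : (negIUnit σ).re = 0 := by
  rcases Int.units_eq_one_or σ with rfl | rfl <;> simp [negIUnit]

theorem negIUnit_im_sq (σ : ℤˣ) : (negIUnit σ).im ^ 2 = 1 := by
  rcases Int.units_eq_one_or σ with rfl | rfl <;> simp [negIUnit]

theorem norm_negIUnit (σ : ℤˣ) : ‖negIUnit σ‖ = 1 := by
  rcases Int.units_eq_one_or σ with rfl | rfl <;> simp [negIUnit]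

theorem negIUnit_ne_zero (σ : ℤˣ) : negIUnit σ ≠ 0 := by
  rw [← norm_ne_zero_iff, norm_negIUnit]; exact one_ne_zero

theorem negIUnit_sq (σ : ℤˣ) : negIUnit σ * negIUnit σ = -1 := by
  rcases Int.units_eq_one_or σ with rfl | rfl <;> simp [negIUnit]

theorem log_negIUnit_mul (σ : ℤˣ) {b : ℂ} (hb : 0 < b.re) :
    Complex.log (negIUnit σ * b) = Complex.log (negIUnit σ) + Complex.log b := by
  have hb0 : b ≠ 0 := by rintro rfl; simp at hb
  have h1 := abs_le.1 (abs_arg_le_pi_div_two_iff.2 (negIUnit_re σ).ge)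
  have h2 := abs_lt.1 (abs_arg_lt_pi_div_two_iff.2 (Or.inl hb))
  exact (Complex.log_mul_eq_add_log_iff (negIUnit_ne_zero σ) hb0).2
    ⟨by linarith [h1.1, h2.1], by linarith [h1.2, h2.2]⟩

theorem negIUnit_mul_cpow (σ : ℤˣ) {b : ℂ} (hb : 0 < b.re) (s : ℂ) :
    (negIUnit σ * b) ^ s = negIUnit σ ^ s * b ^ s := by
  have hb0 : b ≠ 0 := by rintro rfl; simp at hb
  rw [Complex.cpow_def_of_ne_zero (mul_ne_zero (negIUnit_ne_zero σ) hb0),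
    Complex.cpow_def_of_ne_zero (negIUnit_ne_zero σ), Complex.cpow_def_of_ne_zero hb0,
    log_negIUnit_mul σ hb, add_mul, Complex.exp_add]

/-- Half the sum of two arguments in [-π/2, π/2] lies there again. Thus the product of the roots
stays in the domain of `macdonaldExt`, even when the product ab lands on the cut. -/
theorem cpow_half_mul_cpow_half_re {a b : ℂ} (ha : 0 ≤ a.re) (ha0 : a ≠ 0) (hb : 0 ≤ b.re)
    (hb0 : b ≠ 0) : 0 ≤ (a ^ (1 / 2 : ℂ) * b ^ (1 / 2 : ℂ)).re := by
  rw [Complex.cpow_def_of_ne_zero ha0, Complex.cpow_def_of_ne_zero hb0, ← Complex.exp_add,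
    Complex.exp_re]
  refine mul_nonneg (Real.exp_pos _).le (Real.cos_nonneg_of_mem_Icc ?_)
  have h1 := abs_le.1 (abs_arg_le_pi_div_two_iff.2 ha)
  have h2 := abs_le.1 (abs_arg_le_pi_div_two_iff.2 hb)
  have e : (Complex.log a * (1 / 2 : ℂ) + Complex.log b * (1 / 2 : ℂ)).im =
      (a.arg + b.arg) / 2 := by
    have : (1 / 2 : ℂ) = ((1 / 2 : ℝ) : ℂ) := by push_cast; rfl
    rw [this, Complex.add_im, Complex.im_mul_ofReal, Complex.im_mul_ofReal, Complex.log_im,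
      Complex.log_im]
    ring
  rw [e]
  constructor <;> linarith [h1.1, h1.2, h2.1, h2.2]

theorem cpow_half_mul_self {a : ℂ} (ha : a ≠ 0) : a ^ (1 / 2 : ℂ) * a ^ (1 / 2 : ℂ) = a := by
  rw [← Complex.cpow_add _ _ ha]; norm_num

theorem mem_slitPlane_of_re_nonneg {b : ℂ} (hb : 0 ≤ b.re) (hb0 : b ≠ 0) : b ∈ slitPlane := by
  rw [Complex.mem_slitPlane_iff]
  rcases hb.eq_or_lt with h | h
  · exact Or.inr fun h' => hb0 (Complex.ext h.symm h')
  · exact Or.inl h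

/-- The continuous extension of `b ↦ besselU α (-iσ b)` from `Re b > 0` to the punctured closed
right half-plane. -/
def besselUExt (α : ℝ) (σ : ℤˣ) (b : ℂ) : ℂ :=
  (1 / (√Real.pi : ℂ)) * (negIUnit σ ^ (-(α : ℂ) / 2) * b ^ (-(α : ℂ) / 2)) *
    macdonaldExt α (negIUnit σ ^ (1 / 2 : ℂ) * b ^ (1 / 2 : ℂ))

theorem besselUExt_eq (α : ℝ) (σ : ℤˣ) {b : ℂ} (hb : 0 < b.re) :
    besselUExt α σ b = besselU α (negIUnit σ * b) := by
  have hb0 : b ≠ 0 := by rintro rfl; simp at hb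
  have hre : 0 < (negIUnit σ ^ (1 / 2 : ℂ) * b ^ (1 / 2 : ℂ)).re := by
    rw [Complex.cpow_def_of_ne_zero (negIUnit_ne_zero σ), Complex.cpow_def_of_ne_zero hb0,
      ← Complex.exp_add, Complex.exp_re]
    refine mul_pos (Real.exp_pos _) (Real.cos_pos_of_mem_Ioo ?_)
    have h1 := abs_le.1 (abs_arg_le_pi_div_two_iff.2 (negIUnit_re σ).ge)
    have h2 := abs_lt.1 (abs_arg_lt_pi_div_two_iff.2 (Or.inl hb))
    have e : (Complex.log (negIUnit σ) * (1 / 2 : ℂ) + Complex.log b * (1 / 2 : ℂ)).im =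
        ((negIUnit σ).arg + b.arg) / 2 := by
      have : (1 / 2 : ℂ) = ((1 / 2 : ℝ) : ℂ) := by push_cast; rfl
      rw [this, Complex.add_im, Complex.im_mul_ofReal, Complex.im_mul_ofReal, Complex.log_im,
        Complex.log_im]
      ring
    rw [e]
    constructor <;> linarith [h1.1, h1.2, h2.1, h2.2]
  rw [besselUExt, macdonaldExt_eq α hre, besselU_eq_coshLaplace, negIUnit_mul_cpow σ hb,
    negIUnit_mul_cpow σ hb]

theorem continuousOn_besselUExt (α : ℝ) (σ : ℤˣ) :
    ContinuousOn (besselUExt α σ) {b | 0 ≤ b.re ∧ b ≠ 0} := by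
  have hc : ∀ s : ℂ, ContinuousOn (fun b : ℂ => b ^ s) {b | 0 ≤ b.re ∧ b ≠ 0} := fun s =>
    continuousOn_id.cpow_const fun b hb => mem_slitPlane_of_re_nonneg hb.1 hb.2
  unfold besselUExt
  refine (continuousOn_const.mul (continuousOn_const.mul (hc _))).mul
    ((continuousOn_macdonaldExt α).comp (continuousOn_const.mul (hc _)) fun b hb => ⟨?_, ?_⟩)
  · exact cpow_half_mul_cpow_half_re (negIUnit_re σ).ge (negIUnit_ne_zero σ) hb.1 hb.2
  · exact mul_ne_zero (by simp [negIUnit_ne_zero σ]) (by simp [hb.2])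

theorem cpow_half_re_pos {z : ℂ} (hz : z ∈ slitPlane) : 0 < (z ^ (1 / 2 : ℂ)).re := by
  have hz0 := slitPlane_ne_zero hz
  rw [Complex.cpow_def_of_ne_zero hz0, Complex.exp_re]
  refine mul_pos (Real.exp_pos _) (Real.cos_pos_of_mem_Ioo ?_)
  have e : (Complex.log z * (1 / 2 : ℂ)).im = z.arg / 2 := by
    have : (1 / 2 : ℂ) = ((1 / 2 : ℝ) : ℂ) := by push_cast; rfl
    rw [this, Complex.im_mul_ofReal, Complex.log_im]
    ring
  have h1 := Complex.neg_pi_lt_arg z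
  have h2 := lt_of_le_of_ne (Complex.arg_le_pi z) (mem_slitPlane_iff_arg.1 hz).1
  rw [e]
  constructor <;> linarith

theorem besselU_eq_macdonaldExt (α : ℝ) {z : ℂ} (hz : z ∈ slitPlane) :
    besselU α z = (1 / (√Real.pi : ℂ)) * z ^ (-(α : ℂ) / 2) *
      macdonaldExt α (z ^ (1 / 2 : ℂ)) := by
  rw [besselU_eq_coshLaplace, macdonaldExt_eq α (cpow_half_re_pos hz)]

theorem continuousOn_besselU (α : ℝ) : ContinuousOn (besselU α) slitPlane := by
  have hc : ∀ s : ℂ, ContinuousOn (fun z : ℂ => z ^ s) slitPlane := fun s =>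
    continuousOn_id.cpow_const fun z hz => hz
  refine ContinuousOn.congr ?_ fun z hz => besselU_eq_macdonaldExt α hz
  refine (continuousOn_const.mul (hc _)).mul
    ((continuousOn_macdonaldExt α).comp (hc _) fun z hz => ⟨(cpow_half_re_pos hz).le, ?_⟩)
  simp [slitPlane_ne_zero hz]

/-- The sign of α enters through |z|^{-α/2}, which must not grow at infinity; the Macdonald factor
is controlled by powers of 1 + |z|^{-1/2}. -/
theorem exists_norm_besselU_le {α : ℝ} (hα : 0 ≤ α) {v : ℝ} (hv : 0 < v) :
    ∃ C : ℝ, ∀ z : ℂ, z ∈ slitPlane → v ≤ ‖z‖ → ‖besselU α z‖ ≤ C := by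
  obtain ⟨C, N, hC, h⟩ := exists_norm_macdonaldExt_le α
  refine ⟨‖(1 / (√Real.pi : ℂ))‖ * v ^ (-α / 2) *
    (C * (1 + (v ^ (1 / 2 : ℝ))⁻¹) ^ N), fun z hz hzv => ?_⟩
  have n1 : ‖z ^ (-(α : ℂ) / 2)‖ ≤ v ^ (-α / 2) := by
    have : (-(α : ℂ) / 2) = ((-α / 2 : ℝ) : ℂ) := by push_cast; rfl
    rw [this, Complex.norm_cpow_real]
    exact Real.rpow_le_rpow_of_nonpos hv hzv (by linarith)
  have n2 : ‖z ^ (1 / 2 : ℂ)‖ = ‖z‖ ^ (1 / 2 : ℝ) := by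
    have : (1 / 2 : ℂ) = ((1 / 2 : ℝ) : ℂ) := by push_cast; rfl
    rw [this, Complex.norm_cpow_real]
  rw [besselU_eq_macdonaldExt α hz, norm_mul, norm_mul]
  gcongr
  refine (h _ (cpow_half_re_pos hz).le (by simp [slitPlane_ne_zero hz])).trans ?_
  rw [n2]
  gcongr

/-- At b = c y² the product cb is -y², a point of the cut, and c^{1/2} b^{1/2} = c y. Boundary
values on the cut are therefore Macdonald values on the imaginary axis. -/
theorem besselUExt_negIUnit_mul_sq (α : ℝ) (σ : ℤˣ) {y : ℝ} (hy : 0 < y) :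
    besselUExt α σ (negIUnit σ * (y ^ 2 : ℝ)) =
      (1 / (√Real.pi : ℂ)) * (negIUnit σ ^ (-(α : ℂ) / 2) * negIUnit σ ^ (-(α : ℂ) / 2)) *
        ((y ^ 2 : ℝ) : ℂ) ^ (-(α : ℂ) / 2) * macdonaldExt α (y * negIUnit σ) := by
  have hy2 : 0 < (((y ^ 2 : ℝ) : ℂ)).re := by rw [Complex.ofReal_re]; positivity
  have hs : ((y ^ 2 : ℝ) : ℂ) ^ (1 / 2 : ℂ) = y := by
    have : (1 / 2 : ℂ) = ((1 / 2 : ℝ) : ℂ) := by push_cast; rfl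
    rw [this, ← Complex.ofReal_cpow (by positivity), ← Real.sqrt_eq_rpow, Real.sqrt_sq hy.le]
  unfold besselUExt
  rw [negIUnit_mul_cpow σ hy2, negIUnit_mul_cpow σ hy2, hs, ← mul_assoc (negIUnit σ ^ (1 / 2 : ℂ)),
    cpow_half_mul_self (negIUnit_ne_zero σ), mul_comm (negIUnit σ)]
  ring


/-! ### Laplace moments on the imaginary axis and independence of the two boundary values. -/

theorem integrableOn_pow_mul_exp_neg (n : ℕ) {r : ℝ} (hr : 0 < r) :
    IntegrableOn (fun y : ℝ => y ^ n * Real.exp (-(r * y))) (Set.Ioi 0) := by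
  have := integrableOn_rpow_mul_exp_neg_mul_rpow (s := n) (p := 1)
    (by linarith [Nat.cast_nonneg (α := ℝ) n]) one_pos hr
  simpa using this

theorem norm_pow_mul_cexp_neg (n : ℕ) (r : ℂ) {y : ℝ} (hy : 0 < y) :
    ‖(y : ℂ) ^ n * cexp (-(r * y))‖ = y ^ n * Real.exp (-(r.re * y)) := by
  rw [norm_mul, norm_pow, Complex.norm_real, Real.norm_of_nonneg hy.le, Complex.norm_exp,
    Complex.neg_re, Complex.re_mul_ofReal]

theorem integrableOn_pow_mul_cexp_neg (n : ℕ) {r : ℂ} (hr : 0 < r.re) :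
    IntegrableOn (fun y : ℝ => (y : ℂ) ^ n * cexp (-(r * y))) (Set.Ioi 0) := by
  refine Integrable.mono' (integrableOn_pow_mul_exp_neg n hr)
    (Continuous.aestronglyMeasurable (by fun_prop)) ?_
  exact (ae_restrict_iff' measurableSet_Ioi).2 (Eventually.of_forall fun y hy =>
    (norm_pow_mul_cexp_neg n r hy).le)

theorem integral_pow_mul_cexp_neg (n : ℕ) {r : ℂ} (hr : 0 < r.re) :
    ∫ y in Set.Ioi (0 : ℝ), (y : ℂ) ^ n * cexp (-(r * y)) = n.factorial / r ^ (n + 1) := by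
  have hr0 : r ≠ 0 := by rintro rfl; simp at hr
  have hexp : ∀ y : ℝ, HasDerivAt (fun y : ℝ => cexp (-(r * y))) (-r * cexp (-(r * y))) y := by
    intro y
    refine ((((hasDerivAt_id y).ofReal_comp.const_mul r).neg).cexp).congr_deriv ?_
    simp; ring
  induction n with
  | zero =>
    have := integral_exp_mul_complex_Ioi (a := -r) (by simpa using hr) 0
    simp only [neg_mul] at this
    simp [this]
  | succ n ih =>
    have hpow : ∀ y : ℝ, HasDerivAt (fun y : ℝ => (y : ℂ) ^ (n + 1)) ((n + 1) * (y : ℂ) ^ n) y := by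
      intro y
      simpa using (hasDerivAt_id y).ofReal_comp.fun_pow (n + 1)
    have hd : ∀ y ∈ Set.Ici (0 : ℝ), HasDerivAt (fun y : ℝ => (y : ℂ) ^ (n + 1) * cexp (-(r * y)))
        ((n + 1) * ((y : ℂ) ^ n * cexp (-(r * y))) -
          r * ((y : ℂ) ^ (n + 1) * cexp (-(r * y)))) y := by
      intro y _
      refine ((hpow y).mul (hexp y)).congr_deriv ?_
      ring
    have I1 := integrableOn_pow_mul_cexp_neg n hr
    have I2 := integrableOn_pow_mul_cexp_neg (n + 1) hr
    have I3 : IntegrableOn (fun y : ℝ => (n + 1) * ((y : ℂ) ^ n * cexp (-(r * y))) -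
          r * ((y : ℂ) ^ (n + 1) * cexp (-(r * y)))) (Set.Ioi 0) :=
      (I1.const_mul _).sub (I2.const_mul _)
    have T := tendsto_zero_of_hasDerivAt_of_integrableOn_Ioi
      (fun y hy => hd y (Set.Ioi_subset_Ici_self hy)) I3 I2
    have := integral_Ioi_of_hasDerivAt_of_tendsto' hd I3 T
    rw [integral_sub (I1.const_mul _) (I2.const_mul _), integral_const_mul, integral_const_mul,
      ih] at this
    simp only [Complex.ofReal_zero, ne_eq, Nat.add_eq_zero_iff, one_ne_zero, and_false,
      not_false_eq_true, zero_pow, zero_mul, sub_zero] at this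
    rw [Nat.factorial_succ]
    push_cast
    field_simp at this ⊢
    linear_combination -this

/-- The Laplace transform in `y` of `y^n` times `coshLaplace`, divided by `n!`. -/
def coshMellin (α : ℝ) (n : ℕ) (w : ℂ) (l : ℝ) : ℂ :=
  ∫ t : ℝ, (expCoshWeight (-α) 0 t : ℂ) / (l + 2 * w * Real.cosh t) ^ (n + 1)

/-- Fubini: the y-integral of y^n e^{-(l + 2w cosh t)y} is n! (l + 2w cosh t)^{-(n+1)}. The
resulting factor cosh^{-(n+1)} t makes the t-integral converge. -/
theorem integral_pow_mul_coshLaplace {α : ℝ} {n : ℕ} (hn : |α| < n) {w : ℂ} (hw : 0 < w.re) {l : ℝ}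
    (hl : 0 < l) :
    ∫ y in Set.Ioi (0 : ℝ), (y : ℂ) ^ n * cexp (-(l * y)) * coshLaplace (-α) 0 (y * w) =
      n.factorial * coshMellin α n w l := by
  have hre : ∀ t : ℝ, (l + 2 * w * Real.cosh t : ℂ).re = l + 2 * w.re * Real.cosh t := by
    intro t; rw [Complex.add_re, Complex.ofReal_re, Complex.re_mul_ofReal]; simp
  have hpos : ∀ t : ℝ, 0 < (l + 2 * w * Real.cosh t : ℂ).re := by
    intro t; rw [hre]; have := Real.cosh_pos t; positivity
  set F : ℝ → ℝ → ℂ := fun y t =>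
    (y : ℂ) ^ n * cexp (-((l + 2 * w * Real.cosh t) * y)) * (expCoshWeight (-α) 0 t : ℂ) with hF
  have cw := continuous_expCoshWeight (-α) 0
  have hint : Integrable (Function.uncurry F) ((volume.restrict (Set.Ioi 0)).prod volume) := by
    have hm : AEStronglyMeasurable (Function.uncurry F)
        ((volume.restrict (Set.Ioi (0 : ℝ))).prod volume) := by
      refine Continuous.aestronglyMeasurable ?_
      simp only [hF, Function.uncurry_def]
      fun_prop
    rw [integrable_prod_iff' hm]
    refine ⟨Eventually.of_forall fun t =>
      (integrableOn_pow_mul_cexp_neg n (hpos t)).mul_const (expCoshWeight (-α) 0 t : ℂ), ?_⟩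
    have e : (fun t : ℝ => ∫ y in Set.Ioi (0 : ℝ), ‖Function.uncurry F (y, t)‖) = fun t =>
        n.factorial / (l + 2 * w.re * Real.cosh t) ^ (n + 1) * expCoshWeight (-α) 0 t := by
      funext t
      have h1 : ∫ y in Set.Ioi (0 : ℝ), ‖Function.uncurry F (y, t)‖ =
          ∫ y in Set.Ioi (0 : ℝ), y ^ n * Real.exp (-((l + 2 * w.re * Real.cosh t) * y)) *
            expCoshWeight (-α) 0 t := by
        refine setIntegral_congr_fun measurableSet_Ioi fun y hy => ?_
        simp only [hF, Function.uncurry_apply_pair]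
        rw [norm_mul, norm_pow_mul_cexp_neg n _ hy, hre, Complex.norm_real,
          Real.norm_of_nonneg (expCoshWeight_pos _ _ _).le]
      rw [h1, integral_mul_const]
      congr 1
      have := integral_pow_mul_cexp_neg n (r := ((l + 2 * w.re * Real.cosh t : ℝ) : ℂ))
        (by rw [Complex.ofReal_re, ← hre]; exact hpos t)
      have h2 : ∀ y : ℝ, (y : ℂ) ^ n * cexp (-(((l + 2 * w.re * Real.cosh t : ℝ) : ℂ) * y)) =
          ((y ^ n * Real.exp (-((l + 2 * w.re * Real.cosh t) * y)) : ℝ) : ℂ) := by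
        intro y; push_cast; rfl
      simp_rw [h2] at this
      rw [integral_complex_ofReal] at this
      exact_mod_cast this
    rw [e]
    have hi : Integrable (expCoshWeight (-α) (n + 1)) := by
      apply integrable_expCoshWeight; rw [abs_neg]; push_cast; linarith
    refine Integrable.mono' (hi.const_mul (n.factorial / (2 * w.re) ^ (n + 1))) ?_
      (Eventually.of_forall fun t => ?_)
    · refine Continuous.aestronglyMeasurable ((continuous_const.div (by fun_prop) fun t => ?_).mul cw)
      have := hpos t; rw [hre] at this; positivity
    · have hc := Real.cosh_pos t
      have := expCoshWeight_pos (-α) 0 t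
      rw [Real.norm_of_nonneg (by positivity), ← zero_add (n + 1),
        ← expCoshWeight_mul_inv_cosh_pow, ← mul_assoc, zero_add]
      gcongr
      rw [inv_pow, ← div_eq_mul_inv, div_div, ← mul_pow]
      gcongr
      linarith
  have h1 : ∫ y in Set.Ioi (0 : ℝ), (y : ℂ) ^ n * cexp (-(l * y)) * coshLaplace (-α) 0 (y * w) =
      ∫ y in Set.Ioi (0 : ℝ), ∫ t : ℝ, F y t := by
    refine integral_congr_ae (Eventually.of_forall fun y => ?_)
    simp only
    rw [coshLaplace, ← integral_const_mul]
    refine integral_congr_ae (Eventually.of_forall fun t => ?_)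
    simp only [hF]
    rw [mul_assoc, ← mul_assoc (cexp _), ← Complex.exp_add, ← mul_assoc]
    congr 3
    ring
  rw [h1, integral_integral_swap hint, coshMellin, ← integral_const_mul]
  refine integral_congr_ae (Eventually.of_forall fun t => ?_)
  simp only [hF]
  rw [integral_mul_const, integral_pow_mul_cexp_neg n (hpos t)]
  ring

/-- The imaginary part alone gives |l + 2w cosh t| ≥ 2 cosh t. The bound does not involve l or Re w,
so both may tend to 0 under the integral. -/
theorem norm_coshMellin_integrand_le {α : ℝ} {n : ℕ} {w : ℂ} (hw : w.im ^ 2 = 1) (l t : ℝ) :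
    ‖(expCoshWeight (-α) 0 t : ℂ) / (l + 2 * w * Real.cosh t) ^ (n + 1)‖ ≤
      expCoshWeight (-α) (n + 1) t := by
  have hc := Real.cosh_pos t
  have h1 : Real.cosh t ≤ ‖(l + 2 * w * Real.cosh t : ℂ)‖ := by
    refine le_trans ?_ (Complex.abs_im_le_norm _)
    have e : (l + 2 * w * Real.cosh t : ℂ).im = 2 * w.im * Real.cosh t := by
      rw [Complex.add_im, Complex.ofReal_im, Complex.im_mul_ofReal]; simp
    rw [e, abs_mul, abs_mul, abs_of_pos hc]
    have : |w.im| = 1 := by rw [← sq_eq_sq₀ (abs_nonneg _) zero_le_one, sq_abs, hw, one_pow]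
    rw [this]; norm_num; linarith
  rw [norm_div, norm_pow, Complex.norm_real, Real.norm_of_nonneg (expCoshWeight_pos _ _ _).le,
    ← zero_add (n + 1), ← expCoshWeight_mul_inv_cosh_pow, zero_add, div_eq_inv_mul, ← inv_pow]
  have := expCoshWeight_pos (-α) 0 t
  gcongr

theorem tendsto_coshMellin {ι : Type*} {L : Filter ι} [L.IsCountablyGenerated] {α : ℝ} {n : ℕ}
    (hn : |α| < n) {w : ι → ℂ} {l : ι → ℝ} {w₀ : ℂ} {l₀ : ℝ} (hw : Tendsto w L (𝓝 w₀))
    (hl : Tendsto l L (𝓝 l₀)) (him : ∀ i, (w i).im ^ 2 = 1) (him₀ : w₀.im ^ 2 = 1) :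
    Tendsto (fun i => coshMellin α n (w i) (l i)) L (𝓝 (coshMellin α n w₀ l₀)) := by
  have hi : Integrable (expCoshWeight (-α) (n + 1)) := by
    apply integrable_expCoshWeight; rw [abs_neg]; push_cast; linarith
  have hne : ∀ (w : ℂ) (l t : ℝ), w.im ^ 2 = 1 → (l + 2 * w * Real.cosh t : ℂ) ≠ 0 := by
    intro w l t h h0
    have e := congrArg Complex.im h0
    rw [Complex.add_im, Complex.ofReal_im, Complex.im_mul_ofReal] at e
    simp [(Real.cosh_pos t).ne'] at e
    simp [e] at h
  have cw := continuous_expCoshWeight (-α) 0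
  refine tendsto_integral_filter_of_dominated_convergence (expCoshWeight (-α) (n + 1))
    (Eventually.of_forall fun i => ?_)
    (Eventually.of_forall fun i => Eventually.of_forall fun t =>
      norm_coshMellin_integrand_le (him i) (l i) t) hi (Eventually.of_forall fun t => ?_)
  · refine Continuous.aestronglyMeasurable (Continuous.div (by fun_prop) (by fun_prop) fun t => ?_)
    exact pow_ne_zero _ (hne _ _ _ (him i))
  · refine tendsto_const_nhds.div ?_ (pow_ne_zero _ (hne _ _ _ him₀))
    have hl' : Tendsto (fun i => (l i : ℂ)) L (𝓝 (l₀ : ℂ)) :=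
      (Complex.continuous_ofReal.tendsto _).comp hl
    exact (hl'.add ((hw.const_mul 2).mul_const _)).pow _

/-- The identity for Re w > 0 is applied to w = ε + c and passed to the limit ε ↘ 0. Taking n at
least the exponent N of the bound in 1/|q| lets y^n absorb the singularity at y = 0; taking n > |α|
makes the right-hand side converge. -/
theorem integral_pow_mul_macdonaldExt (α : ℝ) : ∃ n₀ : ℕ, ∀ n ≥ n₀, |α| < n ∧
    ∀ (σ : ℤˣ) (l : ℝ), 0 < l →
    IntegrableOn (fun y : ℝ => (y : ℂ) ^ n * cexp (-(l * y)) * macdonaldExt α (y * negIUnit σ))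
      (Set.Ioi 0) ∧
    ∫ y in Set.Ioi (0 : ℝ), (y : ℂ) ^ n * cexp (-(l * y)) * macdonaldExt α (y * negIUnit σ) =
      n.factorial * coshMellin α n (negIUnit σ) l := by
  obtain ⟨C, N, hC, hG⟩ := exists_norm_macdonaldExt_le α
  obtain ⟨K, hK⟩ := exists_nat_gt |α|
  refine ⟨max N K, fun n hn => ?_⟩
  have hnN : N ≤ n := (le_max_left _ _).trans hn
  have hαn : |α| < n := hK.trans_le (by exact_mod_cast (le_max_right _ _).trans hn)
  refine ⟨hαn, fun σ l hl => ?_⟩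
  have wre : ∀ ε : ℝ, ((ε : ℂ) + negIUnit σ).re = ε := fun ε => by simp [negIUnit_re]
  have wim : ∀ ε : ℝ, ((ε : ℂ) + negIUnit σ).im ^ 2 = 1 := fun ε => by
    simp [negIUnit_im_sq]
  have wnorm : ∀ ε : ℝ, 1 ≤ ‖(ε : ℂ) + negIUnit σ‖ := fun ε => by
    have := Complex.abs_im_le_norm ((ε : ℂ) + negIUnit σ)
    have h1 : |((ε : ℂ) + negIUnit σ).im| = 1 := by
      rw [← sq_eq_sq₀ (abs_nonneg _) zero_le_one, sq_abs, wim, one_pow]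
    linarith
  have wne : ∀ ε : ℝ, (ε : ℂ) + negIUnit σ ≠ 0 := fun ε h => by
    have := wnorm ε; rw [h] at this; simp at this; linarith
  have yre : ∀ (y ε : ℝ), ((y : ℂ) * ((ε : ℂ) + negIUnit σ)).re = y * ε := fun y ε => by
    rw [Complex.re_ofReal_mul, wre]
  have hmem : ∀ (y ε : ℝ), 0 < y → 0 ≤ ε →
      (y : ℂ) * ((ε : ℂ) + negIUnit σ) ∈ {q : ℂ | 0 ≤ q.re ∧ q ≠ 0} := fun y ε hy hε =>
    ⟨by rw [yre]; positivity, mul_ne_zero (by exact_mod_cast hy.ne') (wne ε)⟩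
  set F : ℝ → ℝ → ℂ := fun ε y =>
    (y : ℂ) ^ n * cexp (-(l * y)) * macdonaldExt α (y * ((ε : ℂ) + negIUnit σ)) with hF
  have hcont : ∀ ε : ℝ, 0 ≤ ε → ContinuousOn (F ε) (Set.Ioi 0) := by
    intro ε hε
    refine ContinuousOn.mul (Continuous.continuousOn (by fun_prop))
      ((continuousOn_macdonaldExt α).comp (Continuous.continuousOn (by fun_prop))
        fun y hy => hmem y ε hy hε)
  have hbound : ∀ ε : ℝ, 0 ≤ ε → ∀ y ∈ Set.Ioi (0 : ℝ), ‖F ε y‖ ≤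
      C * (2 ^ (n - 1) * (Real.exp (-(l * y)) + y ^ n * Real.exp (-(l * y)))) := by
    intro ε hε y hy
    have hy0 : 0 < y := hy
    have h1 := hG _ (hmem y ε hy hε).1 (hmem y ε hy hε).2
    have h2 : ‖(y : ℂ) * ((ε : ℂ) + negIUnit σ)‖⁻¹ ≤ y⁻¹ := by
      rw [norm_mul, Complex.norm_real, Real.norm_of_nonneg hy0.le]
      exact inv_anti₀ hy0 (le_mul_of_one_le_right hy0.le (wnorm ε))
    have h3 : y ^ n * (1 + y⁻¹) ^ N ≤ 2 ^ (n - 1) * (1 + y ^ n) := by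
      calc y ^ n * (1 + y⁻¹) ^ N ≤ y ^ n * (1 + y⁻¹) ^ n := by
            gcongr
            have := inv_pos.2 hy0
            linarith
        _ = (1 + y) ^ n := by rw [← mul_pow, mul_add, mul_inv_cancel₀ hy0.ne', mul_one, add_comm]
        _ ≤ _ := by simpa using add_pow_le zero_le_one hy0.le n
    simp only [hF]
    have h4 := norm_pow_mul_cexp_neg n (l : ℂ) hy0
    rw [norm_mul, h4, Complex.ofReal_re]
    calc _ ≤ y ^ n * Real.exp (-(l * y)) * (C * (1 + y⁻¹) ^ N) := by
          gcongr
          exact h1.trans (by gcongr)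
      _ = C * Real.exp (-(l * y)) * (y ^ n * (1 + y⁻¹) ^ N) := by ring
      _ ≤ C * Real.exp (-(l * y)) * (2 ^ (n - 1) * (1 + y ^ n)) := by gcongr
      _ = _ := by ring
  have hB : IntegrableOn (fun y : ℝ =>
      C * (2 ^ (n - 1) * (Real.exp (-(l * y)) + y ^ n * Real.exp (-(l * y))))) (Set.Ioi 0) := by
    have h0 := integrableOn_pow_mul_exp_neg 0 hl
    simp only [pow_zero, one_mul] at h0
    exact ((h0.add (integrableOn_pow_mul_exp_neg n hl)).const_mul _).const_mul _
  have hmeas : ∀ ε : ℝ, 0 ≤ ε → AEStronglyMeasurable (F ε) (volume.restrict (Set.Ioi 0)) :=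
    fun ε hε => (hcont ε hε).aestronglyMeasurable measurableSet_Ioi
  have hF0 : F 0 = fun y : ℝ => (y : ℂ) ^ n * cexp (-(l * y)) * macdonaldExt α (y * negIUnit σ) := by
    simp only [hF, Complex.ofReal_zero, zero_add]
  have hint : IntegrableOn (F 0) (Set.Ioi 0) :=
    Integrable.mono' hB (hmeas 0 le_rfl)
      ((ae_restrict_iff' measurableSet_Ioi).2 (Eventually.of_forall (hbound 0 le_rfl)))
  rw [← hF0]
  refine ⟨hint, ?_⟩
  have hpos : ∀ᶠ ε : ℝ in 𝓝[>] 0, 0 < ε := self_mem_nhdsWithin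
  have T1 : Tendsto (fun ε => ∫ y in Set.Ioi (0 : ℝ), F ε y) (𝓝[>] 0)
      (𝓝 (∫ y in Set.Ioi (0 : ℝ), F 0 y)) := by
    refine tendsto_integral_filter_of_dominated_convergence _
      (hpos.mono fun ε hε => hmeas ε hε.le)
      (hpos.mono fun ε hε => (ae_restrict_iff' measurableSet_Ioi).2
        (Eventually.of_forall (hbound ε hε.le))) hB
      ((ae_restrict_iff' measurableSet_Ioi).2 (Eventually.of_forall fun y hy => ?_))
    refine tendsto_const_nhds.mul ?_
    have hc : ContinuousOn (fun ε : ℝ => macdonaldExt α (y * ((ε : ℂ) + negIUnit σ)))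
        (Set.Ici 0) :=
      (continuousOn_macdonaldExt α).comp (Continuous.continuousOn (by fun_prop))
        fun ε hε => hmem y ε hy hε
    exact (hc 0 Set.self_mem_Ici).mono_left (nhdsWithin_mono _ Set.Ioi_subset_Ici_self)
  have e : ∀ᶠ ε : ℝ in 𝓝[>] 0, n.factorial * coshMellin α n ((ε : ℂ) + negIUnit σ) l =
      ∫ y in Set.Ioi (0 : ℝ), F ε y := by
    filter_upwards [hpos] with ε hε
    rw [← integral_pow_mul_coshLaplace hαn (by rw [wre]; exact hε) hl]
    refine setIntegral_congr_fun measurableSet_Ioi fun y hy => ?_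
    simp only [hF]
    rw [macdonaldExt_eq α (by rw [yre]; exact mul_pos hy hε)]
  have T2 : Tendsto (fun ε : ℝ => n.factorial * coshMellin α n ((ε : ℂ) + negIUnit σ) l) (𝓝[>] 0)
      (𝓝 (n.factorial * coshMellin α n (negIUnit σ) l)) := by
    refine (tendsto_coshMellin hαn ?_ tendsto_const_nhds wim (negIUnit_im_sq σ)).const_mul _
    have : Continuous fun ε : ℝ => (ε : ℂ) + negIUnit σ := by fun_prop
    simpa using (this.tendsto 0).mono_left (nhdsWithin_le_nhds (s := Set.Ioi 0))
  exact tendsto_nhds_unique T1 (T2.congr' e)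

/-- At l = 0 the direction w separates from a real integral common to both signs σ. -/
theorem coshMellin_zero (α : ℝ) (n : ℕ) (w : ℂ) :
    coshMellin α n w 0 = ((2 * w) ^ (n + 1))⁻¹ * ((∫ t, expCoshWeight (-α) (n + 1) t : ℝ) : ℂ) := by
  rw [coshMellin, ← integral_complex_ofReal, ← integral_const_mul]
  refine integral_congr_ae (Eventually.of_forall fun t => ?_)
  simp only
  rw [← zero_add (n + 1), ← expCoshWeight_mul_inv_cosh_pow, Complex.ofReal_zero, zero_add,
    mul_pow _ (Real.cosh t : ℂ), zero_add]
  push_cast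
  rw [div_eq_mul_inv, mul_inv, inv_pow]
  ring

/-- The two boundary values of the Macdonald function on the imaginary axis are not proportional. -/
theorem exists_macdonaldExt_combination_ne_zero (α : ℝ) {k₁ k₂ : ℂ} (hk : k₂ ≠ 0) :
    ∃ y : ℝ, 0 < y ∧
      k₁ * macdonaldExt α (y * negIUnit 1) + k₂ * macdonaldExt α (y * negIUnit (-1)) ≠ 0 := by
  by_contra! H
  obtain ⟨n₀, hn₀⟩ := integral_pow_mul_macdonaldExt α
  have step1 : ∀ n ≥ n₀, ∀ l : ℝ, 0 < l →
      k₁ * coshMellin α n (negIUnit 1) l + k₂ * coshMellin α n (negIUnit (-1)) l = 0 := by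
    intro n hn l hl
    obtain ⟨-, h⟩ := hn₀ n hn
    obtain ⟨i1, e1⟩ := h 1 l hl
    obtain ⟨i2, e2⟩ := h (-1) l hl
    have : ∫ y in Set.Ioi (0 : ℝ),
        (k₁ * ((y : ℂ) ^ n * cexp (-(l * y)) * macdonaldExt α (y * negIUnit 1)) +
          k₂ * ((y : ℂ) ^ n * cexp (-(l * y)) * macdonaldExt α (y * negIUnit (-1)))) = 0 := by
      refine setIntegral_eq_zero_of_forall_eq_zero fun y hy => ?_
      linear_combination ((y : ℂ) ^ n * cexp (-(l * y))) * H y hy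
    rw [integral_add (i1.const_mul _) (i2.const_mul _), integral_const_mul, integral_const_mul, e1,
      e2] at this
    have hf : (n.factorial : ℂ) ≠ 0 := by exact_mod_cast n.factorial_ne_zero
    apply mul_left_cancel₀ hf
    linear_combination this
  have step2 : ∀ n ≥ n₀, k₁ * ((2 * negIUnit 1) ^ (n + 1))⁻¹ +
      k₂ * ((2 * negIUnit (-1)) ^ (n + 1))⁻¹ = 0 := by
    intro n hn
    have hα := (hn₀ n hn).1
    have T : ∀ σ, Tendsto (fun l : ℝ => coshMellin α n (negIUnit σ) l) (𝓝[>] 0)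
        (𝓝 (coshMellin α n (negIUnit σ) 0)) := fun σ =>
      tendsto_coshMellin hα tendsto_const_nhds (tendsto_id.mono_left nhdsWithin_le_nhds)
        (fun _ => negIUnit_im_sq σ) (negIUnit_im_sq σ)
    have hlim := ((T 1).const_mul k₁).add ((T (-1)).const_mul k₂)
    have hz : k₁ * coshMellin α n (negIUnit 1) 0 + k₂ * coshMellin α n (negIUnit (-1)) 0 = 0 := by
      refine tendsto_nhds_unique hlim (tendsto_const_nhds.congr' ?_)
      filter_upwards [self_mem_nhdsWithin] with l hl
      exact (step1 n hn l hl).symm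
    rw [coshMellin_zero, coshMellin_zero] at hz
    have hi : Integrable (expCoshWeight (-α) (n + 1)) := by
      apply integrable_expCoshWeight; rw [abs_neg]; push_cast; linarith
    have hM : 0 < ∫ t, expCoshWeight (-α) (n + 1) t :=
      integral_pos_of_integrable_nonneg_nonzero (x := 0) (continuous_expCoshWeight _ _) hi
        (fun t => (expCoshWeight_pos _ _ _).le) (expCoshWeight_pos _ _ _).ne'
    have hM' : ((∫ t, expCoshWeight (-α) (n + 1) t : ℝ) : ℂ) ≠ 0 := by exact_mod_cast hM.ne'
    apply mul_right_cancel₀ hM'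
    linear_combination hz
  -- Eliminating k₁ between n₀ and n₀ + 1 leaves k₂ (2i)^{-(n₀+1)} ((2i)⁻¹ - (-2i)⁻¹) = 0, and the
  -- last bracket is -i.
  have a := step2 n₀ le_rfl
  have b := step2 (n₀ + 1) (Nat.le_succ _)
  have h1 := negIUnit_ne_zero 1
  have h2 := negIUnit_ne_zero (-1)
  rw [pow_succ (2 * negIUnit 1), pow_succ (2 * negIUnit (-1)), mul_inv, mul_inv] at b
  have hne : ((2 * negIUnit (-1)) ^ (n₀ + 1))⁻¹ ≠ 0 :=
    inv_ne_zero (pow_ne_zero _ (mul_ne_zero two_ne_zero h2))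
  apply hk
  have e : (2 * negIUnit (-1))⁻¹ - (2 * negIUnit 1)⁻¹ = -I := by
    simp [negIUnit]
    ring
  have : k₂ * (((2 * negIUnit (-1)) ^ (n₀ + 1))⁻¹ * -I) = 0 := by
    rw [← e]
    linear_combination b - (2 * negIUnit 1)⁻¹ * a
  simpa [hne] using this


/-! ### Laplace integrals up to the imaginary axis. -/

/-- The value of `∫₀^∞ e^{-as} e^{-η/s} f(s) ds` obtained by an integration by parts on `]1, ∞[`; it
also makes sense when `Re a = 0`. -/
def abelIntegral (f f' : ℝ → ℂ) (a : ℂ) (η : ℝ) : ℂ :=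
  (∫ s in Set.Ioc (0 : ℝ) 1, cexp (-(a * s)) * Real.exp (-(η / s)) * f s) +
    a⁻¹ * (cexp (-a) * Real.exp (-η) * f 1 +
      ∫ s in Set.Ioi (1 : ℝ), cexp (-(a * s)) * (Real.exp (-(η / s)) * (η / s ^ 2 * f s + f' s)))

section

variable {f f' : ℝ → ℂ} {B₁ B₂ : ℝ}

theorem norm_cexp_neg_mul_le_one {a : ℂ} (ha : 0 ≤ a.re) {s : ℝ} (hs : 0 ≤ s) :
    ‖cexp (-(a * s))‖ ≤ 1 := by
  rw [Complex.norm_exp, Complex.neg_re, Complex.re_mul_ofReal, Real.exp_le_one_iff]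
  have := mul_nonneg ha hs
  linarith

theorem norm_exp_neg_div_le_one {η : ℝ} (hη : 0 ≤ η) {s : ℝ} (hs : 0 ≤ s) :
    ‖(Real.exp (-(η / s)) : ℂ)‖ ≤ 1 := by
  rw [Complex.norm_real, Real.norm_of_nonneg (Real.exp_pos _).le, Real.exp_le_one_iff]
  have := div_nonneg hη hs
  linarith

theorem norm_abel_integrand_le (h₁ : ∀ s, 0 < s → ‖f s‖ ≤ B₁) {a : ℂ} (ha : 0 ≤ a.re) {η : ℝ}
    (hη : 0 ≤ η) {s : ℝ} (hs : 0 < s) :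
    ‖cexp (-(a * s)) * Real.exp (-(η / s)) * f s‖ ≤ B₁ := by
  rw [norm_mul, norm_mul]
  calc _ ≤ 1 * 1 * ‖f s‖ := by
        gcongr
        · exact norm_cexp_neg_mul_le_one ha hs.le
        · exact norm_exp_neg_div_le_one hη hs.le
    _ ≤ B₁ := by simpa using h₁ s hs

theorem norm_abel_deriv_le (h₁ : ∀ s, 0 < s → ‖f s‖ ≤ B₁) (h₂ : ∀ s, 1 ≤ s → ‖f' s‖ ≤ B₂ / s ^ 2)
    {a : ℂ} (ha : 0 ≤ a.re) {η : ℝ} (hη : 0 ≤ η) {s : ℝ} (hs : 1 ≤ s) :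
    ‖cexp (-(a * s)) * (Real.exp (-(η / s)) * (η / s ^ 2 * f s + f' s))‖ ≤
      (η * B₁ + B₂) * (s ^ 2)⁻¹ := by
  have hs0 : 0 < s := by linarith
  rw [norm_mul, norm_mul]
  have : ‖(η / s ^ 2 * f s + f' s : ℂ)‖ ≤ (η * B₁ + B₂) * (s ^ 2)⁻¹ := by
    refine (norm_add_le _ _).trans ?_
    have e : ‖(η / s ^ 2 * f s : ℂ)‖ = η / s ^ 2 * ‖f s‖ := by
      rw [norm_mul, norm_div, norm_pow, Complex.norm_real, Complex.norm_real,
        Real.norm_of_nonneg hη, Real.norm_of_nonneg hs0.le]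
    rw [e]
    calc _ ≤ η / s ^ 2 * B₁ + B₂ / s ^ 2 := by
          gcongr
          · exact h₁ s hs0
          · exact h₂ s hs
      _ = _ := by ring
  calc _ ≤ 1 * (1 * ‖(η / s ^ 2 * f s + f' s : ℂ)‖) := by
        gcongr
        · exact norm_cexp_neg_mul_le_one ha hs0.le
        · exact norm_exp_neg_div_le_one hη hs0.le
    _ ≤ _ := by simpa using this

theorem integrableOn_inv_sq_Ioi_one : IntegrableOn (fun s : ℝ => (s ^ 2)⁻¹) (Set.Ioi 1) := by
  have := integrableOn_Ioi_rpow_of_lt (a := -2) (by norm_num) (c := 1) one_pos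
  refine this.congr_fun (fun s hs => ?_) measurableSet_Ioi
  have hs0 : (0 : ℝ) < s := lt_trans one_pos hs
  simp only
  rw [Real.rpow_neg hs0.le, Real.rpow_two]

theorem integral_inv_sq_Ioi_one : ∫ s in Set.Ioi (1 : ℝ), (s ^ 2)⁻¹ = 1 := by
  have := integral_Ioi_rpow_of_lt (a := -2) (by norm_num) (c := 1) one_pos
  have e : ∫ s in Set.Ioi (1 : ℝ), (s ^ 2)⁻¹ = ∫ s in Set.Ioi (1 : ℝ), s ^ (-2 : ℝ) := by
    refine setIntegral_congr_fun measurableSet_Ioi fun s hs => ?_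
    have hs0 : (0 : ℝ) < s := lt_trans one_pos hs
    rw [Real.rpow_neg hs0.le, Real.rpow_two]
  rw [e, this]; norm_num

/-- No continuity of `f'` is needed: on S it agrees with `deriv f`, which is always measurable. -/
theorem aestronglyMeasurable_of_hasDerivAt (hf : ∀ s, 0 < s → HasDerivAt f (f' s) s) {S : Set ℝ}
    (hS : MeasurableSet S) (hS' : S ⊆ Set.Ioi 0) : AEStronglyMeasurable f' (volume.restrict S) := by
  refine (aestronglyMeasurable_deriv f _).congr ?_
  exact (ae_restrict_iff' hS).2 (Eventually.of_forall fun s hs => (hf s (hS' hs)).deriv)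

theorem aestronglyMeasurable_abel_integrand (hf : ∀ s, 0 < s → HasDerivAt f (f' s) s) (a : ℂ)
    (η : ℝ) {S : Set ℝ} (hS : MeasurableSet S) (hS' : S ⊆ Set.Ioi 0) :
    AEStronglyMeasurable (fun s : ℝ => cexp (-(a * s)) * Real.exp (-(η / s)) * f s)
      (volume.restrict S) := by
  have hc : ContinuousOn f S := fun s hs => (hf s (hS' hs)).continuousAt.continuousWithinAt
  refine (Measurable.aestronglyMeasurable ?_).mul (hc.aestronglyMeasurable hS)
  fun_prop

theorem aestronglyMeasurable_abel_deriv (hf : ∀ s, 0 < s → HasDerivAt f (f' s) s) (a : ℂ)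
    (η : ℝ) {S : Set ℝ} (hS : MeasurableSet S) (hS' : S ⊆ Set.Ioi 0) :
    AEStronglyMeasurable (fun s : ℝ => cexp (-(a * s)) * (Real.exp (-(η / s)) *
      (η / s ^ 2 * f s + f' s))) (volume.restrict S) := by
  have hc : ContinuousOn f S := fun s hs => (hf s (hS' hs)).continuousAt.continuousWithinAt
  have h1 := hc.aestronglyMeasurable (μ := volume) hS
  have h2 := aestronglyMeasurable_of_hasDerivAt hf hS hS'
  refine (Measurable.aestronglyMeasurable (by fun_prop)).mul
    ((Measurable.aestronglyMeasurable (by fun_prop)).mul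
      (((Measurable.aestronglyMeasurable (by fun_prop)).mul h1).add h2))

theorem integrableOn_abel_deriv (hf : ∀ s, 0 < s → HasDerivAt f (f' s) s)
    (h₁ : ∀ s, 0 < s → ‖f s‖ ≤ B₁) (h₂ : ∀ s, 1 ≤ s → ‖f' s‖ ≤ B₂ / s ^ 2)
    {a : ℂ} (ha : 0 ≤ a.re) {η : ℝ} (hη : 0 ≤ η) :
    IntegrableOn (fun s : ℝ => cexp (-(a * s)) * (Real.exp (-(η / s)) *
      (η / s ^ 2 * f s + f' s))) (Set.Ioi 1) := by
  refine Integrable.mono' (integrableOn_inv_sq_Ioi_one.const_mul (η * B₁ + B₂))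
    (aestronglyMeasurable_abel_deriv hf a η measurableSet_Ioi (Set.Ioi_subset_Ioi zero_le_one)) ?_
  exact (ae_restrict_iff' measurableSet_Ioi).2 (Eventually.of_forall fun s (hs : 1 < s) =>
    norm_abel_deriv_le h₁ h₂ ha hη hs.le)

theorem integrableOn_abel_integrand (hf : ∀ s, 0 < s → HasDerivAt f (f' s) s)
    (h₁ : ∀ s, 0 < s → ‖f s‖ ≤ B₁) {a : ℂ} (ha : 0 < a.re) {η : ℝ} (hη : 0 ≤ η) :
    IntegrableOn (fun s : ℝ => cexp (-(a * s)) * Real.exp (-(η / s)) * f s) (Set.Ioi 0) := by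
  have hi : IntegrableOn (fun s : ℝ => Real.exp (-a.re * s) * B₁) (Set.Ioi 0) :=
    (integrableOn_exp_mul_Ioi (by linarith) 0).mul_const B₁
  refine Integrable.mono' hi
    (aestronglyMeasurable_abel_integrand hf a η measurableSet_Ioi subset_rfl) ?_
  refine (ae_restrict_iff' measurableSet_Ioi).2 (Eventually.of_forall fun s (hs : 0 < s) => ?_)
  rw [norm_mul, norm_mul]
  calc _ ≤ Real.exp (-a.re * s) * 1 * ‖f s‖ := by
        gcongr
        · rw [Complex.norm_exp, Complex.neg_re, Complex.re_mul_ofReal]; simp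
        · exact norm_exp_neg_div_le_one hη hs.le
    _ ≤ _ := by
        rw [mul_one]
        gcongr
        exact h₁ s hs

/-- For Re a > 0 the integrand and its derivative are both integrable on ]1, ∞[, so the boundary
term at infinity vanishes. The gain is that the remaining integrand is O(s^{-2}) without using Re a
> 0. -/
theorem integral_eq_abelIntegral (hf : ∀ s, 0 < s → HasDerivAt f (f' s) s)
    (h₁ : ∀ s, 0 < s → ‖f s‖ ≤ B₁) (h₂ : ∀ s, 1 ≤ s → ‖f' s‖ ≤ B₂ / s ^ 2)
    {a : ℂ} (ha : 0 < a.re) {η : ℝ} (hη : 0 ≤ η) :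
    ∫ s in Set.Ioi (0 : ℝ), cexp (-(a * s)) * Real.exp (-(η / s)) * f s =
      abelIntegral f f' a η := by
  have ha0 : a ≠ 0 := by rintro rfl; simp at ha
  have I0 := integrableOn_abel_integrand hf h₁ ha hη
  have I1 := I0.mono_set (Set.Ioc_subset_Ioi_self (a := (1 : ℝ)) (b := 0))
  have I2 := I0.mono_set (Set.Ioi_subset_Ioi (zero_le_one (α := ℝ)))
  have I3 := integrableOn_abel_deriv hf h₁ h₂ ha.le hη
  have hd : ∀ s ∈ Set.Ici (1 : ℝ), HasDerivAt
      (fun s : ℝ => cexp (-(a * s)) * Real.exp (-(η / s)) * f s)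
      (cexp (-(a * s)) * (Real.exp (-(η / s)) * (η / s ^ 2 * f s + f' s)) -
        a * (cexp (-(a * s)) * Real.exp (-(η / s)) * f s)) s := by
    intro s hs
    have hs0 : (0 : ℝ) < s := lt_of_lt_of_le one_pos hs
    have d1 : HasDerivAt (fun s : ℝ => cexp (-(a * s))) (-a * cexp (-(a * s))) s := by
      refine ((((hasDerivAt_id s).ofReal_comp.const_mul a).neg).cexp).congr_deriv ?_
      simp; ring
    have d2 : HasDerivAt (fun s : ℝ => Real.exp (-(η / s)))
        (Real.exp (-(η / s)) * (η / s ^ 2)) s := by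
      have : HasDerivAt (fun s : ℝ => -(η / s)) (η / s ^ 2) s := by
        refine ((((hasDerivAt_inv hs0.ne').const_mul η).neg).congr_deriv ?_)
        field_simp
      exact this.exp
    refine ((d1.mul d2.ofReal_comp).mul (hf s hs0)).congr_deriv ?_
    simp only [Pi.mul_apply]
    push_cast
    ring
  have I4 : IntegrableOn (fun s : ℝ =>
      cexp (-(a * s)) * (Real.exp (-(η / s)) * (η / s ^ 2 * f s + f' s)) -
        a * (cexp (-(a * s)) * Real.exp (-(η / s)) * f s)) (Set.Ioi 1) := I3.sub (I2.const_mul a)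
  have T := tendsto_zero_of_hasDerivAt_of_integrableOn_Ioi
    (fun s hs => hd s (Set.Ioi_subset_Ici_self hs)) I4 I2
  have key := integral_Ioi_of_hasDerivAt_of_tendsto' hd I4 T
  rw [integral_sub I3 (I2.const_mul a), integral_const_mul] at key
  rw [← Set.Ioc_union_Ioi_eq_Ioi (zero_le_one (α := ℝ)),
    setIntegral_union (Set.Ioc_disjoint_Ioi le_rfl) measurableSet_Ioi I1 I2, abelIntegral]
  congr 1
  simp only [Complex.ofReal_one, mul_one, div_one] at key
  rw [eq_inv_mul_iff_mul_eq₀ ha0]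
  linear_combination -key

/-- Dominated convergence with the constant B₁ on ]0, 1] and (K B₁ + B₂)/s² on ]1, ∞[. Joint
continuity serves both limits, a → c m² and η → 0. -/
theorem continuousOn_abelIntegral (hf : ∀ s, 0 < s → HasDerivAt f (f' s) s)
    (h₁ : ∀ s, 0 < s → ‖f s‖ ≤ B₁) (h₂ : ∀ s, 1 ≤ s → ‖f' s‖ ≤ B₂ / s ^ 2) (K : ℝ) :
    ContinuousOn (fun p : ℂ × ℝ => abelIntegral f f' p.1 p.2)
      {p | (0 ≤ p.1.re ∧ p.1 ≠ 0) ∧ 0 ≤ p.2 ∧ p.2 ≤ K} := by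
  have hB₁ : 0 ≤ B₁ := (norm_nonneg _).trans (h₁ 1 one_pos)
  unfold abelIntegral
  refine ContinuousOn.add ?_ (ContinuousOn.mul (continuousOn_fst.inv₀ fun p hp => hp.1.2)
    (ContinuousOn.add (Continuous.continuousOn (by fun_prop)) ?_))
  · refine continuousOn_of_dominated (bound := fun _ => B₁)
      (fun p _ => aestronglyMeasurable_abel_integrand hf p.1 p.2 measurableSet_Ioc
        Set.Ioc_subset_Ioi_self) (fun p hp => ?_) (by simp) (Eventually.of_forall fun s => ?_)
    · exact (ae_restrict_iff' measurableSet_Ioc).2 (Eventually.of_forall fun s hs =>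
        norm_abel_integrand_le h₁ hp.1.1 hp.2.1 hs.1)
    · exact Continuous.continuousOn (by fun_prop)
  · refine continuousOn_of_dominated (bound := fun s => (K * B₁ + B₂) * (s ^ 2)⁻¹)
      (fun p _ => aestronglyMeasurable_abel_deriv hf p.1 p.2 measurableSet_Ioi
        (Set.Ioi_subset_Ioi zero_le_one)) (fun p hp => ?_)
      (integrableOn_inv_sq_Ioi_one.const_mul _) (Eventually.of_forall fun s => ?_)
    · refine (ae_restrict_iff' measurableSet_Ioi).2 (Eventually.of_forall fun s (hs : 1 < s) => ?_)
      refine (norm_abel_deriv_le h₁ h₂ hp.1.1 hp.2.1 hs.le).trans ?_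
      gcongr
      exact hp.2.2
    · exact Continuous.continuousOn (by fun_prop)

/-- The bound is linear in B₁ and B₂, which will be integrals of Schwartz functions; hence the
limiting functional is continuous. -/
theorem norm_abelIntegral_le
    (h₁ : ∀ s, 0 < s → ‖f s‖ ≤ B₁) (h₂ : ∀ s, 1 ≤ s → ‖f' s‖ ≤ B₂ / s ^ 2)
    {a : ℂ} (ha : 0 ≤ a.re) : ‖abelIntegral f f' a 0‖ ≤ B₁ + ‖a‖⁻¹ * (B₁ + B₂) := by
  unfold abelIntegral
  refine (norm_add_le _ _).trans (add_le_add ?_ ?_)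
  · have := norm_setIntegral_le_of_norm_le_const (μ := volume) (s := Set.Ioc (0 : ℝ) 1)
      (f := fun s : ℝ => cexp (-(a * s)) * Real.exp (-(0 / s)) * f s) (C := B₁) (by simp)
      (fun s hs => norm_abel_integrand_le h₁ ha le_rfl hs.1)
    simpa using this
  · rw [norm_mul, norm_inv]
    gcongr
    refine (norm_add_le _ _).trans (add_le_add ?_ ?_)
    · have := norm_abel_integrand_le h₁ ha (le_refl 0) one_pos
      simpa using this
    · have := norm_integral_le_of_norm_le (μ := volume.restrict (Set.Ioi (1 : ℝ)))
        (f := fun s : ℝ => cexp (-(a * s)) * (Real.exp (-((0 : ℝ) / s)) *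
          (((0 : ℝ) : ℂ) / s ^ 2 * f s + f' s)))
        (integrableOn_inv_sq_Ioi_one.const_mul (0 * B₁ + B₂))
        ((ae_restrict_iff' measurableSet_Ioi).2 (Eventually.of_forall fun s (hs : 1 < s) =>
          norm_abel_deriv_le h₁ h₂ ha le_rfl hs.le))
      rw [integral_const_mul, integral_inv_sq_Ioi_one, zero_mul, zero_add, mul_one] at this
      exact this

end


/-! ### The Fourier transform of imaginary Gaussians of Minkowski signature. -/

theorem integral_minkowski_eq_integral_pi {d : ℕ} (F : Minkowski d → ℂ) :
    ∫ p, F p = ∫ v : Fin d → ℝ, F (WithLp.toLp 2 v) :=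
  ((PiLp.volume_preserving_toLp (Fin d)).integral_comp
    (MeasurableEquiv.toLp 2 (Fin d → ℝ)).measurableEmbedding F).symm

theorem norm_cexp_neg_sum {d : ℕ} (b : Fin d → ℂ) {η : ℝ} (hb : ∀ i, (b i).re = η)
    (p : Minkowski d) :
    ‖cexp (-∑ i, b i * (p i : ℂ) ^ 2)‖ = Real.exp (-η * ‖p‖ ^ 2) := by
  rw [Complex.norm_exp, Complex.neg_re, Complex.re_sum, EuclideanSpace.norm_sq_eq, Finset.mul_sum,
    ← Finset.sum_neg_distrib]
  congr 1
  refine Finset.sum_congr rfl fun i _ => ?_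
  rw [← Complex.ofReal_pow, Complex.re_mul_ofReal, hb, Real.norm_eq_abs, sq_abs]
  ring

theorem continuous_cexp_neg_sum {d : ℕ} (b : Fin d → ℂ) :
    Continuous fun p : Minkowski d => cexp (-∑ i, b i * (p i : ℂ) ^ 2) := by
  fun_prop

theorem integrable_cexp_neg_sum {d : ℕ} {b : Fin d → ℂ} {η : ℝ} (hη : 0 < η)
    (hb : ∀ i, (b i).re = η) :
    Integrable fun p : Minkowski d => cexp (-∑ i, b i * (p i : ℂ) ^ 2) := by
  have h := (GaussianFourier.integrable_cexp_neg_mul_sq_norm_add (V := Minkowski d) (b := (η : ℂ))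
    (by simpa using hη) 0 0).norm
  refine Integrable.mono' h (continuous_cexp_neg_sum b).aestronglyMeasurable
    (Eventually.of_forall fun p => ?_)
  rw [norm_cexp_neg_sum b hb, Complex.norm_exp]
  apply le_of_eq
  congr 1
  simp [← Complex.ofReal_pow]

section

variable {d : ℕ} [NeZero d]

theorem minkowskiSign_sq (i : Fin d) : minkowskiSign i ^ 2 = 1 := by
  unfold minkowskiSign; split_ifs <;> norm_num

theorem minkowskiSign_ne_zero (i : Fin d) : minkowskiSign i ≠ 0 := by
  unfold minkowskiSign; split_ifs <;> norm_num

theorem continuous_minkowskiSq : Continuous (minkowskiSq (d := d)) := by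
  unfold minkowskiSq minkowskiProd; fun_prop

theorem hasTemperateGrowth_minkowskiSq :
    (fun x : Minkowski d => (minkowskiSq x : ℂ)).HasTemperateGrowth := by
  have h : ∀ i : Fin d, (fun x : Minkowski d => ((x i : ℝ) : ℂ)).HasTemperateGrowth := fun i =>
    (Complex.ofRealCLM.comp (EuclideanSpace.proj (𝕜 := ℝ) i)).hasTemperateGrowth
  have e : (fun x : Minkowski d => (minkowskiSq x : ℂ)) = fun x : Minkowski d =>
      ∑ i, (minkowskiSign i : ℂ) * ((x i : ℝ) : ℂ) * ((x i : ℝ) : ℂ) := by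
    funext x; simp only [minkowskiSq, minkowskiProd]; push_cast; rfl
  rw [e]
  exact Function.HasTemperateGrowth.sum fun i _ =>
    ((Function.HasTemperateGrowth.const _).mul (h i)).mul (h i)

theorem integral_gaussian_mul_cexp_minkowskiProd {b : Fin d → ℂ} (hb : ∀ i, 0 < (b i).re)
    (x : Minkowski d) :
    ∫ p : Minkowski d, cexp (-∑ i, b i * (p i : ℂ) ^ 2) * cexp (I * minkowskiProd p x) =
      (∏ i, (Real.pi / b i) ^ (1 / 2 : ℂ)) * cexp (-∑ i, (x i : ℂ) ^ 2 / (4 * b i)) := by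
  rw [integral_minkowski_eq_integral_pi]
  have := GaussianFourier.integral_cexp_neg_sum_mul_add hb (fun i => I * (minkowskiSign i * x i))
  rw [Finset.prod_mul_distrib, ← Complex.exp_sum] at this
  convert! this using 2
  · funext v
    rw [← Complex.exp_add, minkowskiProd]
    congr 2
    push_cast
    rw [Finset.mul_sum]
    refine Finset.sum_congr rfl fun i _ => ?_
    ring
  · rw [← Finset.sum_neg_distrib]
    congr 1
    refine Finset.sum_congr rfl fun i _ => ?_
    have h : (minkowskiSign i : ℂ) ^ 2 = 1 := by exact_mod_cast minkowskiSign_sq i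
    rw [mul_pow, mul_pow, h, Complex.I_sq]
    ring

theorem continuous_minkowskiProd :
    Continuous fun z : Minkowski d × Minkowski d => minkowskiProd z.1 z.2 := by
  unfold minkowskiProd; fun_prop

theorem integral_gaussian_mul_minkowskiTransform {b : Fin d → ℂ} {η : ℝ} (hη : 0 < η)
    (hb : ∀ i, (b i).re = η) (φ : 𝓢(Minkowski d, ℂ)) :
    ∫ p, cexp (-∑ i, b i * (p i : ℂ) ^ 2) * minkowskiTransform d φ p =
      ((2 * Real.pi : ℂ) ^ d)⁻¹ * (∏ i, (Real.pi / b i) ^ (1 / 2 : ℂ)) *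
        ∫ x : Minkowski d, cexp (-∑ i, (x i : ℂ) ^ 2 / (4 * b i)) * φ x := by
  set F : Minkowski d → Minkowski d → ℂ := fun p x =>
    cexp (I * minkowskiProd p x) * (cexp (-∑ i, b i * (p i : ℂ) ^ 2) * φ x) with hF
  have hint : Integrable (Function.uncurry F) (volume.prod volume) := by
    refine Integrable.mono ((integrable_cexp_neg_sum hη hb).mul_prod φ.integrable) ?_
      (Eventually.of_forall fun z => ?_)
    · refine Continuous.aestronglyMeasurable ?_
      have := continuous_minkowskiProd (d := d)
      have := φ.continuous
      simp only [hF, Function.uncurry_def]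
      fun_prop
    · simp only [hF, Function.uncurry_def]
      rw [norm_mul, mul_comm I, Complex.norm_exp_ofReal_mul_I, one_mul]
  have h1 : ∫ p, cexp (-∑ i, b i * (p i : ℂ) ^ 2) * minkowskiTransform d φ p =
      ((2 * Real.pi : ℂ) ^ d)⁻¹ * ∫ p, ∫ x, F p x := by
    rw [← integral_const_mul]
    refine integral_congr_ae (Eventually.of_forall fun p => ?_)
    simp only [hF]
    rw [minkowskiTransform_apply, mul_left_comm, ← integral_const_mul]
    congr 1
    refine integral_congr_ae (Eventually.of_forall fun x => ?_)
    simp only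
    ring
  rw [h1, integral_integral_swap hint, mul_assoc]
  congr 1
  rw [← integral_const_mul]
  refine integral_congr_ae (Eventually.of_forall fun x => ?_)
  simp only [hF]
  rw [← mul_assoc, ← integral_gaussian_mul_cexp_minkowskiProd (fun i => by rw [hb]; exact hη),
    ← integral_mul_const]
  refine integral_congr_ae (Eventually.of_forall fun p => ?_)
  simp only
  ring

theorem negIUnit_neg (σ : ℤˣ) : negIUnit (-σ) = -negIUnit σ := by
  rcases Int.units_eq_one_or σ with rfl | rfl <;> simp [negIUnit]

theorem negIUnit_neg_cpow_half_mul (σ : ℤˣ) :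
    negIUnit (-σ) ^ (1 / 2 : ℂ) * negIUnit σ ^ (1 / 2 : ℂ) = 1 := by
  have h : Complex.log (negIUnit (-σ)) + Complex.log (negIUnit σ) = 0 := by
    rcases Int.units_eq_one_or σ with rfl | rfl <;>
      simp [negIUnit, Complex.log_I, Complex.log_neg_I]
  rw [Complex.cpow_def_of_ne_zero (negIUnit_ne_zero _), Complex.cpow_def_of_ne_zero
    (negIUnit_ne_zero _), ← Complex.exp_add, ← add_mul, h, zero_mul, Complex.exp_zero]

theorem gaussian_constant_real (d : ℕ) {s : ℝ} (hs : 0 < s) :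
    ((2 * Real.pi) ^ d)⁻¹ * √(Real.pi / s) ^ d =
      ((4 * Real.pi) ^ ((d : ℝ) / 2))⁻¹ * s ^ (-((d : ℝ) / 2)) := by
  have hπ := Real.pi_pos
  have h1 : ∀ x : ℝ, 0 ≤ x → √x ^ d = x ^ ((d : ℝ) / 2) := by
    intro x hx
    rw [Real.sqrt_eq_rpow, ← Real.rpow_natCast, ← Real.rpow_mul hx]
    congr 1; ring
  have h2 : (2 * Real.pi) ^ d = (4 * Real.pi) ^ ((d : ℝ) / 2) * Real.pi ^ ((d : ℝ) / 2) := by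
    rw [← Real.mul_rpow (by positivity) hπ.le, ← h1 _ (by positivity)]
    congr 1
    rw [show 4 * Real.pi * Real.pi = (2 * Real.pi) ^ 2 by ring, Real.sqrt_sq (by positivity)]
  have h3 : 0 < Real.pi ^ ((d : ℝ) / 2) := Real.rpow_pos_of_pos hπ _
  have h4 : 0 < (4 * Real.pi) ^ ((d : ℝ) / 2) := Real.rpow_pos_of_pos (by positivity) _
  rw [h1 _ (by positivity), Real.div_rpow hπ.le hs.le, h2, Real.rpow_neg hs.le]
  field_simp

/-- The d - 1 space directions contribute c^{1/2} each and the time direction (-c)^{1/2}. These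
principal roots are inverse to each other, so one pair cancels and c^{(d-2)/2} remains. -/
theorem gaussian_constant (hd : 2 ≤ d) (σ : ℤˣ) {s : ℝ} (hs : 0 < s) :
    ((2 * Real.pi : ℂ) ^ d)⁻¹ *
        (∏ i : Fin d, (Real.pi / (-(minkowskiSign i * negIUnit σ * s))) ^ (1 / 2 : ℂ)) =
      negIUnit σ ^ ((d : ℂ) / 2 - 1) / (((4 * Real.pi) ^ ((d : ℝ) / 2) : ℝ) : ℂ) *
        ((s ^ (-((d : ℝ) / 2)) : ℝ) : ℂ) := by
  have hπs : 0 < Real.pi / s := div_pos Real.pi_pos hs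
  have hs0 : (s : ℂ) ≠ 0 := by exact_mod_cast hs.ne'
  have hre : 0 < ((Real.pi / s : ℝ) : ℂ).re := by rw [Complex.ofReal_re]; exact hπs
  have hsq : ((Real.pi / s : ℝ) : ℂ) ^ (1 / 2 : ℂ) = (√(Real.pi / s) : ℂ) := by
    have : (1 / 2 : ℂ) = ((1 / 2 : ℝ) : ℂ) := by push_cast; rfl
    rw [this, ← Complex.ofReal_cpow hπs.le, ← Real.sqrt_eq_rpow]
  have hc0 := negIUnit_ne_zero σ
  have hi : ∀ τ : ℤˣ, (Real.pi / (-(negIUnit τ * s)) : ℂ) ^ (1 / 2 : ℂ) =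
      negIUnit τ ^ (1 / 2 : ℂ) * (√(Real.pi / s) : ℂ) := by
    intro τ
    rw [← hsq, ← negIUnit_mul_cpow τ hre]
    congr 1
    have := negIUnit_ne_zero τ
    push_cast
    field_simp
    linear_combination -negIUnit_sq τ
  have h0 : (Real.pi / (-(minkowskiSign (0 : Fin d) * negIUnit σ * s)) : ℂ) ^ (1 / 2 : ℂ) =
      negIUnit (-σ) ^ (1 / 2 : ℂ) * (√(Real.pi / s) : ℂ) := by
    rw [← hi, negIUnit_neg]; simp [minkowskiSign]
  have h1 : ∀ i ∈ (Finset.univ : Finset (Fin d)).erase 0,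
      (Real.pi / (-(minkowskiSign i * negIUnit σ * s)) : ℂ) ^ (1 / 2 : ℂ) =
      negIUnit σ ^ (1 / 2 : ℂ) * (√(Real.pi / s) : ℂ) := by
    intro i hi'
    rw [← hi]; simp [minkowskiSign, Finset.ne_of_mem_erase hi']
  rw [← Finset.mul_prod_erase Finset.univ _ (Finset.mem_univ (0 : Fin d)), h0,
    Finset.prod_congr rfl h1, Finset.prod_const, Finset.card_erase_of_mem (Finset.mem_univ _),
    Finset.card_univ, Fintype.card_fin]
  obtain ⟨k, rfl⟩ : ∃ k, d = k + 2 := ⟨d - 2, by omega⟩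
  have hk : negIUnit σ ^ (((k + 2 : ℕ) : ℂ) / 2 - 1) = (negIUnit σ ^ (1 / 2 : ℂ)) ^ k := by
    rw [← Complex.cpow_nat_mul]; congr 1; push_cast; ring
  have hr := congrArg (fun r : ℝ => (r : ℂ)) (gaussian_constant_real (k + 2) hs)
  simp only [Complex.ofReal_mul, Complex.ofReal_inv] at hr
  rw [hk, show k + 2 - 1 = k + 1 from rfl]
  have := negIUnit_neg_cpow_half_mul σ
  push_cast at hr ⊢
  linear_combination (((2 * Real.pi : ℂ) ^ (k + 2))⁻¹ * (√(Real.pi / s) : ℂ) ^ (k + 2) *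
    (negIUnit σ ^ (1 / 2 : ℂ)) ^ k) * this + (negIUnit σ ^ (1 / 2 : ℂ)) ^ k * hr

/-- The Fourier transform of the imaginary Gaussian `e^{-iσ s p²}`. -/
theorem integral_cexp_minkowskiSq_mul_minkowskiTransform (hd : 2 ≤ d) (σ : ℤˣ) {s : ℝ}
    (hs : 0 < s) (φ : 𝓢(Minkowski d, ℂ)) :
    ∫ p, cexp (negIUnit σ * s * minkowskiSq p) * minkowskiTransform d φ p =
      negIUnit σ ^ ((d : ℂ) / 2 - 1) / (((4 * Real.pi) ^ ((d : ℝ) / 2) : ℝ) : ℂ) *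
        ((s ^ (-((d : ℝ) / 2)) : ℝ) : ℂ) *
        ∫ x : Minkowski d, cexp (-(negIUnit σ * minkowskiSq x / 4 / s)) * φ x := by
  -- The real part η makes the Gaussian integrable; η = 0 is the oscillatory case, recovered as η ↘
  -- 0 under the domination by the Schwartz factor.
  set b : ℝ → Fin d → ℂ := fun η i => η - minkowskiSign i * negIUnit σ * s with hbdef
  have hb : ∀ η i, (b η i).re = η := by
    intro η i
    simp only [hbdef]
    rw [Complex.sub_re, Complex.re_mul_ofReal, Complex.re_ofReal_mul, negIUnit_re]; simp
  have hs0 : (s : ℂ) ≠ 0 := by exact_mod_cast hs.ne'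
  have hc0 := negIUnit_ne_zero σ
  have hb0 : ∀ η i, b η i ≠ 0 := by
    intro η i h
    have h1 := congrArg Complex.im h
    simp only [hbdef] at h1
    rw [Complex.sub_im, Complex.im_mul_ofReal, Complex.im_ofReal_mul] at h1
    have h2 : (negIUnit σ).im ≠ 0 := fun h => by have := negIUnit_im_sq σ; simp [h] at this
    simp [minkowskiSign_ne_zero, h2, hs.ne'] at h1
  have hbc : ∀ i, Continuous fun η : ℝ => b η i := fun i => by simp only [hbdef]; fun_prop
  have hpos : ∀ᶠ η : ℝ in 𝓝[>] 0, 0 < η := self_mem_nhdsWithin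
  have hle : 𝓝[>] (0 : ℝ) ≤ 𝓝 0 := nhdsWithin_le_nhds
  have e0 : ∀ p : Minkowski d, -∑ i, b 0 i * (p i : ℂ) ^ 2 = negIUnit σ * s * minkowskiSq p := by
    intro p
    simp only [hbdef, minkowskiSq, minkowskiProd]
    push_cast
    rw [Finset.mul_sum, ← Finset.sum_neg_distrib]
    refine Finset.sum_congr rfl fun i _ => ?_
    ring
  have e1 : ∀ x : Minkowski d, -∑ i, (x i : ℂ) ^ 2 / (4 * b 0 i) =
      -(negIUnit σ * minkowskiSq x / 4 / s) := by
    intro x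
    simp only [hbdef, minkowskiSq, minkowskiProd]
    push_cast
    rw [Finset.mul_sum, Finset.sum_div, Finset.sum_div]
    congr 1
    refine Finset.sum_congr rfl fun i _ => ?_
    have h1 : (minkowskiSign i : ℂ) ≠ 0 := by exact_mod_cast minkowskiSign_ne_zero i
    have h2 : (minkowskiSign i : ℂ) ^ 2 = 1 := by exact_mod_cast minkowskiSign_sq i
    rw [zero_sub]
    field_simp
    linear_combination (-(x i : ℂ) ^ 2 * (minkowskiSign i : ℂ) ^ 2) * negIUnit_sq σ +
      (x i : ℂ) ^ 2 * h2
  have T1 : Tendsto (fun η : ℝ => ∫ p : Minkowski d, cexp (-∑ i, b η i * (p i : ℂ) ^ 2) *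
      minkowskiTransform d φ p) (𝓝[>] 0)
      (𝓝 (∫ p : Minkowski d, cexp (negIUnit σ * s * minkowskiSq p) *
        minkowskiTransform d φ p)) := by
    refine tendsto_integral_filter_of_dominated_convergence
      (fun p => ‖minkowskiTransform d φ p‖) (Eventually.of_forall fun η =>
        ((continuous_cexp_neg_sum (b η)).mul (minkowskiTransform d φ).continuous).aestronglyMeasurable)
      (hpos.mono fun η hη => Eventually.of_forall fun p => ?_)
      (minkowskiTransform d φ).integrable.norm (Eventually.of_forall fun p => ?_)
    · rw [norm_mul, norm_cexp_neg_sum (b η) (hb η)]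
      refine mul_le_of_le_one_left (norm_nonneg _) (Real.exp_le_one_iff.2 ?_)
      have := mul_nonneg hη.le (sq_nonneg ‖p‖)
      linarith
    · refine Tendsto.mul_const _ ?_
      rw [← e0]
      have : Continuous fun η : ℝ => cexp (-∑ i, b η i * (p i : ℂ) ^ 2) := by fun_prop
      exact (this.tendsto 0).mono_left hle
  have T2 : Tendsto (fun η : ℝ => ∫ x : Minkowski d, cexp (-∑ i, (x i : ℂ) ^ 2 / (4 * b η i)) * φ x)
      (𝓝[>] 0)
      (𝓝 (∫ x : Minkowski d, cexp (-(negIUnit σ * minkowskiSq x / 4 / s)) * φ x)) := by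
    refine tendsto_integral_filter_of_dominated_convergence
      (fun x => ‖φ x‖) (Eventually.of_forall fun η =>
        Continuous.aestronglyMeasurable ?_)
      (hpos.mono fun η hη => Eventually.of_forall fun x => ?_)
      φ.integrable.norm (Eventually.of_forall fun x => ?_)
    · have := φ.continuous
      fun_prop
    · rw [norm_mul]
      refine mul_le_of_le_one_left (norm_nonneg _) ?_
      rw [Complex.norm_exp, Real.exp_le_one_iff, Complex.neg_re, Complex.re_sum,
        Left.neg_nonpos_iff]
      refine Finset.sum_nonneg fun i _ => ?_
      have : (x i : ℂ) ^ 2 / (4 * b η i) = ((x i ^ 2 / 4 : ℝ) : ℂ) * (b η i)⁻¹ := by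
        push_cast; field_simp
      rw [this, Complex.re_ofReal_mul, Complex.inv_re, hb]
      have := Complex.normSq_nonneg (b η i)
      positivity
    · refine Tendsto.mul_const _ ?_
      rw [← e1]
      have : Continuous fun η : ℝ => cexp (-∑ i, (x i : ℂ) ^ 2 / (4 * b η i)) := by
        refine Complex.continuous_exp.comp (continuous_finsetSum _ fun i _ => ?_).neg
        exact continuous_const.div (continuous_const.mul (hbc i)) fun η =>
          mul_ne_zero (by norm_num) (hb0 η i)
      exact (this.tendsto 0).mono_left hle
  have T3 : Tendsto (fun η : ℝ => ∏ i, (Real.pi / b η i) ^ (1 / 2 : ℂ)) (𝓝[>] 0)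
      (𝓝 (∏ i : Fin d, (Real.pi / (-(minkowskiSign i * negIUnit σ * s))) ^ (1 / 2 : ℂ))) := by
    refine tendsto_finsetProd _ fun i _ => ?_
    have e : b 0 i = -(minkowskiSign i * negIUnit σ * s) := by simp [hbdef]
    rw [← e]
    -- At η = 0 the base is purely imaginary and nonzero, hence off the cut: the principal root is
    -- continuous there and no branch jump occurs.
    have hc : ContinuousAt (fun η : ℝ => (Real.pi / b η i) ^ (1 / 2 : ℂ)) 0 := by
      refine (continuousAt_const.div (hbc i).continuousAt (hb0 0 i)).cpow continuousAt_const ?_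
      show (Real.pi / b 0 i : ℂ) ∈ slitPlane
      refine mem_slitPlane_of_re_nonneg ?_
        (div_ne_zero (by exact_mod_cast Real.pi_ne_zero) (hb0 0 i))
      rw [div_eq_mul_inv, Complex.re_ofReal_mul, Complex.inv_re, hb]
      simp
    exact hc.tendsto.mono_left hle
  have T4 := (T3.const_mul ((2 * Real.pi : ℂ) ^ d)⁻¹).mul T2
  rw [gaussian_constant hd σ hs] at T4
  refine tendsto_nhds_unique T1 (T4.congr' ?_)
  filter_upwards [hpos] with η hη
  exact (integral_gaussian_mul_minkowskiTransform hη (hb η) φ).symm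

end


/-! ### The evolution in s and the momentum-space limit. -/

section

variable {d : ℕ} [NeZero d]

/-- The oscillatory integral `∫ e^{iσ v x² / 4} φ(x) dx`. -/
def oscillatoryIntegral (σ : ℤˣ) (φ : 𝓢(Minkowski d, ℂ)) (v : ℝ) : ℂ :=
  ∫ x : Minkowski d, cexp (-(negIUnit σ * minkowskiSq x / 4 * v)) * φ x

theorem norm_cexp_negIUnit_mul_ofReal (σ : ℤˣ) (r : ℝ) : ‖cexp (negIUnit σ * r)‖ = 1 := by
  rw [Complex.norm_exp, Complex.re_mul_ofReal, negIUnit_re, zero_mul, Real.exp_zero]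

theorem norm_oscillatory_factor (σ : ℤˣ) (x : Minkowski d) (v : ℝ) :
    ‖cexp (-(negIUnit σ * minkowskiSq x / 4 * v))‖ = 1 := by
  rw [← norm_cexp_negIUnit_mul_ofReal σ (-(minkowskiSq x / 4 * v))]
  congr 2; push_cast; ring

theorem norm_oscillatoryIntegral_le (σ : ℤˣ) (φ : 𝓢(Minkowski d, ℂ)) (v : ℝ) :
    ‖oscillatoryIntegral σ φ v‖ ≤ ∫ x, ‖φ x‖ := by
  refine norm_integral_le_of_norm_le φ.integrable.norm (Eventually.of_forall fun x => ?_)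
  rw [norm_mul, norm_oscillatory_factor, one_mul]

/-- Multiplication by `x²` on Schwartz functions. -/
def mulMinkowskiSq (d : ℕ) [NeZero d] : 𝓢(Minkowski d, ℂ) →L[ℂ] 𝓢(Minkowski d, ℂ) :=
  SchwartzMap.smulLeftCLM ℂ fun x : Minkowski d => (minkowskiSq x : ℂ)

theorem mulMinkowskiSq_apply (φ : 𝓢(Minkowski d, ℂ)) (x : Minkowski d) :
    mulMinkowskiSq d φ x = minkowskiSq x * φ x := by
  rw [mulMinkowskiSq, SchwartzMap.smulLeftCLM_apply_apply hasTemperateGrowth_minkowskiSq,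
    smul_eq_mul]

theorem hasDerivAt_oscillatoryIntegral (σ : ℤˣ) (φ : 𝓢(Minkowski d, ℂ)) (v : ℝ) :
    HasDerivAt (oscillatoryIntegral σ φ)
      (-(negIUnit σ / 4) * oscillatoryIntegral σ (mulMinkowskiSq d φ) v) v := by
  have hq := continuous_minkowskiSq (d := d)
  have hφ := φ.continuous
  have hc : ∀ v : ℝ, Continuous fun x : Minkowski d =>
      cexp (-(negIUnit σ * minkowskiSq x / 4 * v)) := fun v => by fun_prop
  have key := (hasDerivAt_integral_of_dominated_loc_of_deriv_le (μ := volume) (x₀ := v)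
    (s := Set.univ) (bound := fun x => ‖mulMinkowskiSq d φ x‖)
    (F := fun (v : ℝ) x => cexp (-(negIUnit σ * minkowskiSq x / 4 * v)) * φ x)
    (F' := fun (v : ℝ) x => -(negIUnit σ / 4) *
      (cexp (-(negIUnit σ * minkowskiSq x / 4 * v)) * mulMinkowskiSq d φ x)) Filter.univ_mem
    (Eventually.of_forall fun v => ((hc v).mul hφ).aestronglyMeasurable) ?_ ?_ ?_
    (mulMinkowskiSq d φ).integrable.norm ?_).2
  · refine key.congr_deriv ?_
    rw [oscillatoryIntegral, integral_const_mul]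
  · refine φ.integrable.mono ((hc v).mul hφ).aestronglyMeasurable (Eventually.of_forall fun x => ?_)
    rw [norm_mul, norm_oscillatory_factor, one_mul]
  · exact (continuous_const.mul ((hc v).mul (mulMinkowskiSq d φ).continuous)).aestronglyMeasurable
  · refine Eventually.of_forall fun x v _ => ?_
    rw [norm_mul, norm_mul, norm_oscillatory_factor, one_mul, norm_neg, norm_div, norm_negIUnit]
    refine mul_le_of_le_one_left (norm_nonneg _) ?_
    norm_num
  · refine Eventually.of_forall fun x v _ => ?_
    have h : HasDerivAt (fun v : ℝ => -(negIUnit σ * minkowskiSq x / 4 * v))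
        (-(negIUnit σ * minkowskiSq x / 4)) v := by
      simpa using ((hasDerivAt_id v).ofReal_comp.const_mul
        (negIUnit σ * minkowskiSq x / 4 : ℂ)).fun_neg
    refine ((h.cexp).mul_const (φ x)).congr_deriv ?_
    rw [mulMinkowskiSq_apply]
    ring

/-- The Schrödinger-type evolution `∫ e^{-iσ s p²} ψ(p) dp`. -/
def minkowskiEvolution (σ : ℤˣ) (ψ : 𝓢(Minkowski d, ℂ)) (s : ℝ) : ℂ :=
  ∫ p : Minkowski d, cexp (negIUnit σ * s * minkowskiSq p) * ψ p

/-- The constant `(-iσ)^{d/2-1} / (4π)^{d/2}`. -/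
def gaussianPhase (d : ℕ) (σ : ℤˣ) : ℂ :=
  negIUnit σ ^ ((d : ℂ) / 2 - 1) / (((4 * Real.pi) ^ ((d : ℝ) / 2) : ℝ) : ℂ)

/-- The derivative of `minkowskiEvolution σ (minkowskiTransform d φ)`. -/
def minkowskiEvolutionDeriv (σ : ℤˣ) (φ : 𝓢(Minkowski d, ℂ)) (s : ℝ) : ℂ :=
  gaussianPhase d σ *
    (((-((d : ℝ) / 2) * s ^ (-((d : ℝ) / 2) - 1) : ℝ) : ℂ) * oscillatoryIntegral σ φ s⁻¹ +
      ((s ^ (-((d : ℝ) / 2)) * (s ^ 2)⁻¹ : ℝ) : ℂ) *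
        (negIUnit σ / 4 * oscillatoryIntegral σ (mulMinkowskiSq d φ) s⁻¹))

/-- The position-space form displays the decay s^{-d/2} at infinity; boundedness near s = 0 is seen
only in the momentum-space form. -/
theorem minkowskiEvolution_minkowskiTransform (hd : 2 ≤ d) (σ : ℤˣ) (φ : 𝓢(Minkowski d, ℂ))
    {s : ℝ} (hs : 0 < s) :
    minkowskiEvolution σ (minkowskiTransform d φ) s =
      gaussianPhase d σ * (((s ^ (-((d : ℝ) / 2)) : ℝ) : ℂ) * oscillatoryIntegral σ φ s⁻¹) := by
  rw [minkowskiEvolution, integral_cexp_minkowskiSq_mul_minkowskiTransform hd σ hs, mul_assoc]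
  simp only [gaussianPhase, oscillatoryIntegral, Complex.ofReal_inv, div_eq_mul_inv]

theorem norm_cexp_evolution (σ : ℤˣ) (s : ℝ) (p : Minkowski d) :
    ‖cexp (negIUnit σ * s * minkowskiSq p)‖ = 1 := by
  rw [mul_assoc, ← Complex.ofReal_mul, norm_cexp_negIUnit_mul_ofReal]

theorem norm_minkowskiEvolution_le (σ : ℤˣ) (ψ : 𝓢(Minkowski d, ℂ)) (s : ℝ) :
    ‖minkowskiEvolution σ ψ s‖ ≤ ∫ p, ‖ψ p‖ := by
  refine norm_integral_le_of_norm_le ψ.integrable.norm (Eventually.of_forall fun p => ?_)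
  rw [norm_mul, norm_cexp_evolution, one_mul]

theorem hasDerivAt_minkowskiEvolution (hd : 2 ≤ d) (σ : ℤˣ) (φ : 𝓢(Minkowski d, ℂ)) {s : ℝ}
    (hs : 0 < s) :
    HasDerivAt (minkowskiEvolution σ (minkowskiTransform d φ))
      (minkowskiEvolutionDeriv σ φ s) s := by
  have h1 := (Real.hasDerivAt_rpow_const (x := s) (p := -((d : ℝ) / 2)) (Or.inl hs.ne')).ofReal_comp
  have h2 := (hasDerivAt_oscillatoryIntegral σ φ s⁻¹).scomp s (hasDerivAt_inv hs.ne')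
  have h3 := (h1.mul h2).const_mul (gaussianPhase d σ)
  have h4 := h3.congr_of_eventuallyEq
    (f₁ := minkowskiEvolution σ (minkowskiTransform d φ)) (by
      filter_upwards [lt_mem_nhds hs] with t ht
      rw [minkowskiEvolution_minkowskiTransform hd σ φ ht]
      rfl)
  refine h4.congr_deriv ?_
  rw [minkowskiEvolutionDeriv]
  simp only [Complex.real_smul, Function.comp_apply]
  push_cast
  ring

/-- Differentiating s^{-d/2} gives s^{-d/2-1} ≤ s^{-2}, which is where d ≥ 2 enters; differentiating
the phase x²/(4s) gives s^{-2} and a factor x² that φ absorbs. -/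
theorem norm_minkowskiEvolutionDeriv_le (hd : 2 ≤ d) (σ : ℤˣ) (φ : 𝓢(Minkowski d, ℂ)) {s : ℝ}
    (hs : 1 ≤ s) :
    ‖minkowskiEvolutionDeriv σ φ s‖ ≤
      ‖gaussianPhase d σ‖ * (d / 2 * (∫ x, ‖φ x‖) + ∫ x, ‖mulMinkowskiSq d φ x‖) / s ^ 2 := by
  have hs0 : 0 < s := by linarith
  have hd' : (2 : ℝ) ≤ d := by exact_mod_cast hd
  have r1 : s ^ (-((d : ℝ) / 2) - 1) ≤ (s ^ 2)⁻¹ := by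
    rw [← Real.rpow_two, ← Real.rpow_neg hs0.le]
    exact Real.rpow_le_rpow_of_exponent_le hs (by linarith)
  have r2 : s ^ (-((d : ℝ) / 2)) ≤ 1 := Real.rpow_le_one_of_one_le_of_nonpos hs (by linarith)
  rw [minkowskiEvolutionDeriv, norm_mul, mul_div_assoc]
  gcongr
  refine (norm_add_le _ _).trans ?_
  have i1 : ‖((-((d : ℝ) / 2) * s ^ (-((d : ℝ) / 2) - 1) : ℝ) : ℂ)‖ ≤ d / 2 * (s ^ 2)⁻¹ := by
    rw [Complex.norm_real, norm_mul, norm_neg, Real.norm_of_nonneg (by positivity),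
      Real.norm_of_nonneg (by positivity)]
    gcongr
  have i2 : ‖((s ^ (-((d : ℝ) / 2)) * (s ^ 2)⁻¹ : ℝ) : ℂ)‖ ≤ 1 * (s ^ 2)⁻¹ := by
    rw [Complex.norm_real, Real.norm_of_nonneg (by positivity)]
    gcongr
  have i3 : ‖negIUnit σ / 4 * oscillatoryIntegral σ (mulMinkowskiSq d φ) s⁻¹‖ ≤
      ∫ x, ‖mulMinkowskiSq d φ x‖ := by
    rw [norm_mul, norm_div, norm_negIUnit]
    refine le_trans (mul_le_of_le_one_left (norm_nonneg _) (by norm_num))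
      (norm_oscillatoryIntegral_le σ _ _)
  rw [norm_mul, norm_mul (((s ^ (-((d : ℝ) / 2)) * (s ^ 2)⁻¹ : ℝ) : ℂ))]
  calc _ ≤ d / 2 * (s ^ 2)⁻¹ * (∫ x, ‖φ x‖) + 1 * (s ^ 2)⁻¹ * ∫ x, ‖mulMinkowskiSq d φ x‖ := by
        gcongr
        exact norm_oscillatoryIntegral_le σ φ _
    _ = _ := by ring

/-- The common value of the momentum and position space limits. -/
def propagatorValue (σ : ℤˣ) (m : ℝ) (φ : 𝓢(Minkowski d, ℂ)) : ℂ :=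
  -negIUnit σ * abelIntegral (minkowskiEvolution σ (minkowskiTransform d φ))
    (minkowskiEvolutionDeriv σ φ) (negIUnit σ * (m : ℂ) ^ 2) 0

theorem re_add_negIUnit_mul_sq (σ : ℤˣ) (m δ : ℝ) : (δ + negIUnit σ * (m : ℂ) ^ 2).re = δ := by
  rw [← Complex.ofReal_pow, Complex.add_re, Complex.re_mul_ofReal, negIUnit_re]; simp

theorem im_add_negIUnit_mul_sq (σ : ℤˣ) (m δ : ℝ) :
    (δ + negIUnit σ * (m : ℂ) ^ 2).im = (negIUnit σ).im * m ^ 2 := by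
  rw [← Complex.ofReal_pow, Complex.add_im, Complex.im_mul_ofReal]; simp

theorem add_negIUnit_mul_sq_ne_zero (σ : ℤˣ) {m : ℝ} (hm : 0 < m) (δ : ℝ) :
    (δ + negIUnit σ * (m : ℂ) ^ 2) ≠ 0 := fun h => by
  have h1 := im_add_negIUnit_mul_sq σ m δ
  have h2 : (negIUnit σ).im ≠ 0 := fun h => by have := negIUnit_im_sq σ; simp [h] at this
  rw [h] at h1
  simp [h2, hm.ne'] at h1

theorem sub_eq_negIUnit_mul (σ : ℤˣ) (A ε : ℂ) :
    A - ((σ : ℤ) : ℂ) * I * ε = negIUnit σ * (ε - negIUnit σ * A) := by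
  have h : ((σ : ℤ) : ℂ) * I = -negIUnit σ := by rw [negIUnit]; ring
  rw [h]
  linear_combination A * negIUnit_sq σ

/-- With A = p² - m² one has A - iσε = c(ε - cA), where the bracket has real part ε, and c⁻¹ = -c.
The trivial factor e^{-0/s} matches the shape of `abelIntegral` at η = 0. -/
theorem integral_resolvent_mul (σ : ℤˣ) (m : ℝ) {ε : ℝ} (hε : 0 < ε) (ψ : 𝓢(Minkowski d, ℂ)) :
    Integrable (fun p => 1 / (-(m : ℂ) ^ 2 + minkowskiSq p - ((σ : ℤ) : ℂ) * I * ε) * ψ p) ∧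
    ∫ p, 1 / (-(m : ℂ) ^ 2 + minkowskiSq p - ((σ : ℤ) : ℂ) * I * ε) * ψ p =
      -negIUnit σ * ∫ s in Set.Ioi (0 : ℝ), cexp (-((ε + negIUnit σ * (m : ℂ) ^ 2) * s)) *
        Real.exp (-(0 / s)) * minkowskiEvolution σ ψ s := by
  have hq := continuous_minkowskiSq (d := d)
  have hψ := ψ.continuous
  have hre : ∀ p : Minkowski d,
      ((ε : ℂ) - negIUnit σ * (-(m : ℂ) ^ 2 + minkowskiSq p)).re = ε := by
    intro p
    have : (-(m : ℂ) ^ 2 + minkowskiSq p) = ((-m ^ 2 + minkowskiSq p : ℝ) : ℂ) := by push_cast; rfl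
    rw [this, Complex.sub_re, Complex.re_mul_ofReal, negIUnit_re]; simp
  have hne : ∀ p : Minkowski d, (ε : ℂ) - negIUnit σ * (-(m : ℂ) ^ 2 + minkowskiSq p) ≠ 0 :=
    fun p h => by have := hre p; rw [h] at this; simp at this; exact hε.ne this
  have hc0 := negIUnit_ne_zero σ
  set F : ℝ → Minkowski d → ℂ := fun s p =>
    cexp (-(((ε : ℂ) - negIUnit σ * (-(m : ℂ) ^ 2 + minkowskiSq p)) * s)) * ψ p with hF
  have hFn : ∀ s p, ‖F s p‖ = Real.exp (-ε * s) * ‖ψ p‖ := by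
    intro s p
    simp only [hF]
    rw [norm_mul, Complex.norm_exp, Complex.neg_re, Complex.re_mul_ofReal, hre, neg_mul]
  have hint : Integrable (Function.uncurry F) ((volume.restrict (Set.Ioi 0)).prod volume) := by
    have h1 := (integrableOn_exp_mul_Ioi (a := -ε) (by linarith) 0)
    refine Integrable.mono' (Integrable.mul_prod h1 ψ.integrable.norm) ?_
      (Eventually.of_forall fun z => ?_)
    · refine Continuous.aestronglyMeasurable ?_
      simp only [hF, Function.uncurry_def]
      fun_prop
    · simp only [Function.uncurry_def]
      rw [hFn]
  have inner : ∀ p : Minkowski d, ∫ s in Set.Ioi (0 : ℝ), F s p =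
      (1 / ((ε : ℂ) - negIUnit σ * (-(m : ℂ) ^ 2 + minkowskiSq p))) * ψ p := by
    intro p
    simp only [hF]
    have := integral_pow_mul_cexp_neg 0
      (r := (ε : ℂ) - negIUnit σ * (-(m : ℂ) ^ 2 + minkowskiSq p)) (by rw [hre]; exact hε)
    simp only [pow_zero, one_mul, Nat.factorial_zero, Nat.cast_one, zero_add, pow_one] at this
    rw [integral_mul_const, this]
  have e : ∀ p : Minkowski d,
      1 / (-(m : ℂ) ^ 2 + minkowskiSq p - ((σ : ℤ) : ℂ) * I * ε) * ψ p =
      -negIUnit σ * ∫ s in Set.Ioi (0 : ℝ), F s p := by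
    intro p
    rw [inner, sub_eq_negIUnit_mul, ← mul_assoc]
    congr 1
    have := hne p
    field_simp
    linear_combination negIUnit_sq σ
  have hR := hint.integral_prod_right
  refine ⟨?_, ?_⟩
  · simp_rw [e]
    exact hR.const_mul _
  · simp_rw [e]
    rw [integral_const_mul, ← integral_integral_swap hint]
    congr 1
    refine setIntegral_congr_fun measurableSet_Ioi fun s _ => ?_
    simp only [hF, minkowskiEvolution]
    rw [zero_div, neg_zero, Real.exp_zero, Complex.ofReal_one, mul_one, ← integral_const_mul]
    refine integral_congr_ae (Eventually.of_forall fun p => ?_)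
    simp only
    rw [← mul_assoc, ← Complex.exp_add]
    congr 2
    ring

theorem integral_evolution_eq_abelIntegral (hd : 2 ≤ d) (σ : ℤˣ) (φ : 𝓢(Minkowski d, ℂ))
    {a : ℂ} (ha : 0 < a.re) {η : ℝ} (hη : 0 ≤ η) :
    ∫ s in Set.Ioi (0 : ℝ), cexp (-(a * s)) * Real.exp (-(η / s)) *
        minkowskiEvolution σ (minkowskiTransform d φ) s =
      abelIntegral (minkowskiEvolution σ (minkowskiTransform d φ)) (minkowskiEvolutionDeriv σ φ)
        a η :=
  integral_eq_abelIntegral (fun _ hs => hasDerivAt_minkowskiEvolution hd σ φ hs)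
    (fun s _ => norm_minkowskiEvolution_le σ _ s)
    (fun _ hs => norm_minkowskiEvolutionDeriv_le hd σ φ hs) ha hη

theorem continuousOn_abelIntegral_evolution (hd : 2 ≤ d) (σ : ℤˣ) (φ : 𝓢(Minkowski d, ℂ))
    (K : ℝ) :
    ContinuousOn (fun p : ℂ × ℝ => abelIntegral (minkowskiEvolution σ (minkowskiTransform d φ))
      (minkowskiEvolutionDeriv σ φ) p.1 p.2) {p | (0 ≤ p.1.re ∧ p.1 ≠ 0) ∧ 0 ≤ p.2 ∧ p.2 ≤ K} :=
  continuousOn_abelIntegral (fun _ hs => hasDerivAt_minkowskiEvolution hd σ φ hs)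
    (fun s _ => norm_minkowskiEvolution_le σ _ s)
    (fun _ hs => norm_minkowskiEvolutionDeriv_le hd σ φ hs) K

theorem tendsto_abelIntegral_mass (hd : 2 ≤ d) (σ : ℤˣ) {m : ℝ} (hm : 0 < m)
    (φ : 𝓢(Minkowski d, ℂ)) {η : ℝ} (hη : 0 ≤ η) :
    Tendsto (fun δ : ℝ => abelIntegral (minkowskiEvolution σ (minkowskiTransform d φ))
      (minkowskiEvolutionDeriv σ φ) (δ + negIUnit σ * (m : ℂ) ^ 2) η) (𝓝[>] 0)
      (𝓝 (abelIntegral (minkowskiEvolution σ (minkowskiTransform d φ))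
        (minkowskiEvolutionDeriv σ φ) (negIUnit σ * (m : ℂ) ^ 2) η)) := by
  have h : ContinuousOn (fun δ : ℝ => abelIntegral (minkowskiEvolution σ (minkowskiTransform d φ))
      (minkowskiEvolutionDeriv σ φ) (δ + negIUnit σ * (m : ℂ) ^ 2) η) (Set.Ici 0) :=
    (continuousOn_abelIntegral_evolution hd σ φ η).comp
      (f := fun δ : ℝ => ((δ + negIUnit σ * (m : ℂ) ^ 2 : ℂ), η))
      (Continuous.continuousOn (by fun_prop)) fun δ hδ =>
        ⟨⟨by rw [re_add_negIUnit_mul_sq]; exact hδ, add_negIUnit_mul_sq_ne_zero σ hm δ⟩, hη, le_rfl⟩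
  have := (h 0 Set.self_mem_Ici).mono_left (nhdsWithin_mono _ Set.Ioi_subset_Ici_self)
  simpa using this

theorem tendsto_abelIntegral_regularization (hd : 2 ≤ d) (σ : ℤˣ) {m : ℝ} (hm : 0 < m)
    (φ : 𝓢(Minkowski d, ℂ)) :
    Tendsto (fun η : ℝ => abelIntegral (minkowskiEvolution σ (minkowskiTransform d φ))
      (minkowskiEvolutionDeriv σ φ) (negIUnit σ * (m : ℂ) ^ 2) η) (𝓝[>] 0)
      (𝓝 (abelIntegral (minkowskiEvolution σ (minkowskiTransform d φ))
        (minkowskiEvolutionDeriv σ φ) (negIUnit σ * (m : ℂ) ^ 2) 0)) := by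
  have hre := re_add_negIUnit_mul_sq σ m 0
  have hne := add_negIUnit_mul_sq_ne_zero σ hm 0
  rw [Complex.ofReal_zero, zero_add] at hre hne
  have h : ContinuousOn (fun η : ℝ => abelIntegral (minkowskiEvolution σ (minkowskiTransform d φ))
      (minkowskiEvolutionDeriv σ φ) (negIUnit σ * (m : ℂ) ^ 2) η) (Set.Icc 0 1) :=
    (continuousOn_abelIntegral_evolution hd σ φ 1).comp
      (f := fun η : ℝ => ((negIUnit σ * (m : ℂ) ^ 2 : ℂ), η))
      (Continuous.continuousOn (by fun_prop)) fun η hη => ⟨⟨hre.ge, hne⟩, hη.1, hη.2⟩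
  have h0 := h 0 ⟨le_rfl, zero_le_one⟩
  refine h0.mono_left ?_
  rw [← nhdsWithin_Ioc_eq_nhdsGT (zero_lt_one (α := ℝ))]
  exact nhdsWithin_mono _ Set.Ioc_subset_Icc_self

theorem tendsto_integral_resolvent (hd : 2 ≤ d) (σ : ℤˣ) {m : ℝ} (hm : 0 < m)
    (φ : 𝓢(Minkowski d, ℂ)) :
    Tendsto (fun ε : ℝ => ∫ p, 1 / (-(m : ℂ) ^ 2 + minkowskiSq p - ((σ : ℤ) : ℂ) * I * ε) *
      minkowskiTransform d φ p) (𝓝[>] 0) (𝓝 (propagatorValue σ m φ)) := by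
  refine ((tendsto_abelIntegral_mass hd σ hm φ le_rfl).const_mul (-negIUnit σ)).congr' ?_
  filter_upwards [self_mem_nhdsWithin] with ε hε
  rw [(integral_resolvent_mul σ m hε _).2, integral_evolution_eq_abelIntegral hd σ φ
    (by rw [re_add_negIUnit_mul_sq]; exact hε) le_rfl]

end


/-! ### The position-space limit. -/

/-- The order `d/2 - 1` of the Bessel function in the propagators. -/
def besselOrder (d : ℕ) : ℝ := (d : ℝ) / 2 - 1

theorem ofReal_besselOrder (d : ℕ) : ((besselOrder d : ℝ) : ℂ) = (d : ℂ) / 2 - 1 := by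
  rw [besselOrder]; push_cast; rfl

theorem besselOrder_nonneg {d : ℕ} (hd : 2 ≤ d) : 0 ≤ besselOrder d := by
  have : (2 : ℝ) ≤ d := by exact_mod_cast hd
  rw [besselOrder]; linarith

/-- The singularity s^{-d/2} at 0 is tamed by e^{-η/s} ≤ d! s^d / η^d. -/
theorem integrableOn_exp_neg_mul_exp_neg_div_mul_rpow (d : ℕ) {r η : ℝ} (hr : 0 < r) (hη : 0 < η) :
    IntegrableOn (fun s : ℝ => Real.exp (-(r * s)) * Real.exp (-(η / s)) *
      s ^ (-besselOrder d - 1)) (Set.Ioi 0) := by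
  have hs : (-1 : ℝ) < (d : ℝ) / 2 := by have : (0 : ℝ) ≤ d := Nat.cast_nonneg d; linarith
  have h := (integrableOn_rpow_mul_exp_neg_mul_rpow hs zero_lt_one hr).const_mul
    ((d.factorial : ℝ) / η ^ d)
  refine Integrable.mono' h ?_ ?_
  · refine ContinuousOn.aestronglyMeasurable ?_ measurableSet_Ioi
    have h0 : ∀ s ∈ Set.Ioi (0 : ℝ), s ≠ 0 := fun s hs => (Set.mem_Ioi.1 hs).ne'
    refine (ContinuousOn.mul (Continuous.continuousOn (by fun_prop)) ?_).mul
      (continuousOn_id.rpow_const fun s hs => Or.inl (h0 s hs))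
    exact Real.continuous_exp.comp_continuousOn ((continuousOn_const.div continuousOn_id h0).neg)
  · refine (ae_restrict_mem measurableSet_Ioi).mono fun s hs => ?_
    have hs0 : 0 < s := hs
    rw [Real.norm_of_nonneg (by positivity), Real.rpow_one, neg_mul]
    have e1 : Real.exp (-(η / s)) ≤ d.factorial / η ^ d * s ^ d := by
      have := Real.pow_div_factorial_le_exp (η / s) (by positivity) d
      rw [Real.exp_neg]
      refine (inv_anti₀ (by positivity) this).trans_eq ?_
      rw [div_pow]
      field_simp
    have e2 : s ^ ((d : ℝ) / 2) = s ^ d * s ^ (-besselOrder d - 1) := by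
      rw [← Real.rpow_natCast, ← Real.rpow_add hs0, besselOrder]
      congr 1; ring
    calc _ ≤ Real.exp (-(r * s)) * (d.factorial / η ^ d * s ^ d) * s ^ (-besselOrder d - 1) := by
          gcongr
      _ = _ := by rw [e2]; ring

/-- The normalization constant `√π m^{d-2} (-iσ)^{d+1} / (4π)^{d/2}` of the propagators. -/
def propagatorConst (d : ℕ) (σ : ℤˣ) (m : ℝ) : ℂ :=
  (√Real.pi : ℂ) * (m : ℂ) ^ (d - 2) * (-((σ : ℤ) : ℂ) * I) ^ (d + 1) /
    (((4 * Real.pi) ^ ((d : ℝ) / 2) : ℝ) : ℂ)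

theorem negIUnit_pow_add_one {d : ℕ} (hd : 2 ≤ d) (σ : ℤˣ) :
    negIUnit σ ^ (d + 1) = -(negIUnit σ * negIUnit σ ^ (d - 2)) := by
  obtain ⟨k, rfl⟩ := Nat.exists_eq_add_of_le hd
  rw [Nat.add_sub_cancel_left]
  linear_combination negIUnit σ * negIUnit σ ^ k * negIUnit_sq σ

/-- The Gaussian phase and a^α at a = c m² each contribute c^{d/2-1}; with the prefactor -c = c³
this makes c^{d+1}. -/
theorem propagatorConst_eq {d : ℕ} (hd : 2 ≤ d) (σ : ℤˣ) {m : ℝ} (hm : 0 < m) :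
    propagatorConst d σ m = -negIUnit σ * (gaussianPhase d σ *
      ((√Real.pi : ℂ) * (negIUnit σ * (m : ℂ) ^ 2) ^ (besselOrder d : ℂ))) := by
  have hm2 : (0 : ℝ) < (((m ^ 2 : ℝ)) : ℂ).re := by rw [Complex.ofReal_re]; positivity
  have h1 : ((m ^ 2 : ℝ) : ℂ) ^ (besselOrder d : ℂ) = (m : ℂ) ^ (d - 2) := by
    rw [← Complex.ofReal_cpow (by positivity), ← Complex.ofReal_pow, ← Real.rpow_natCast,
      ← Real.rpow_mul hm.le, ← Real.rpow_natCast m (d - 2), besselOrder, Nat.cast_sub hd]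
    congr 2
    push_cast; ring
  have h2 : negIUnit σ ^ ((d : ℂ) / 2 - 1) * negIUnit σ ^ ((d : ℂ) / 2 - 1) =
      negIUnit σ ^ (d - 2) := by
    rw [← Complex.cpow_add _ _ (negIUnit_ne_zero σ), ← Complex.cpow_natCast, Nat.cast_sub hd]
    congr 1
    push_cast; ring
  rw [← Complex.ofReal_pow, negIUnit_mul_cpow σ hm2, h1, gaussianPhase, ofReal_besselOrder,
    propagatorConst]
  change (√Real.pi : ℂ) * (m : ℂ) ^ (d - 2) * negIUnit σ ^ (d + 1) / _ = _
  rw [negIUnit_pow_add_one hd, ← h2]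
  ring

section

variable {d : ℕ} [NeZero d]

theorem re_regularizedSq (σ : ℤˣ) (η : ℝ) (x : Minkowski d) :
    ((η : ℂ) + negIUnit σ * minkowskiSq x / 4).re = η := by
  have : negIUnit σ * minkowskiSq x / 4 = negIUnit σ * ((minkowskiSq x / 4 : ℝ) : ℂ) := by
    push_cast; ring
  rw [this, Complex.add_re, Complex.re_mul_ofReal, negIUnit_re]; simp

/-- Fubini is legitimate because Re a > 0 controls s → ∞ and η > 0 controls s → 0. The s-integral at
fixed x is then the two-parameter formula with b = η + c x²/4. -/
theorem integral_evolution_eq_integral_besselU (hd : 2 ≤ d) (σ : ℤˣ) (φ : 𝓢(Minkowski d, ℂ)) {a : ℂ}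
    (ha : 0 < a.re) {η : ℝ} (hη : 0 < η) :
    ∫ s in Set.Ioi (0 : ℝ), cexp (-(a * s)) * Real.exp (-(η / s)) *
        minkowskiEvolution σ (minkowskiTransform d φ) s =
      gaussianPhase d σ * ((√Real.pi : ℂ) * a ^ (besselOrder d : ℂ) *
        ∫ x : Minkowski d,
          besselU (besselOrder d) (a * (η + negIUnit σ * minkowskiSq x / 4)) * φ x) := by
  have hq := continuous_minkowskiSq (d := d)
  have hφ := φ.continuous
  set F : ℝ → Minkowski d → ℂ := fun s x =>
    cexp (-(a * s) - (η + negIUnit σ * minkowskiSq x / 4) / s) *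
      ((s ^ (-besselOrder d - 1) : ℝ) : ℂ) * φ x with hF
  have hFn : ∀ s : ℝ, 0 < s → ∀ x, ‖F s x‖ =
      Real.exp (-(a.re * s)) * Real.exp (-(η / s)) * s ^ (-besselOrder d - 1) * ‖φ x‖ := by
    intro s hs x
    simp only [hF]
    rw [norm_mul, norm_mul, Complex.norm_exp, Complex.sub_re, Complex.neg_re,
      Complex.re_mul_ofReal, Complex.div_ofReal_re, re_regularizedSq, Complex.norm_real,
      Real.norm_of_nonneg (by positivity), sub_eq_add_neg, Real.exp_add]
  have hint : Integrable (Function.uncurry F) ((volume.restrict (Set.Ioi 0)).prod volume) := by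
    refine Integrable.mono' (Integrable.mul_prod
      (integrableOn_exp_neg_mul_exp_neg_div_mul_rpow d ha hη) φ.integrable.norm) ?_ ?_
    · have : (volume.restrict (Set.Ioi (0 : ℝ))).prod (volume : Measure (Minkowski d)) =
          (volume.prod volume).restrict (Set.Ioi 0 ×ˢ Set.univ) := by
        rw [← Measure.prod_restrict, Measure.restrict_univ]
      rw [this]
      refine ContinuousOn.aestronglyMeasurable ?_ (measurableSet_Ioi.prod MeasurableSet.univ)
      have h0 : ∀ z ∈ Set.Ioi (0 : ℝ) ×ˢ (Set.univ : Set (Minkowski d)), z.1 ≠ 0 :=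
        fun z hz => (Set.mem_Ioi.1 hz.1).ne'
      have h0' : ∀ z ∈ Set.Ioi (0 : ℝ) ×ˢ (Set.univ : Set (Minkowski d)), (z.1 : ℂ) ≠ 0 :=
        fun z hz => Complex.ofReal_ne_zero.2 (h0 z hz)
      simp only [hF, Function.uncurry_def]
      refine (ContinuousOn.mul ?_ ?_).mul (Continuous.continuousOn (by fun_prop))
      · refine Complex.continuous_exp.comp_continuousOn
          ((Continuous.continuousOn (by fun_prop)).sub ?_)
        exact ContinuousOn.div (Continuous.continuousOn (by fun_prop))
          (Continuous.continuousOn (by fun_prop)) h0'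
      · exact Complex.continuous_ofReal.comp_continuousOn
          (continuousOn_fst.rpow_const fun z hz => Or.inl (h0 z hz))
    · have : ∀ᵐ z ∂((volume.restrict (Set.Ioi (0 : ℝ))).prod (volume : Measure (Minkowski d))),
          z ∈ Set.Ioi (0 : ℝ) ×ˢ (Set.univ : Set (Minkowski d)) := by
        rw [← Measure.restrict_univ (μ := (volume : Measure (Minkowski d))), Measure.prod_restrict]
        exact ae_restrict_mem (measurableSet_Ioi.prod MeasurableSet.univ)
      filter_upwards [this] with z hz
      exact (hFn z.1 hz.1 z.2).le
  have inner : ∀ x : Minkowski d, ∫ s in Set.Ioi (0 : ℝ), F s x =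
      (√Real.pi : ℂ) * a ^ (besselOrder d : ℂ) *
        (besselU (besselOrder d) (a * (η + negIUnit σ * minkowskiSq x / 4)) * φ x) := by
    intro x
    simp only [hF]
    rw [integral_mul_const, integral_exp_neg_mul_sub_div_eq_besselU _ ha
      (by rw [re_regularizedSq]; exact hη)]
    ring
  have key := integral_integral_swap hint
  simp_rw [inner] at key
  rw [integral_const_mul] at key
  rw [← key, ← integral_const_mul]
  refine setIntegral_congr_fun measurableSet_Ioi fun s hs => ?_
  have hs0 : 0 < s := hs
  have hexp : (-((d : ℝ) / 2)) = -besselOrder d - 1 := by rw [besselOrder]; ring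
  simp only [hF]
  rw [minkowskiEvolution_minkowskiTransform hd σ φ hs0, oscillatoryIntegral, hexp, mul_left_comm]
  congr 1
  rw [← mul_assoc, ← integral_const_mul]
  refine integral_congr_ae (Eventually.of_forall fun x => ?_)
  have e : cexp (-(a * s) - (η + negIUnit σ * minkowskiSq x / 4) / s) =
      cexp (-(a * s)) * Real.exp (-(η / s)) *
        cexp (-(negIUnit σ * minkowskiSq x / 4 * (s⁻¹ : ℝ))) := by
    rw [Complex.ofReal_exp, ← Complex.exp_add, ← Complex.exp_add]
    congr 1
    push_cast
    ring
  simp only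
  rw [e]
  ring

theorem negIUnit_im_ne_zero (σ : ℤˣ) : (negIUnit σ).im ≠ 0 := fun h => by
  have := negIUnit_im_sq σ; simp [h] at this

/-- For δ > 0 both factors lie in the open right half-plane; for δ = 0 the first is imaginary, but η
then gives the product a nonzero imaginary part. -/
theorem mul_regularizedSq_mem_slitPlane (σ : ℤˣ) {m δ η : ℝ} (hm : 0 < m) (hδ : 0 ≤ δ) (hη : 0 < η)
    (x : Minkowski d) :
    (δ + negIUnit σ * (m : ℂ) ^ 2) * (η + negIUnit σ * minkowskiSq x / 4) ∈ slitPlane := by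
  rcases hδ.eq_or_lt with rfl | hδ
  · refine mem_slitPlane_iff.2 (Or.inr ?_)
    have e : ((0 : ℝ) + negIUnit σ * (m : ℂ) ^ 2) * (η + negIUnit σ * minkowskiSq x / 4) =
        negIUnit σ * ((m ^ 2 * η : ℝ) : ℂ) - ((m ^ 2 * minkowskiSq x / 4 : ℝ) : ℂ) := by
      push_cast
      linear_combination (m : ℂ) ^ 2 * minkowskiSq x / 4 * negIUnit_sq σ
    rw [e, Complex.sub_im, Complex.ofReal_im, Complex.im_mul_ofReal, sub_zero]
    exact mul_ne_zero (negIUnit_im_ne_zero σ) (by positivity)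
  · have ha : 0 < (δ + negIUnit σ * (m : ℂ) ^ 2).re := by rw [re_add_negIUnit_mul_sq]; exact hδ
    have hb : 0 < ((η : ℂ) + negIUnit σ * minkowskiSq x / 4).re := by
      rw [re_regularizedSq]; exact hη
    have ha0 : (δ + negIUnit σ * (m : ℂ) ^ 2) ≠ 0 := fun h => by rw [h] at ha; simp at ha
    have hb0 : ((η : ℂ) + negIUnit σ * minkowskiSq x / 4) ≠ 0 := fun h => by
      rw [h] at hb; simp at hb
    refine mem_slitPlane_iff_arg.2 ⟨fun h => ?_, mul_ne_zero ha0 hb0⟩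
    have h1 := abs_arg_add_lt_pi ha hb
    have h2 := congrArg Complex.im (log_mul_of_re_pos ha hb)
    rw [Complex.add_im, Complex.log_im, Complex.log_im, Complex.log_im] at h2
    rw [← h2, h, abs_of_pos Real.pi_pos] at h1
    exact lt_irrefl _ h1

/-- The argument of U_α stays away from 0 uniformly in x and δ, so one constant bounds U_α
throughout and a multiple of |φ| dominates. -/
theorem le_norm_mul_regularizedSq (σ : ℤˣ) {m δ η : ℝ} (hη : 0 < η) (x : Minkowski d) :
    m ^ 2 * η ≤ ‖(δ + negIUnit σ * (m : ℂ) ^ 2) * (η + negIUnit σ * minkowskiSq x / 4)‖ := by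
  rw [norm_mul]
  have h1 := Complex.abs_im_le_norm (δ + negIUnit σ * (m : ℂ) ^ 2)
  have h2 := Complex.re_le_norm ((η : ℂ) + negIUnit σ * minkowskiSq x / 4)
  have h3 : |(negIUnit σ).im| = 1 := by
    rw [← Real.sqrt_sq_eq_abs, negIUnit_im_sq, Real.sqrt_one]
  rw [im_add_negIUnit_mul_sq, abs_mul, h3, one_mul, abs_of_nonneg (sq_nonneg m)] at h1
  rw [re_regularizedSq] at h2
  gcongr

theorem continuous_besselU_regularizedSq (σ : ℤˣ) {m δ η : ℝ} (hm : 0 < m) (hδ : 0 ≤ δ)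
    (hη : 0 < η) :
    Continuous fun x : Minkowski d => besselU (besselOrder d)
      ((δ + negIUnit σ * (m : ℂ) ^ 2) * (η + negIUnit σ * minkowskiSq x / 4)) := by
  have hq := continuous_minkowskiSq (d := d)
  exact (continuousOn_besselU (besselOrder d)).comp_continuous (by fun_prop)
    fun x => mul_regularizedSq_mem_slitPlane σ hm hδ hη x

theorem integrable_besselU_regularizedSq_mul (hd : 2 ≤ d) (σ : ℤˣ) {m η : ℝ} (hm : 0 < m)
    (hη : 0 < η) (φ : 𝓢(Minkowski d, ℂ)) :
    Integrable fun x : Minkowski d => besselU (besselOrder d)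
      ((negIUnit σ * (m : ℂ) ^ 2) * (η + negIUnit σ * minkowskiSq x / 4)) * φ x := by
  obtain ⟨C, hC⟩ := exists_norm_besselU_le (besselOrder_nonneg hd)
    (show 0 < m ^ 2 * η by positivity)
  have hc := continuous_besselU_regularizedSq (d := d) σ hm le_rfl hη
  have hb := fun x : Minkowski d => hC _ (mul_regularizedSq_mem_slitPlane σ hm le_rfl hη x)
    (le_norm_mul_regularizedSq σ hη x)
  simp only [Complex.ofReal_zero, zero_add] at hc hb
  exact φ.integrable.bdd_mul hc.aestronglyMeasurable (Eventually.of_forall hb)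

/-- Both sides are limits, as δ ↘ 0 with η fixed, of the identity at a = δ + c m², where Re a > 0.
-/
theorem integral_besselU_eq_abelIntegral (hd : 2 ≤ d) (σ : ℤˣ) {m η : ℝ} (hm : 0 < m)
    (hη : 0 < η) (φ : 𝓢(Minkowski d, ℂ)) :
    gaussianPhase d σ * ((√Real.pi : ℂ) * (negIUnit σ * (m : ℂ) ^ 2) ^ (besselOrder d : ℂ) *
      ∫ x : Minkowski d, besselU (besselOrder d)
        ((negIUnit σ * (m : ℂ) ^ 2) * (η + negIUnit σ * minkowskiSq x / 4)) * φ x) =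
      abelIntegral (minkowskiEvolution σ (minkowskiTransform d φ)) (minkowskiEvolutionDeriv σ φ)
        (negIUnit σ * (m : ℂ) ^ 2) η := by
  obtain ⟨C, hC⟩ := exists_norm_besselU_le (besselOrder_nonneg hd)
    (show 0 < m ^ 2 * η by positivity)
  have hφ := φ.continuous
  have hlin : Tendsto (fun δ : ℝ => (δ + negIUnit σ * (m : ℂ) ^ 2)) (𝓝[>] 0)
      (𝓝 (negIUnit σ * (m : ℂ) ^ 2)) := by
    have : Continuous fun δ : ℝ => (δ + negIUnit σ * (m : ℂ) ^ 2) := by fun_prop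
    simpa using (this.tendsto 0).mono_left nhdsWithin_le_nhds
  have hslit : negIUnit σ * (m : ℂ) ^ 2 ∈ slitPlane := by
    have h := im_add_negIUnit_mul_sq σ m 0
    rw [Complex.ofReal_zero, zero_add] at h
    refine mem_slitPlane_iff.2 (Or.inr ?_)
    rw [h]
    exact mul_ne_zero (negIUnit_im_ne_zero σ) (by positivity)
  have hlim : Tendsto (fun δ : ℝ => ∫ x : Minkowski d, besselU (besselOrder d)
        ((δ + negIUnit σ * (m : ℂ) ^ 2) * (η + negIUnit σ * minkowskiSq x / 4)) * φ x) (𝓝[>] 0)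
      (𝓝 (∫ x : Minkowski d, besselU (besselOrder d)
        ((negIUnit σ * (m : ℂ) ^ 2) * (η + negIUnit σ * minkowskiSq x / 4)) * φ x)) := by
    refine tendsto_integral_filter_of_dominated_convergence (fun x => C * ‖φ x‖) ?_ ?_
      (φ.integrable.norm.const_mul C) ?_
    · filter_upwards [self_mem_nhdsWithin] with δ hδ
      exact ((continuous_besselU_regularizedSq σ hm (le_of_lt hδ) hη).mul hφ).aestronglyMeasurable
    · filter_upwards [self_mem_nhdsWithin] with δ hδ
      refine Eventually.of_forall fun x => ?_
      rw [norm_mul]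
      gcongr
      exact hC _ (mul_regularizedSq_mem_slitPlane σ hm (le_of_lt hδ) hη x)
        (le_norm_mul_regularizedSq σ hη x)
    · refine Eventually.of_forall fun x => Tendsto.mul_const _ ?_
      have hs := mul_regularizedSq_mem_slitPlane σ hm le_rfl hη x
      rw [Complex.ofReal_zero, zero_add] at hs
      exact ((continuousOn_besselU (besselOrder d)).continuousAt
        (isOpen_slitPlane.mem_nhds hs)).tendsto.comp (hlin.mul_const _)
  have hpow := (continuousAt_cpow_const (b := (besselOrder d : ℂ)) hslit).tendsto.comp hlin
  have h1 := ((hpow.const_mul (√Real.pi : ℂ)).mul hlim).const_mul (gaussianPhase d σ)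
  refine tendsto_nhds_unique h1 ((tendsto_abelIntegral_mass hd σ hm φ hη.le).congr' ?_)
  filter_upwards [self_mem_nhdsWithin] with δ hδ
  have ha : 0 < (δ + negIUnit σ * (m : ℂ) ^ 2).re := by rw [re_add_negIUnit_mul_sq]; exact hδ
  rw [← integral_evolution_eq_abelIntegral hd σ φ ha hη.le,
    integral_evolution_eq_integral_besselU hd σ φ ha hη]
  rfl

theorem regularizedSq_eq (σ : ℤˣ) (m ε : ℝ) (x : Minkowski d) :
    (m : ℂ) ^ 2 * (-(minkowskiSq x : ℂ) - ((σ : ℤ) : ℂ) * I * ε) / 4 =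
      negIUnit σ * (m : ℂ) ^ 2 * ((ε / 4 : ℝ) + negIUnit σ * minkowskiSq x / 4) := by
  rw [sub_eq_negIUnit_mul]
  push_cast
  ring

theorem tendsto_integral_besselU (hd : 2 ≤ d) (σ : ℤˣ) {m : ℝ} (hm : 0 < m)
    (φ : 𝓢(Minkowski d, ℂ)) :
    (∀ ε : ℝ, 0 < ε → Integrable fun x : Minkowski d => propagatorConst d σ m *
      besselU (besselOrder d)
        ((m : ℂ) ^ 2 * (-(minkowskiSq x : ℂ) - ((σ : ℤ) : ℂ) * I * ε) / 4) * φ x) ∧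
    Tendsto (fun ε : ℝ => ∫ x : Minkowski d, propagatorConst d σ m * besselU (besselOrder d)
        ((m : ℂ) ^ 2 * (-(minkowskiSq x : ℂ) - ((σ : ℤ) : ℂ) * I * ε) / 4) * φ x)
      (𝓝[>] 0) (𝓝 (propagatorValue σ m φ)) := by
  simp only [regularizedSq_eq, mul_assoc (propagatorConst d σ m)]
  refine ⟨fun ε hε => (integrable_besselU_regularizedSq_mul hd σ hm (by positivity) φ).const_mul _,
    ?_⟩
  have hlim : Tendsto (fun ε : ℝ => ε / 4) (𝓝[>] 0) (𝓝[>] 0) := by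
    refine tendsto_nhdsWithin_iff.2 ⟨?_, ?_⟩
    · have : Continuous fun ε : ℝ => ε / 4 := by fun_prop
      simpa using (this.tendsto 0).mono_left nhdsWithin_le_nhds
    · filter_upwards [self_mem_nhdsWithin] with ε hε
      exact div_pos (Set.mem_Ioi.1 hε) (by norm_num)
  refine (((tendsto_abelIntegral_regularization hd σ hm φ).comp hlim).const_mul
    (-negIUnit σ)).congr' ?_
  filter_upwards [self_mem_nhdsWithin] with ε hε
  rw [Function.comp_apply, ← integral_besselU_eq_abelIntegral hd σ hm
    (div_pos (Set.mem_Ioi.1 hε) (by norm_num)) φ, integral_const_mul, propagatorConst_eq hd σ hm]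
  ring

end


/-! ### The limit as a tempered distribution. -/

theorem tendsto_integral_norm_zero {d : ℕ}
    (A : 𝓢(Minkowski d, ℂ) →L[ℂ] 𝓢(Minkowski d, ℂ)) :
    Tendsto (fun φ : 𝓢(Minkowski d, ℂ) => ∫ x, ‖A φ x‖) (𝓝 0) (𝓝 0) := by
  have h : Continuous fun φ : 𝓢(Minkowski d, ℂ) => ‖(A φ).toLp 1 volume‖ :=
    (SchwartzMap.continuous_toLp.comp A.continuous).norm
  simp only [SchwartzMap.norm_toLp_one] at h
  simpa using h.tendsto 0

section

variable {d : ℕ} [NeZero d]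

/-- The inverse of `minkowskiTransform`. -/
def minkowskiTransformInv (d : ℕ) [NeZero d] : 𝓢(Minkowski d, ℂ) →L[ℂ] 𝓢(Minkowski d, ℂ) :=
  ((2 * Real.pi : ℂ) ^ d) •
    (FourierTransform.fourierCLM ℂ 𝓢(Minkowski d, ℂ)).comp
      (SchwartzMap.compCLMOfContinuousLinearEquiv ℂ (minkowskiRescale d).symm)

theorem two_pi_pow_ne_zero (d : ℕ) : ((2 * Real.pi : ℂ) ^ d) ≠ 0 :=
  pow_ne_zero _ (mul_ne_zero two_ne_zero (Complex.ofReal_ne_zero.2 Real.pi_ne_zero))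

theorem minkowskiTransform_minkowskiTransformInv (ψ : 𝓢(Minkowski d, ℂ)) :
    minkowskiTransform d (minkowskiTransformInv d ψ) = ψ := by
  ext p
  have h := two_pi_pow_ne_zero d
  simp [minkowskiTransform, minkowskiTransformInv, h]

theorem minkowskiTransformInv_minkowskiTransform (φ : 𝓢(Minkowski d, ℂ)) :
    minkowskiTransformInv d (minkowskiTransform d φ) = φ := by
  have h := two_pi_pow_ne_zero d
  have e : ∀ ψ : 𝓢(Minkowski d, ℂ),
      SchwartzMap.compCLMOfContinuousLinearEquiv ℂ (minkowskiRescale d).symm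
        (SchwartzMap.compCLMOfContinuousLinearEquiv ℂ (minkowskiRescale d) ψ) = ψ := by
    intro ψ; ext x; simp
  ext p
  simp [minkowskiTransform, minkowskiTransformInv, h, e]

/-- Additivity is inherited from the integrals at ε > 0 by uniqueness of limits. -/
theorem propagatorValue_add (hd : 2 ≤ d) (σ : ℤˣ) {m : ℝ} (hm : 0 < m)
    (φ₁ φ₂ : 𝓢(Minkowski d, ℂ)) :
    propagatorValue σ m (φ₁ + φ₂) = propagatorValue σ m φ₁ + propagatorValue σ m φ₂ := by
  refine tendsto_nhds_unique (tendsto_integral_resolvent hd σ hm (φ₁ + φ₂))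
    (((tendsto_integral_resolvent hd σ hm φ₁).add
      (tendsto_integral_resolvent hd σ hm φ₂)).congr' ?_)
  filter_upwards [self_mem_nhdsWithin] with ε hε
  rw [← integral_add (integral_resolvent_mul σ m hε _).1 (integral_resolvent_mul σ m hε _).1]
  simp only [map_add, add_apply, mul_add]

theorem propagatorValue_smul (hd : 2 ≤ d) (σ : ℤˣ) {m : ℝ} (hm : 0 < m) (c : ℂ)
    (φ : 𝓢(Minkowski d, ℂ)) :
    propagatorValue σ m (c • φ) = c * propagatorValue σ m φ := by
  refine tendsto_nhds_unique (tendsto_integral_resolvent hd σ hm (c • φ))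
    (((tendsto_integral_resolvent hd σ hm φ).const_mul c).congr fun ε => ?_)
  rw [← integral_const_mul]
  simp only [map_smul, smul_apply, smul_eq_mul, mul_left_comm c]

theorem norm_propagatorValue_le (hd : 2 ≤ d) (σ : ℤˣ) (m : ℝ) (φ : 𝓢(Minkowski d, ℂ)) :
    ‖propagatorValue σ m φ‖ ≤ (∫ p, ‖minkowskiTransform d φ p‖) +
      ‖negIUnit σ * (m : ℂ) ^ 2‖⁻¹ * ((∫ p, ‖minkowskiTransform d φ p‖) +
        ‖gaussianPhase d σ‖ * (d / 2 * (∫ x, ‖φ x‖) + ∫ x, ‖mulMinkowskiSq d φ x‖)) := by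
  have h := re_add_negIUnit_mul_sq σ m 0
  rw [Complex.ofReal_zero, zero_add] at h
  rw [propagatorValue, norm_mul, norm_neg, norm_negIUnit, one_mul]
  exact norm_abelIntegral_le (fun s _ => norm_minkowskiEvolution_le σ _ s)
    (fun _ hs => norm_minkowskiEvolutionDeriv_le hd σ φ hs) h.ge

/-- The propagator, as a continuous linear functional on Schwartz functions. -/
def propagator (hd : 2 ≤ d) (σ : ℤˣ) {m : ℝ} (hm : 0 < m) : 𝓢'(Minkowski d, ℂ) :=
  ContinuousLinearMap.toPointwiseConvergenceCLM _ _ _ _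
    { toFun := propagatorValue σ m
      map_add' := propagatorValue_add hd σ hm
      map_smul' := propagatorValue_smul hd σ hm
      cont := by
        let T : 𝓢(Minkowski d, ℂ) →ₗ[ℂ] ℂ :=
          { toFun := propagatorValue σ m
            map_add' := propagatorValue_add hd σ hm
            map_smul' := propagatorValue_smul hd σ hm }
        refine continuous_of_continuousAt_zero T ?_
        rw [ContinuousAt, map_zero]
        refine squeeze_zero_norm (norm_propagatorValue_le hd σ m) ?_
        have h1 := tendsto_integral_norm_zero (minkowskiTransform d)
        have h2 := tendsto_integral_norm_zero (ContinuousLinearMap.id ℂ 𝓢(Minkowski d, ℂ))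
        have h3 := tendsto_integral_norm_zero (mulMinkowskiSq d)
        have := h1.add ((h1.add (((h2.const_mul ((d : ℝ) / 2)).add h3).const_mul
          ‖gaussianPhase d σ‖)).const_mul ‖negIUnit σ * (m : ℂ) ^ 2‖⁻¹)
        simp only [mul_zero, add_zero] at this
        exact this }

theorem propagator_apply (hd : 2 ≤ d) (σ : ℤˣ) {m : ℝ} (hm : 0 < m) (φ : 𝓢(Minkowski d, ℂ)) :
    propagator hd σ hm φ = propagatorValue σ m φ := rfl

theorem isTachyonicPropagator_propagator (hd : 2 ≤ d) (σ : ℤˣ) {m : ℝ} (hm : 0 < m) :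
    IsTachyonicPropagator σ m (propagator (d := d) hd σ hm) := by
  -- The momentum-space limit was computed only against transforms; since the transform is
  -- invertible, every Schwartz function is one.
  refine ⟨PointwiseConvergenceCLM.precomp ℂ (minkowskiTransformInv d) (propagator hd σ hm),
    fun ψ => ⟨fun ε hε => (integral_resolvent_mul σ m hε ψ).1, ?_⟩, ?_⟩
  · have := tendsto_integral_resolvent hd σ hm (minkowskiTransformInv d ψ)
    rwa [minkowskiTransform_minkowskiTransformInv] at this
  · ext φ
    rw [minkowskiFourierInv_apply]
    change _ = propagator hd σ hm (minkowskiTransformInv d (minkowskiTransform d φ))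
    rw [minkowskiTransformInv_minkowskiTransform]

theorem isDistributionalLimit_propagator (hd : 2 ≤ d) (σ : ℤˣ) {m : ℝ} (hm : 0 < m) :
    IsDistributionalLimit (fun ε x => propagatorConst d σ m * besselU (besselOrder d)
      ((m : ℂ) ^ 2 * (-(minkowskiSq x : ℂ) - ((σ : ℤ) : ℂ) * I * ε) / 4))
      (propagator (d := d) hd σ hm) :=
  fun φ => tendsto_integral_besselU hd σ hm φ

end


/-! ### The propagators away from the light cone. -/

theorem tendsto_besselU_boundary (α : ℝ) (σ : ℤˣ) {q : ℝ} (hq : q ≠ 0) :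
    Tendsto (fun ε : ℝ => besselU α (-q - ((σ : ℤ) : ℂ) * I * ε)) (𝓝[>] 0)
      (𝓝 (besselUExt α σ (negIUnit σ * q))) := by
  have hc : ContinuousOn (fun ε : ℝ => besselUExt α σ (ε + negIUnit σ * q)) (Set.Ici 0) := by
    refine (continuousOn_besselUExt α σ).comp (Continuous.continuousOn (by fun_prop))
      fun ε hε => ⟨?_, fun h => ?_⟩
    · rw [Complex.add_re, Complex.re_mul_ofReal, negIUnit_re, Complex.ofReal_re]
      simpa using hε
    · have h' := congrArg Complex.im h
      rw [Complex.add_im, Complex.im_mul_ofReal, Complex.ofReal_im, zero_add] at h'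
      exact mul_ne_zero (negIUnit_im_ne_zero σ) hq h'
  have h0 := (hc 0 Set.self_mem_Ici).mono_left (nhdsWithin_mono _ Set.Ioi_subset_Ici_self)
  simp only [Complex.ofReal_zero, zero_add] at h0
  refine h0.congr' ?_
  filter_upwards [self_mem_nhdsWithin] with ε hε
  rw [besselUExt_eq α σ (by rw [Complex.add_re, Complex.re_mul_ofReal, negIUnit_re]; simpa using hε),
    sub_eq_negIUnit_mul]
  congr 2
  ring

/-- For q < 0 the limit point -q = |q| is off the cut, so continuity of U_α gives a second
evaluation of the same limit. -/
theorem besselUExt_negIUnit_mul_of_neg (α : ℝ) (σ : ℤˣ) {q : ℝ} (hq : q < 0) :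
    besselUExt α σ (negIUnit σ * q) = besselU α ((|q| : ℝ) : ℂ) := by
  refine tendsto_nhds_unique (tendsto_besselU_boundary α σ hq.ne) ?_
  have hc : Continuous fun ε : ℝ => -(q : ℂ) - ((σ : ℤ) : ℂ) * I * ε := by fun_prop
  have h1 := (hc.tendsto 0).mono_left (nhdsWithin_le_nhds (s := Set.Ioi 0))
  have e : -(q : ℂ) - ((σ : ℤ) : ℂ) * I * (0 : ℝ) = ((|q| : ℝ) : ℂ) := by
    rw [abs_of_neg hq]; push_cast; ring
  rw [e] at h1
  have hs : ((|q| : ℝ) : ℂ) ∈ slitPlane := by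
    rw [Complex.ofReal_mem_slitPlane]; exact abs_pos.2 hq.ne
  exact ((continuousOn_besselU α).continuousAt (isOpen_slitPlane.mem_nhds hs)).tendsto.comp h1

theorem exp_pow_eq_negIUnit_pow {d : ℕ} (hd : 2 ≤ d) (σ : ℤˣ) :
    cexp (-((σ : ℤ) : ℂ) * I * Real.pi * ((d : ℂ) / 2 - 1)) = negIUnit σ ^ (d - 2) := by
  have h : cexp (-((σ : ℤ) : ℂ) * I * (Real.pi / 2)) = negIUnit σ := by
    rcases Int.units_eq_one_or σ with rfl | rfl
    · have := Complex.exp_log (neg_ne_zero.2 I_ne_zero)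
      rw [Complex.log_neg_I] at this
      rw [negIUnit]
      convert this using 2 <;> push_cast <;> ring
    · have := Complex.exp_log I_ne_zero
      rw [Complex.log_I] at this
      rw [negIUnit]
      convert this using 2 <;> push_cast <;> ring
  rw [← h, ← Complex.exp_nat_mul, Nat.cast_sub hd]
  congr 1
  push_cast; ring

/-- Since e^{-iσπ/2} = c, the exponential is c^{d-2}, and iσ c^{d-2} = -c·c^{d-2} = c^{d+1}. -/
theorem propagatorConst_eq_exp {d : ℕ} (hd : 2 ≤ d) (σ : ℤˣ) (m : ℝ) :
    ((σ : ℤ) : ℂ) * I * (√Real.pi : ℂ) * (m : ℂ) ^ (d - 2) *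
      cexp (-((σ : ℤ) : ℂ) * I * Real.pi * ((d : ℂ) / 2 - 1)) /
      (((4 * Real.pi) ^ ((d : ℝ) / 2) : ℝ) : ℂ) = propagatorConst d σ m := by
  have h : ((σ : ℤ) : ℂ) * I = -negIUnit σ := by rw [negIUnit]; ring
  rw [exp_pow_eq_negIUnit_pow hd, propagatorConst, h]
  change _ = (√Real.pi : ℂ) * (m : ℂ) ^ (d - 2) * negIUnit σ ^ (d + 1) / _
  rw [negIUnit_pow_add_one hd]
  ring

theorem IsGivenOn.congr {d : ℕ} {T : 𝓢'(Minkowski d, ℂ)} {Ω Ω' : Set (Minkowski d)}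
    {f g : Minkowski d → ℂ} (h : IsGivenOn T Ω f) (hΩ : Ω' ⊆ Ω) (hfg : ∀ x ∈ Ω', f x = g x) :
    IsGivenOn T Ω' g := by
  intro φ hφ hφs
  have e : (fun x => f x * φ x) = fun x => g x * φ x := by
    funext x
    by_cases hx : x ∈ tsupport φ
    · rw [hfg x (hφs hx)]
    · simp [image_eq_zero_of_notMem_tsupport hx]
  rw [← e]
  exact h φ hφ (hφs.trans hΩ)

section

variable {d : ℕ} [NeZero d]

/-- The function representing the propagator away from the light cone. -/
def propagatorFun (σ : ℤˣ) (m : ℝ) (x : Minkowski d) : ℂ :=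
  propagatorConst d σ m *
    besselUExt (besselOrder d) σ (negIUnit σ * ((m ^ 2 * minkowskiSq x / 4 : ℝ) : ℂ))

theorem continuousOn_besselUExt_regularized (σ : ℤˣ) {m : ℝ} (hm : 0 < m) :
    ContinuousOn (fun z : ℝ × Minkowski d => besselUExt (besselOrder d) σ
      ((m ^ 2 * (z.1 / 4) : ℝ) + negIUnit σ * ((m ^ 2 * minkowskiSq z.2 / 4 : ℝ) : ℂ)))
      (Set.Ici 0 ×ˢ {x | minkowskiSq x ≠ 0}) := by
  have hq := continuous_minkowskiSq (d := d)
  refine (continuousOn_besselUExt _ σ).comp (Continuous.continuousOn (by fun_prop))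
    fun z hz => ⟨?_, fun h => ?_⟩
  · rw [Complex.add_re, Complex.re_mul_ofReal, negIUnit_re, Complex.ofReal_re, zero_mul, add_zero]
    have := Set.mem_Ici.1 hz.1
    positivity
  · have h' := congrArg Complex.im h
    rw [Complex.add_im, Complex.im_mul_ofReal, Complex.ofReal_im, zero_add] at h'
    have hz2 : minkowskiSq z.2 ≠ 0 := hz.2
    exact mul_ne_zero (negIUnit_im_ne_zero σ) (by positivity) h'

theorem continuousOn_propagatorFun (σ : ℤˣ) {m : ℝ} (hm : 0 < m) :
    ContinuousOn (propagatorFun (d := d) σ m) {x | minkowskiSq x ≠ 0} := by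
  have h := (continuousOn_besselUExt_regularized (d := d) σ hm).comp
    (f := fun x : Minkowski d => ((0 : ℝ), x)) (Continuous.continuousOn (by fun_prop))
    (fun x hx => ⟨Set.self_mem_Ici, hx⟩)
  refine ((continuousOn_const (c := propagatorConst d σ m)).mul h).congr fun x _ => ?_
  simp [propagatorFun]

/-- The regularized functions are jointly continuous in (ε, x) down to ε = 0 off the cone.
Compactness of [0, 1] × supp φ then gives a uniform bound for dominated convergence. -/
theorem isGivenOn_propagatorFun (hd : 2 ≤ d) (σ : ℤˣ) {m : ℝ} (hm : 0 < m) :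
    IsGivenOn (propagator (d := d) hd σ hm) {x | minkowskiSq x ≠ 0} (propagatorFun σ m) := by
  intro φ hφ hφs
  have hc := continuousOn_propagatorFun (d := d) σ hm
  have hsupp : Function.support (fun x => propagatorFun σ m x * φ x) ⊆ tsupport φ :=
    fun x hx => subset_tsupport _ (right_ne_zero_of_mul hx)
  have hint : Integrable fun x => propagatorFun σ m x * φ x :=
    (integrableOn_iff_integrable_of_support_subset hsupp).1
      (((hc.mono hφs).mul φ.continuous.continuousOn).integrableOn_compact hφ)
  refine ⟨hint, ?_⟩
  have hK : IsCompact (Set.Icc (0 : ℝ) 1 ×ˢ tsupport φ) := isCompact_Icc.prod hφ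
  obtain ⟨C, hC⟩ := hK.exists_bound_of_continuousOn
    ((continuousOn_besselUExt_regularized (d := d) σ hm).mono
      (Set.prod_mono (fun ε hε => hε.1) hφs))
  obtain ⟨hi, hl⟩ := tendsto_integral_besselU hd σ hm φ
  have hH : ∀ ε : ℝ, 0 < ε → ∀ x : Minkowski d, besselU (besselOrder d)
      ((m : ℂ) ^ 2 * (-(minkowskiSq x : ℂ) - ((σ : ℤ) : ℂ) * I * ε) / 4) =
      besselUExt (besselOrder d) σ
        ((m ^ 2 * (ε / 4) : ℝ) + negIUnit σ * ((m ^ 2 * minkowskiSq x / 4 : ℝ) : ℂ)) := by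
    intro ε hε x
    rw [regularizedSq_eq, besselUExt_eq]
    · congr 1; push_cast; ring
    · rw [Complex.add_re, Complex.re_mul_ofReal, negIUnit_re, Complex.ofReal_re, zero_mul, add_zero]
      positivity
  rw [propagator_apply]
  refine tendsto_nhds_unique hl (tendsto_integral_filter_of_dominated_convergence
    (fun x => ‖propagatorConst d σ m‖ * C * ‖φ x‖) ?_ ?_ (φ.integrable.norm.const_mul _) ?_)
  · filter_upwards [self_mem_nhdsWithin] with ε hε
    exact (hi ε hε).aestronglyMeasurable
  · filter_upwards [Ioc_mem_nhdsGT (zero_lt_one (α := ℝ))] with ε hε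
    refine Eventually.of_forall fun x => ?_
    by_cases hx : x ∈ tsupport φ
    · rw [hH ε hε.1, norm_mul, norm_mul]
      gcongr
      exact hC (ε, x) ⟨⟨hε.1.le, hε.2⟩, hx⟩
    · simp [image_eq_zero_of_notMem_tsupport hx]
  · refine Eventually.of_forall fun x => ?_
    by_cases hx : x ∈ tsupport φ
    · refine Tendsto.mul_const _ (Tendsto.const_mul _ ?_)
      have h0 := (continuousOn_besselUExt_regularized (d := d) σ hm).comp
        (f := fun ε : ℝ => (ε, x)) (s := Set.Ici 0) (Continuous.continuousOn (by fun_prop))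
        (fun ε hε => ⟨hε, hφs hx⟩) 0 Set.self_mem_Ici
      have h1 := h0.tendsto.mono_left (nhdsWithin_mono _ Set.Ioi_subset_Ici_self)
      simp only [Function.comp_apply, zero_div, mul_zero, Complex.ofReal_zero, zero_add] at h1
      refine h1.congr' ?_
      filter_upwards [self_mem_nhdsWithin] with ε hε
      exact (hH ε hε x).symm
    · simp [image_eq_zero_of_notMem_tsupport hx]

theorem isGivenOn_spacelike (hd : 2 ≤ d) (σ : ℤˣ) {m : ℝ} (hm : 0 < m) :
    IsGivenOn (propagator (d := d) hd σ hm) {x | 0 < minkowskiSq x} (fun x =>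
      propagatorConst d σ m * besselUExt (besselOrder d) σ
        (negIUnit σ * ((-(m ^ 2 * -minkowskiSq x / 4) : ℝ) : ℂ))) := by
  refine (isGivenOn_propagatorFun hd σ hm).congr (fun x hx => ne_of_gt hx)
    fun x _ => ?_
  rw [propagatorFun]
  congr 5
  ring

theorem isGivenOn_timelike (hd : 2 ≤ d) (σ : ℤˣ) {m : ℝ} (hm : 0 < m) :
    IsGivenOn (propagator (d := d) hd σ hm) {x | minkowskiSq x < 0} (fun x =>
      propagatorConst d σ m *
        besselU (besselOrder d) ((m ^ 2 * |minkowskiSq x| / 4 : ℝ) : ℂ)) := by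
  refine (isGivenOn_propagatorFun hd σ hm).congr (fun x hx => ne_of_lt hx)
    fun x hx => ?_
  have hx' : minkowskiSq x < 0 := hx
  rw [propagatorFun, besselUExt_negIUnit_mul_of_neg _ σ (by
    have : m ^ 2 * minkowskiSq x < 0 := mul_neg_of_pos_of_neg (by positivity) hx'
    linarith)]
  congr 3
  rw [abs_div, abs_mul, abs_of_nonneg (sq_nonneg m), abs_of_pos (four_pos (α := ℝ))]

end


/-! ### Failure of causal support. -/

theorem propagatorConst_ne_zero (d : ℕ) (σ : ℤˣ) {m : ℝ} (hm : 0 < m) :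
    propagatorConst d σ m ≠ 0 := by
  have h1 : (√Real.pi : ℂ) ≠ 0 := Complex.ofReal_ne_zero.2 (Real.sqrt_pos.2 Real.pi_pos).ne'
  have h2 : (((4 * Real.pi) ^ ((d : ℝ) / 2) : ℝ) : ℂ) ≠ 0 :=
    Complex.ofReal_ne_zero.2 (Real.rpow_pos_of_pos (by positivity) _).ne'
  have h3 : (m : ℂ) ≠ 0 := Complex.ofReal_ne_zero.2 hm.ne'
  exact div_ne_zero (mul_ne_zero (mul_ne_zero h1 (pow_ne_zero _ h3))
    (pow_ne_zero _ (negIUnit_ne_zero σ))) h2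

section

variable {d : ℕ} [NeZero d]

theorem minkowskiSq_single {i : Fin d} (hi : i ≠ 0) (r : ℝ) :
    minkowskiSq (EuclideanSpace.single i r) = r ^ 2 := by
  rw [minkowskiSq, minkowskiProd, Finset.sum_eq_single i]
  · simp [minkowskiSign, hi, sq]
  · intro j _ hj
    simp [hj]
  · simp

theorem exists_spacelike_propagatorFun_add_ne_zero (hd : 2 ≤ d) {m : ℝ} (hm : 0 < m) :
    ∃ x : Minkowski d, 0 < minkowskiSq x ∧ propagatorFun 1 m x + propagatorFun (-1) m x ≠ 0 := by
  set α := besselOrder d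
  have hπ : (1 / (√Real.pi : ℂ)) ≠ 0 :=
    one_div_ne_zero (Complex.ofReal_ne_zero.2 (Real.sqrt_pos.2 Real.pi_pos).ne')
  have hpow : ∀ {z : ℂ} (s : ℂ), z ≠ 0 → z ^ s ≠ 0 := fun s hz h =>
    hz ((Complex.cpow_eq_zero_iff _ _).1 h).1
  set k : ℤˣ → ℂ := fun σ => propagatorConst d σ m *
    ((1 / (√Real.pi : ℂ)) * (negIUnit σ ^ (-(α : ℂ) / 2) * negIUnit σ ^ (-(α : ℂ) / 2))) with hk
  have hk0 : k (-1) ≠ 0 := by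
    have := hpow (-(α : ℂ) / 2) (negIUnit_ne_zero (-1))
    exact mul_ne_zero (propagatorConst_ne_zero d _ hm) (mul_ne_zero hπ (mul_ne_zero this this))
  obtain ⟨y, hy, hne⟩ := exists_macdonaldExt_combination_ne_zero α (k₁ := k 1) hk0
  have h1 : (⟨1, hd⟩ : Fin d) ≠ 0 := fun h => by simpa using congrArg Fin.val h
  -- The point lies on a space axis, which exists because d ≥ 2; the length 2y/m puts the argument
  -- of U_α at -y².
  have hsq : m ^ 2 * minkowskiSq (EuclideanSpace.single (⟨1, hd⟩ : Fin d) (2 * y / m)) / 4 =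
      y ^ 2 := by
    rw [minkowskiSq_single h1]; field_simp; ring
  refine ⟨EuclideanSpace.single ⟨1, hd⟩ (2 * y / m), ?_, ?_⟩
  · rw [minkowskiSq_single h1]; positivity
  · rw [propagatorFun, propagatorFun, hsq, besselUExt_negIUnit_mul_sq _ _ hy,
      besselUExt_negIUnit_mul_sq _ _ hy]
    have hy0 : ((y ^ 2 : ℝ) : ℂ) ^ (-(α : ℂ) / 2) ≠ 0 :=
      hpow _ (Complex.ofReal_ne_zero.2 (by positivity))
    refine fun h => mul_ne_zero hy0 hne (Eq.trans ?_ h)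
    simp only [hk]
    ring

/-- If every real test function supported in s gave zero, the representing function would vanish
almost everywhere on the spacelike part of s, hence everywhere there by continuity, in particular at
x. -/
theorem exists_test_propagator_add_ne_zero (hd : 2 ≤ d) {m : ℝ} (hm : 0 < m) {x : Minkowski d}
    (hx : 0 < minkowskiSq x) (hne : propagatorFun 1 m x + propagatorFun (-1) m x ≠ 0)
    {s : Set (Minkowski d)} (hs : IsOpen s) (hxs : x ∈ s) :
    ∃ φ : 𝓓((⊤ : TopologicalSpace.Opens (Minkowski d)), ℝ), tsupport φ ⊆ s ∧
      (propagator hd 1 hm + propagator hd (-1) hm) (testToSchwartz φ) ≠ 0 := by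
  by_contra! hcon
  have hU : IsOpen (s ∩ {x : Minkowski d | 0 < minkowskiSq x}) :=
    hs.inter (isOpen_lt continuous_const continuous_minkowskiSq)
  have hsub : s ∩ {x : Minkowski d | 0 < minkowskiSq x} ⊆ {x | minkowskiSq x ≠ 0} :=
    fun x hx => ne_of_gt hx.2
  have hc : ContinuousOn (fun x : Minkowski d => propagatorFun 1 m x + propagatorFun (-1) m x)
      (s ∩ {x : Minkowski d | 0 < minkowskiSq x}) :=
    ((continuousOn_propagatorFun 1 hm).add (continuousOn_propagatorFun (-1) hm)).mono hsub
  have hae := hU.ae_eq_zero_of_integral_contDiff_smul_eq_zero (μ := volume)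
    (hc.locallyIntegrableOn hU.measurableSet) fun g hg hgc hgs => by
      have hφ := hcon ⟨g, hg, hgc, fun _ _ => trivial⟩ (hgs.trans Set.inter_subset_left)
      set φ : 𝓢(Minkowski d, ℂ) := testToSchwartz ⟨g, hg, hgc, fun _ _ => trivial⟩ with hφdef
      have hφg : ∀ x, φ x = (g x : ℂ) := fun x => rfl
      have hts : tsupport φ ⊆ tsupport g :=
        tsupport_comp_subset (g := fun r : ℝ => (r : ℂ)) Complex.ofReal_zero g
      have hcs : HasCompactSupport φ := hgc.mono' (subset_tsupport _ |>.trans hts)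
      have e1 := isGivenOn_propagatorFun hd 1 hm φ hcs (hts.trans (hgs.trans hsub))
      have e2 := isGivenOn_propagatorFun hd (-1) hm φ hcs (hts.trans (hgs.trans hsub))
      change propagator hd 1 hm φ + propagator hd (-1) hm φ = 0 at hφ
      rw [e1.2, e2.2, ← integral_add e1.1 e2.1] at hφ
      rw [← hφ]
      refine integral_congr_ae (Eventually.of_forall fun x => ?_)
      simp only [hφg, Complex.real_smul]
      ring
  have h0 := Measure.eqOn_open_of_ae_eq (μ := volume) (g := fun _ => (0 : ℂ))
    ((ae_restrict_iff' hU.measurableSet).2 hae) hU hc continuousOn_const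
  exact hne (h0 ⟨hxs, hx⟩)

end

end

/-! ### Assembly of the theorem. -/

theorem mainTheorem9 (d : ℕ) [NeZero d] (hd : 2 ≤ d) (m : ℝ) (hm : 0 < m) :
    ∃ G : ℤˣ → 𝓢'(Minkowski d, ℂ),
      (∀ σ : ℤˣ,
        IsTachyonicPropagator σ m (G σ) ∧
        IsDistributionalLimit
          (fun ε x =>
            (√Real.pi : ℂ) * (m : ℂ) ^ (d - 2) * (-((σ : ℤ) : ℂ) * I) ^ (d + 1) /
                (((4 * Real.pi) ^ ((d : ℝ) / 2) : ℝ) : ℂ) *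
              besselU ((d : ℂ) / 2 - 1)
                ((m : ℂ) ^ 2 * (-(minkowskiSq x : ℂ) - ((σ : ℤ) : ℂ) * I * ε) / 4))
          (G σ) ∧
        (∃ u : ℝ → ℂ,
          (∀ w : ℝ, w < 0 →
            Tendsto (fun ε : ℝ => besselU ((d : ℂ) / 2 - 1) (w - ((σ : ℤ) : ℂ) * I * ε))
              (𝓝[>] 0) (𝓝 (u w))) ∧
          IsGivenOn (G σ) {x | 0 < minkowskiSq x} (fun x =>
            ((σ : ℤ) : ℂ) * I * (√Real.pi : ℂ) * (m : ℂ) ^ (d - 2) *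
                cexp (-((σ : ℤ) : ℂ) * I * Real.pi * ((d : ℂ) / 2 - 1)) /
                (((4 * Real.pi) ^ ((d : ℝ) / 2) : ℝ) : ℂ) *
              u (m ^ 2 * -minkowskiSq x / 4))) ∧
        IsGivenOn (G σ) {x | minkowskiSq x < 0} (fun x =>
          ((σ : ℤ) : ℂ) * I * (√Real.pi : ℂ) * (m : ℂ) ^ (d - 2) *
              cexp (-((σ : ℤ) : ℂ) * I * Real.pi * ((d : ℂ) / 2 - 1)) /
              (((4 * Real.pi) ^ ((d : ℝ) / 2) : ℝ) : ℂ) *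
            besselU ((d : ℂ) / 2 - 1) ((m ^ 2 * |minkowskiSq x| / 4 : ℝ) : ℂ))) ∧
      ¬ Distribution.dsupport (G 1 + G (-1)) ⊆ futureCone d ∪ pastCone d ∧
      ∀ Gf Gb : 𝓓'((⊤ : TopologicalSpace.Opens (Minkowski d)), ℂ),
        IsForwardGreen m Gf → IsBackwardGreen m Gb →
          ∃ φ : 𝓓((⊤ : TopologicalSpace.Opens (Minkowski d)), ℝ),
            (G 1 + G (-1)) (testToSchwartz φ) ≠ (Gf + Gb) φ := by

  have hord := ofReal_besselOrder d
  obtain ⟨x, hx, hne⟩ := exists_spacelike_propagatorFun_add_ne_zero hd hm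
  have hxf : x ∉ futureCone d := fun h => absurd h.1 (not_le.2 hx)
  have hxp : x ∉ pastCone d := fun h => absurd h.1 (not_le.2 hx)
  refine ⟨fun σ => propagator hd σ hm, fun σ => ⟨isTachyonicPropagator_propagator hd σ hm, ?_,
    ⟨fun w => besselUExt (besselOrder d) σ (negIUnit σ * ((-w : ℝ) : ℂ)), fun w hw => ?_, ?_⟩, ?_⟩,
    fun hsub => ?_, fun Gf Gb hf hb => ?_⟩
  · rw [← hord]
    exact isDistributionalLimit_propagator hd σ hm
  · have := tendsto_besselU_boundary (besselOrder d) σ (neg_ne_zero.2 hw.ne)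
    simp only [hord, Complex.ofReal_neg, neg_neg] at this ⊢
    exact this
  · simp only [propagatorConst_eq_exp hd]
    exact isGivenOn_spacelike hd σ hm
  · have := isGivenOn_timelike (d := d) hd σ hm
    simpa only [propagatorConst_eq_exp hd, hord] using this
  · refine (hsub (Distribution.mem_dsupport_iff_forall_exists_ne x |>.2 fun s hxs hs => ?_)).elim
      hxf hxp
    obtain ⟨φ, hφs, hφ⟩ := exists_test_propagator_add_ne_zero hd hm hx hne hs hxs
    exact ⟨testToSchwartz φ, (tsupport_comp_subset (g := fun r : ℝ => (r : ℂ))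
      Complex.ofReal_zero φ).trans hφs, hφ⟩
  -- Only the support conditions on the two Green functions matter: both vanish near the spacelike
  -- point x, and a test function in the common neighbourhood detects the propagators.
  · obtain ⟨s, hs, hso, hxs⟩ := (Distribution.notMem_dsupport_iff x).1 fun h => hxf (hf.2 h)
    obtain ⟨t, ht, hto, hxt⟩ := (Distribution.notMem_dsupport_iff x).1 fun h => hxp (hb.2 h)
    obtain ⟨φ, hφs, hφ⟩ :=
      exists_test_propagator_add_ne_zero hd hm hx hne (hso.inter hto) ⟨hxs, hxt⟩
    refine ⟨φ, ?_⟩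
    have h0 : (Gf + Gb) φ = 0 := by
      change Gf φ + Gb φ = 0
      rw [hs φ (hφs.trans Set.inter_subset_left), ht φ (hφs.trans Set.inter_subset_right), add_zero]
    rw [h0]
    exact hφ
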